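/- **Definitions.** A (generalized) allowable sequence on $n$ elements is a sequence of permutations $\pi_0,\dots,\pi_k$ of $[n]$ such that any two consecutive permutations differ by a move, i.e. the reversal of one or more pairwise disjoint substrings of length at least two, and every pair of elements is reversed exactly once in the sequence. It is simple if each move swaps two adjacent elements. It is realizable if there is a planar point set $p_1,\dots,p_n$ (a realization) for which the orders of the orthogonal projections onto an oriented line rotating counterclockwise by $180^\circ$ are successively $\pi_0,\dots,\pi_k$. Identify the $t$-th move with a point $o_t$ on the line at infinity. The line through an element $a$ and $o_t$ consists of $o_t$, $a$ and all elements that are reversed with $a$ in move $t$; it is spanned by a set $Q$ of elements if two elements of $Q$ on it are reversed in move $t$. The point $o_t$ is active if it lies on at least two lines spanned by the elements. For an ordering $p_1,\dots,p_n$ of the elements let $O_{i-1}$ be the set of active points that lie on a line spanned by $\{p_1,\dots,p_{i-1}\}$, and let $S_{i-1}=\{p_1,\dots,p_{i-1}\}\cup O_{i-1}$. The ordering is a constructibility order if each $p_i$ lies on at most two lines, other than the line at infinity, spanned by two points of $S_{i-1}$. An allowable sequence is constructible if it has a constructibility order. **Statement.** Let $A$ be a constructible allowable sequence on $n$ elements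 and let $p_1,\dots,p_n$ be a constructibility order of $A$. Then there are a simple allowable sequence $A'$ on $m$ elements, for some $m$, and a map $f:[m]\to[n]$ ("$a$ replaces $f(a)$") such that: 1. $A'$ is realizable if and only if $A$ is realizable. 2. An element $p_i$ that lies on no line spanned by $S_{i-1}$ is replaced by exactly one element, and an element $p_i$ that lies on one or two such lines is replaced by exactly four elements. 3. $A'$ is a perturbation of $A$: if $f(a)\ne f(b)$, then $a$ precedes $b$ in the first permutation of $A'$ if and only if $f(a)$ precedes $f(b)$ in the first permutation of $A$; and if $f(a)\neq f(b)$, $f(c)\neq f(d)$ and $A$ reverses the pair $f(a),f(b)$ in an earlier move than the pair $f(c),f(d)$, then $A'$ reverses $a,b$ in an earlier move than $c,d$. 4. For every realization of $A$ and every $\varepsilon>0$ there is a realization of $A'$ in which every $p_i$ that is replaced by one element keeps its place, and every $p_i$ that is replaced by four elements lies in the interior of the convex hull of the four new points, which have distance less than $\varepsilon$ from $p_i$ and, in a suitable order, form a perturbed parallelogram $v_0,v_1,v_2,v_3$: the vectors $v_1-v_0$ and $v_3-v_0$ are linearly independent, and $v_2=v_0+\alpha(v_1-v_0)+\beta(v_3-v_0)$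 with $|\alpha-1|<\varepsilon$ and $|\beta-1|<\varepsilon$. 5. For every realization of $A'$ there is a realization of $A$ in which every $p_i$ that is replaced by one element is the point of that element, and for every $p_i$ that is replaced by four elements the four points are in convex position and $p_i$ lies in the interior of their convex hull. -/

import Mathlib

/-- Two permutations, given as maps `element ↦ position`, differ by one (generalized) move:
a nonempty family of pairwise disjoint substrings, given by their first and last positions and each
of length at least two, is reversed, and every other element keeps its position. -/
def IsMove {n : ℕ} (σ τ : Equiv.Perm (Fin n)) : Prop :=
  ∃ I : Finset (Fin n × Fin n), I.Nonempty ∧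
    (∀ J ∈ I, J.1 < J.2) ∧
    (∀ J ∈ I, ∀ K ∈ I, J ≠ K → Disjoint (Set.Icc J.1 J.2) (Set.Icc K.1 K.2)) ∧
    (∀ J ∈ I, ∀ a, σ a ∈ Set.Icc J.1 J.2 →
      ((τ a : ℕ) + (σ a : ℕ) = (J.1 : ℕ) + (J.2 : ℕ))) ∧
    (∀ a, (∀ J ∈ I, σ a ∉ Set.Icc J.1 J.2) → τ a = σ a)

/-- The elements `a` and `b` stand in opposite orders in the permutations `σ` and `τ`. -/
def Reversed {n : ℕ} (σ τ : Equiv.Perm (Fin n)) (a b : Fin n) : Prop :=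
  a ≠ b ∧ (σ a < σ b ↔ τ b < τ a)

/-- A (generalized) allowable sequence on `n` elements with `k` moves, that is, `k + 1`
permutations. `pos t a` is the position of the element `a` in the `t`-th permutation. -/
structure AllowableSeq (n k : ℕ) where
  pos : Fin (k + 1) → Equiv.Perm (Fin n)
  isMove : ∀ t : Fin k, IsMove (pos t.castSucc) (pos t.succ)
  reversed_once : ∀ a b : Fin n, a ≠ b →
    ∃! t : Fin k, Reversed (pos t.castSucc) (pos t.succ) a b

/-- The Euclidean plane. -/
abbrev Plane : Type := EuclideanSpace ℝ (Fin 2)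

/-- The unit vector of angle `θ`. -/
noncomputable def unitVec (θ : ℝ) : Plane := !₂[Real.cos θ, Real.sin θ]

namespace AllowableSeq

variable {n k : ℕ}

/-- The elements `a` and `b` are reversed in the move `t`. -/
def Switched (A : AllowableSeq n k) (t : Fin k) (a b : Fin n) : Prop :=
  Reversed (A.pos t.castSucc) (A.pos t.succ) a b

/-- Every move is a swap of two adjacent elements. -/
def IsSimple (A : AllowableSeq n k) : Prop :=
  ∀ t : Fin k, ∃ a b : Fin n,
    (A.pos t.castSucc a : ℕ) + 1 = (A.pos t.castSucc b : ℕ) ∧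
    A.pos t.succ = A.pos t.castSucc * Equiv.swap a b

/-- The point configuration `p` has `A` as its allowable sequence: while an oriented line rotates
counterclockwise by `180°` from the angle `s 0` to the angle `s 0 + π`, the order of the orthogonal
projections of the points onto it is the `t`-th permutation of `A` strictly between the consecutive
angles `s t` and `s (t + 1)`. -/
def Realizes (A : AllowableSeq n k) (p : Fin n → Plane) : Prop :=
  ∃ s : Fin (k + 2) → ℝ, StrictMono s ∧ s (Fin.last (k + 1)) = s 0 + Real.pi ∧
    ∀ t : Fin (k + 1), ∀ θ ∈ Set.Ioo (s t.castSucc) (s t.succ), ∀ a b : Fin n,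
      (inner ℝ (p a) (unitVec θ) < inner ℝ (p b) (unitVec θ) ↔ A.pos t a < A.pos t b)

/-- Some point configuration has `A` as its allowable sequence. -/
def Realizable (A : AllowableSeq n k) : Prop := ∃ p : Fin n → Plane, A.Realizes p

/-! ### Lines and points at infinity

The move `t` is identified with a point `o t` on the line at infinity. A line other than the line
at infinity is recorded as a pair: its point at infinity and the set of elements lying on it. -/

/-- The line through the element `a` and the point at infinity `o t`. -/
def line (A : AllowableSeq n k) (t : Fin k) (a : Fin n) : Fin k × Set (Fin n) :=
  (t, {b | b = a ∨ A.Switched t a b})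

/-- The lines spanned by two elements of `Q`. -/
def spannedLines (A : AllowableSeq n k) (Q : Set (Fin n)) : Set (Fin k × Set (Fin n)) :=
  {l | ∃ t, ∃ a ∈ Q, ∃ b ∈ Q, A.Switched t a b ∧ l = A.line t a}

/-- The point at infinity `o t` lies on at least two lines spanned by the elements. -/
def Active (A : AllowableSeq n k) (t : Fin k) : Prop :=
  ∃ l ∈ A.spannedLines Set.univ, ∃ l' ∈ A.spannedLines Set.univ, l ≠ l' ∧ l.1 = t ∧ l'.1 = t

/-- The active points at infinity that the elements of `Q` determine, that is, that lie on a line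
spanned by two elements of `Q`. -/
def activePoints (A : AllowableSeq n k) (Q : Set (Fin n)) : Set (Fin k) :=
  {t | A.Active t ∧ ∃ l ∈ A.spannedLines Q, l.1 = t}

/-- The lines other than the line at infinity that are spanned by two points of the union of the set
`Q` of elements and the set `O` of points at infinity. -/
def linesSpannedBy (A : AllowableSeq n k) (Q : Set (Fin n)) (O : Set (Fin k)) :
    Set (Fin k × Set (Fin n)) :=
  A.spannedLines Q ∪ {l | ∃ a ∈ Q, ∃ t ∈ O, l = A.line t a}

/-- For an enumeration `e` of the elements: the elements that come before `e i`. -/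
def before (e : Equiv.Perm (Fin n)) (i : Fin n) : Set (Fin n) := {a | ∃ j < i, a = e j}

/-- The lines through the element `e i` that are spanned by the previous elements and the active
points at infinity which these determine. -/
def linesAt (A : AllowableSeq n k) (e : Equiv.Perm (Fin n)) (i : Fin n) :
    Set (Fin k × Set (Fin n)) :=
  {l | l ∈ A.linesSpannedBy (before e i) (A.activePoints (before e i)) ∧ e i ∈ l.2}

/-- `e` is a constructibility order of `A`: each element lies on at most two lines spanned by the
previous elements and the active points at infinity which these determine. -/
def IsConstructibilityOrder (A : AllowableSeq n k) (e : Equiv.Perm (Fin n)) : Prop :=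
  ∀ i : Fin n, (A.linesAt e i).ncard ≤ 2

/-- `A` is constructible: it has a constructibility order. -/
def Constructible (A : AllowableSeq n k) : Prop :=
  ∃ e : Equiv.Perm (Fin n), A.IsConstructibilityOrder e

/-- `A'` is a perturbation of `A` along `f`, where the element `a` of `A'` replaces the element `f a`
of `A`: apart from pairs that replace the same element, `A'` starts with the same order as `A`, and
pairs that `A` reverses in an earlier move are reversed earlier in `A'`. -/
def IsPerturbation {m k' : ℕ} (A' : AllowableSeq m k') (A : AllowableSeq n k)
    (f : Fin m → Fin n) : Prop :=
  (∀ a b, f a ≠ f b → (A'.pos 0 a < A'.pos 0 b ↔ A.pos 0 (f a) < A.pos 0 (f b))) ∧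
  ∀ a b c d s t s' t', A.Switched s (f a) (f b) → A.Switched t (f c) (f d) →
    A'.Switched s' a b → A'.Switched t' c d → s < t → s' < t'

end AllowableSeq

/-- `v 0, v 1, v 2, v 3` are, in this cyclic order, the vertices of a non-degenerate parallelogram
up to an affine relative error `ε`: `v 2` is `v 0 + α (v 1 - v 0) + β (v 3 - v 0)` with `α` and `β`
close to `1`. -/
def IsPerturbedParallelogram (ε : ℝ) (v : Fin 4 → Plane) : Prop :=
  LinearIndependent ℝ ![v 1 - v 0, v 3 - v 0] ∧
  ∃ α β : ℝ, |α - 1| < ε ∧ |β - 1| < ε ∧ v 2 = v 0 + α • (v 1 - v 0) + β • (v 3 - v 0)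

/-! A point configuration enters only through two orders: that of the abscissas and that of the
slopes of connecting lines, in a frame turned to the starting direction. An allowable sequence gives
abstract data of this kind (`Conf`): initial positions, and as "slope" of a pair the time of its
reversal. These data obey one law, that the slopes of the sides of a triangle are monotone
(`Conf.Valid`). Realizing the sequence means realizing both orders by real abscissas and slopes
(`AllowableSeq.realizes_iff`). Conversely, valid data whose slopes are all different come from a
simple allowable sequence (`Conf.exists_simple`). Hence it suffices to manipulate data.

The elements are treated from the last to the first of the constructibility order. If a coincidence
of slopes involves a line through the current element `x`, then by genericity of the elements
already treated it involves only `x` and earlier elements. Such a line contains two earlier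
elements, or one earlier element and an active point determined by earlier ones
(`Stage.exists_line`). So the coincidences at `x` occur in at most two directions
(`Stage.exists_two_slopes`); if `x` lies on no line it is already generic (`Stage.keep`).

Otherwise choose `y` on one of the special lines and replace `x` by a quadrilateral of length of
order `δ` along `xy` and height of order `δ²` across it. Its vertices lie in the four quadrants: the
line `xy` separates the vertices 0, 3 from 1, 2, and every line through `x` in another direction
separates 0, 1 from 2, 3, because the quadrilateral is flat. The coordinates near `1` and near `-ρ`
are chosen so that, for small `ρ` and then small `δ`, the order of all new slopes is determined by
the old orders alone and not by the metric (`ExtLt.congr`, `eventually_small`). Therefore the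
extension is a combinatorial operation (`ext_equiv`), it is again valid (`ext_valid`), and every
realization of the old data extends to one of the new data with an arbitrarily small quadrilateral
(`Realized.exists_quad`).

For the way back, take any realization of the extended data. The lines of old points in the two
special directions still separate the four new points in the two prescribed ways, so they cross
inside the convex hull of the four points (`exists_quad_weights`). Placing `x` at the crossing
restores the coincidences in both directions. All strict inequalities of slopes at `x` hold for each
of the four vertices, and they pass to the mean because they are half-plane conditions
(`exists_restore`). -/

/-- `y` is strictly between `x` and `z`, or the three numbers are equal. -/
def SlopeBtw (x y z : ℝ) : Prop := (x < y ∧ y < z) ∨ (z < y ∧ y < x) ∨ (x = y ∧ y = z)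

/-- The combinatorial data of a point configuration in general direction: first coordinates, and
slopes of the connecting lines. -/
structure Conf (ι : Type) where
  /-- the first coordinates -/
  pos : ι → ℝ
  /-- the slopes of the connecting lines -/
  key : ι → ι → ℝ

namespace Conf

variable {ι κ : Type}

/-- The laws of the data: the slopes of the sides of a triangle are monotone. -/
structure Valid (C : Conf ι) : Prop where
  inj : Function.Injective C.pos
  symm : ∀ a b, C.key a b = C.key b a
  btw : ∀ a b c, C.pos a < C.pos b → C.pos b < C.pos c →
    SlopeBtw (C.key a b) (C.key a c) (C.key b c)

/-- Equality of the orders of first coordinates and of slopes. -/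
structure Equiv (C D : Conf ι) : Prop where
  pos_iff : ∀ a b, C.pos a < C.pos b ↔ D.pos a < D.pos b
  key_iff : ∀ a b c d, a ≠ b → c ≠ d → (C.key a b < C.key c d ↔ D.key a b < D.key c d)

theorem Equiv.symm {C D : Conf ι} (h : Equiv C D) : Equiv D C :=
  ⟨fun a b => (h.1 a b).symm, fun a b c d hab hcd => (h.2 a b c d hab hcd).symm⟩

theorem Equiv.trans {C D E : Conf ι} (h : Equiv C D) (h' : Equiv D E) : Equiv C E :=
  ⟨fun a b => (h.1 a b).trans (h'.1 a b),
   fun a b c d hab hcd => (h.2 a b c d hab hcd).trans (h'.2 a b c d hab hcd)⟩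

theorem Equiv.key_eq_iff {C D : Conf ι} (h : Equiv C D) {a b c d : ι} (hab : a ≠ b) (hcd : c ≠ d) :
    C.key a b = C.key c d ↔ D.key a b = D.key c d := by
  have h1 := h.2 a b c d hab hcd
  have h2 := h.2 c d a b hcd hab
  constructor <;> intro e
  · exact le_antisymm (not_lt.1 fun h => absurd (h2.2 h) (by simp [e]))
      (not_lt.1 fun h => absurd (h1.2 h) (by simp [e]))
  · exact le_antisymm (not_lt.1 fun h => absurd (h2.1 h) (by simp [e]))
      (not_lt.1 fun h => absurd (h1.1 h) (by simp [e]))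

/-- The data of a point configuration with coordinates `X` and `Y`. -/
noncomputable def slope (X Y : ι → ℝ) : Conf ι where
  pos := X
  key a b := (Y b - Y a) / (X b - X a)

theorem slope_key_comm (X Y : ι → ℝ) (a b : ι) : (slope X Y).key a b = (slope X Y).key b a := by
  simp only [slope]
  rw [← neg_div_neg_eq]; congr 1 <;> ring

/-- The slopes of the sides of a triangle are monotone. -/
theorem btw_slope {x₁ x₂ x₃ y₁ y₂ y₃ : ℝ} (h : x₁ < x₂) (h' : x₂ < x₃) :
    SlopeBtw ((y₂ - y₁) / (x₂ - x₁)) ((y₃ - y₁) / (x₃ - x₁)) ((y₃ - y₂) / (x₃ - x₂)) := by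
  have h1 : 0 < x₂ - x₁ := sub_pos.2 h
  have h2 : 0 < x₃ - x₂ := sub_pos.2 h'
  have h3 : 0 < x₃ - x₁ := by linarith
  unfold SlopeBtw
  rw [div_lt_div_iff₀ h1 h3, div_lt_div_iff₀ h3 h2, div_lt_div_iff₀ h2 h3, div_lt_div_iff₀ h3 h1,
    div_eq_div_iff h1.ne' h3.ne', div_eq_div_iff h3.ne' h2.ne']
  rcases lt_trichotomy ((y₂ - y₁) * (x₃ - x₂)) ((y₃ - y₂) * (x₂ - x₁)) with e | e | e
  · left; constructor <;> nlinarith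
  · right; right; constructor <;> nlinarith
  · right; left; constructor <;> nlinarith

/-- Transport of the data along a map. -/
def comap (g : κ → ι) (C : Conf ι) : Conf κ where
  pos a := C.pos (g a)
  key a b := C.key (g a) (g b)

/-- The points `p` have, in suitable rotated coordinates, the orders of first coordinates and of
slopes prescribed by `C`. -/
def Realized (C : Conf ι) (p : ι → Plane) : Prop :=
  ∃ θ : ℝ, Equiv (slope (fun a => inner ℝ (p a) (unitVec θ))
    (fun a => inner ℝ (p a) (unitVec (θ + Real.pi / 2)))) C

theorem Realized.congr {C D : Conf ι} (h : Equiv C D) {p : ι → Plane} (hp : C.Realized p) :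
    D.Realized p := by
  obtain ⟨θ, hθ⟩ := hp
  exact ⟨θ, hθ.trans h⟩

theorem Realized.comap {C : Conf ι} {p : ι → Plane} (hp : C.Realized p) {g : κ → ι}
    (hg : Function.Injective g) : (C.comap g).Realized (p ∘ g) := by
  obtain ⟨θ, hθ⟩ := hp
  exact ⟨θ, fun a b => hθ.1 (g a) (g b),
    fun a b c d hab hcd => hθ.2 (g a) (g b) (g c) (g d) (hg.ne hab) (hg.ne hcd)⟩

end Conf

/-! ### Moves, reversal times and the data of an allowable sequence -/

/-- A move keeps the order of two elements that lie in no common reversed substring. -/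
theorem lt_of_not_common {n : ℕ} {σ τ : Equiv.Perm (Fin n)} {I : Finset (Fin n × Fin n)}
    (h2 : ∀ J ∈ I, ∀ K ∈ I, J ≠ K → Disjoint (Set.Icc J.1 J.2) (Set.Icc K.1 K.2))
    (h3 : ∀ J ∈ I, ∀ a, σ a ∈ Set.Icc J.1 J.2 →
      ((τ a : ℕ) + (σ a : ℕ) = (J.1 : ℕ) + (J.2 : ℕ)))
    (h4 : ∀ a, (∀ J ∈ I, σ a ∉ Set.Icc J.1 J.2) → τ a = σ a)
    {a b : Fin n} (hab : ∀ J ∈ I, ¬ (σ a ∈ Set.Icc J.1 J.2 ∧ σ b ∈ Set.Icc J.1 J.2))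
    (hlt : σ a < σ b) : τ a < τ b := by
  by_cases ha : ∃ J ∈ I, σ a ∈ Set.Icc J.1 J.2
  · obtain ⟨J, hJ, haJ⟩ := ha
    have e1 := h3 J hJ a haJ
    by_cases hb : ∃ K ∈ I, σ b ∈ Set.Icc K.1 K.2
    · obtain ⟨K, hK, hbK⟩ := hb
      have e2 := h3 K hK b hbK
      have hne : J ≠ K := by rintro rfl; exact hab J hJ ⟨haJ, hbK⟩
      have hd := Set.disjoint_left.1 (h2 J hJ K hK hne)
      have d1 : ¬ (K.1 ≤ J.2 ∧ J.1 ≤ K.1) := fun h =>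
        hd (a := K.1) ⟨h.2, h.1⟩ ⟨le_rfl, hbK.1.trans hbK.2⟩
      have d2 : ¬ (J.1 ≤ K.2 ∧ K.1 ≤ J.1) := fun h =>
        hd (a := J.1) ⟨le_rfl, haJ.1.trans haJ.2⟩ ⟨h.2, h.1⟩
      simp only [Set.mem_Icc, Fin.le_def, Fin.lt_def] at *
      omega
    · push Not at hb
      have e2 := h4 b hb
      have := hb J hJ
      rw [e2]
      simp only [Set.mem_Icc, Fin.le_def, Fin.lt_def] at *
      omega
  · push Not at ha
    have e1 := h4 a ha
    by_cases hb : ∃ K ∈ I, σ b ∈ Set.Icc K.1 K.2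
    · obtain ⟨K, hK, hbK⟩ := hb
      have e2 := h3 K hK b hbK
      have := ha K hK
      rw [e1]
      simp only [Set.mem_Icc, Fin.le_def, Fin.lt_def] at *
      omega
    · push Not at hb
      rw [e1, h4 b hb]; exact hlt

/-- Being reversed in a move is transitive. -/
theorem Reversed.trans_of_isMove {n : ℕ} {σ τ : Equiv.Perm (Fin n)} (h : IsMove σ τ)
    {a b c : Fin n} (hab : Reversed σ τ a b) (hac : Reversed σ τ a c) (hbc : b ≠ c) :
    Reversed σ τ b c := by
  obtain ⟨I, -, -, h2, h3, h4⟩ := h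
  -- A reversed pair lies in a common substring. Disjointness makes the substrings of the two pairs
  -- equal, and inside one substring the old and new positions have a constant sum, so all its pairs
  -- are reversed.
  have key : ∀ x y, Reversed σ τ x y →
      ∃ J ∈ I, σ x ∈ Set.Icc J.1 J.2 ∧ σ y ∈ Set.Icc J.1 J.2 := by
    intro x y hxy
    by_contra hcon
    push Not at hcon
    have hcon' : ∀ J ∈ I, ¬ (σ x ∈ Set.Icc J.1 J.2 ∧ σ y ∈ Set.Icc J.1 J.2) :=
      fun J hJ h => hcon J hJ h.1 h.2
    rcases lt_or_gt_of_ne (σ.injective.ne hxy.1) with hl | hl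
    · exact absurd (lt_of_not_common h2 h3 h4 hcon' hl) (hxy.2.1 hl).not_gt
    · have := lt_of_not_common h2 h3 h4 (fun J hJ h => hcon' J hJ h.symm) hl
      exact hl.not_gt (hxy.2.2 this)
  obtain ⟨J, hJ, haJ, hbJ⟩ := key _ _ hab
  obtain ⟨K, hK, haK, hcK⟩ := key _ _ hac
  have hJK : J = K := by
    by_contra hne
    exact Set.disjoint_left.1 (h2 J hJ K hK hne) haJ haK
  subst hJK
  have e1 := h3 J hJ b hbJ
  have e2 := h3 J hJ c hcK
  refine ⟨hbc, ?_⟩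
  simp only [Fin.lt_def]
  omega

theorem Reversed.symm {n : ℕ} {σ τ : Equiv.Perm (Fin n)} {a b : Fin n} (h : Reversed σ τ a b) :
    Reversed σ τ b a := by
  obtain ⟨hne, h⟩ := h
  refine ⟨hne.symm, ?_⟩
  have h1 := lt_or_gt_of_ne (σ.injective.ne hne)
  have h2 := lt_or_gt_of_ne (τ.injective.ne hne)
  constructor <;> intro h3
  · exact h2.resolve_right fun h4 => (h.2 h4).not_gt h3
  · exact h1.resolve_left fun h4 => (h.1 h4).not_gt h3

namespace AllowableSeq

variable {n k : ℕ}

/-- The index of the move that reverses `a` and `b`. -/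
noncomputable def time (A : AllowableSeq n k) (a b : Fin n) : ℕ :=
  if h : a ≠ b then ((A.reversed_once a b h).choose : ℕ) else 0

theorem switched_iff (A : AllowableSeq n k) {a b : Fin n} (h : a ≠ b) (t : Fin k) :
    A.Switched t a b ↔ (t : ℕ) = A.time a b := by
  have hs := (A.reversed_once a b h).choose_spec
  simp only [time, dif_pos h]
  constructor
  · intro ht
    exact congrArg Fin.val (hs.2 t ht)
  · intro ht
    rw [Fin.ext ht]; exact hs.1

theorem Switched.ne {A : AllowableSeq n k} {t : Fin k} {a b : Fin n} (h : A.Switched t a b) :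
    a ≠ b := h.1

theorem Switched.time_eq {A : AllowableSeq n k} {t : Fin k} {a b : Fin n} (h : A.Switched t a b) :
    A.time a b = t := ((A.switched_iff h.ne t).1 h).symm

theorem time_lt (A : AllowableSeq n k) {a b : Fin n} (h : a ≠ b) : A.time a b < k := by
  simp only [time, dif_pos h]
  exact Fin.is_lt _

theorem time_comm (A : AllowableSeq n k) (a b : Fin n) : A.time a b = A.time b a := by
  rcases eq_or_ne a b with rfl | h
  · rfl
  · have : A.Switched ⟨A.time a b, A.time_lt h⟩ a b := (A.switched_iff h _).2 rfl
    exact (A.switched_iff h.symm _).1 (Reversed.symm this)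

/-- A pair changes its order exactly once, so the initial order and the reversal time determine
every permutation of the sequence. -/
theorem pos_lt_iff (A : AllowableSeq n k) {a b : Fin n} (h : a ≠ b) (t : Fin (k + 1)) :
    A.pos t a < A.pos t b ↔ (A.pos 0 a < A.pos 0 b ↔ (t : ℕ) ≤ A.time a b) := by
  induction t using Fin.induction with
  | zero => simp
  | succ t ih =>
    have h1 := lt_or_gt_of_ne ((A.pos t.castSucc).injective.ne h)
    have h2 := lt_or_gt_of_ne ((A.pos t.succ).injective.ne h)
    have h3 := A.switched_iff h t
    simp only [Switched, Reversed] at h3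
    have h4 := @lt_asymm _ _ (A.pos t.castSucc a) (A.pos t.castSucc b)
    have h5 := @lt_asymm _ _ (A.pos t.succ a) (A.pos t.succ b)
    simp only [Fin.val_castSucc, Fin.val_succ] at ih ⊢
    rcases lt_trichotomy (t : ℕ) (A.time a b) with ht | ht | ht
    · have e1 : (t : ℕ) ≤ A.time a b := ht.le
      have e2 : (t : ℕ) + 1 ≤ A.time a b := ht
      have e3 : (t : ℕ) ≠ A.time a b := ht.ne
      tauto
    · have e1 : (t : ℕ) ≤ A.time a b := ht.le
      have e2 : ¬ (t : ℕ) + 1 ≤ A.time a b := by omega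
      tauto
    · have e1 : ¬ (t : ℕ) ≤ A.time a b := by omega
      have e2 : ¬ (t : ℕ) + 1 ≤ A.time a b := by omega
      have e3 : (t : ℕ) ≠ A.time a b := ht.ne'
      tauto

theorem time_trans (A : AllowableSeq n k) {a b c : Fin n} (hab : a ≠ b) (hac : a ≠ c) (hbc : b ≠ c)
    (h : A.time a b = A.time a c) : A.time b c = A.time a b := by
  have h1 : A.Switched ⟨A.time a b, A.time_lt hab⟩ a b := (A.switched_iff hab _).2 rfl
  have h2 : A.Switched ⟨A.time a b, A.time_lt hab⟩ a c := (A.switched_iff hac _).2 h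
  exact ((A.switched_iff hbc _).1 (Reversed.trans_of_isMove (A.isMove _) h1 h2 hbc)).symm

/-- The combinatorial data of an allowable sequence. -/
noncomputable def conf (A : AllowableSeq n k) : Conf (Fin n) where
  pos a := (A.pos 0 a : ℕ)
  key a b := A.time a b

/-- If the outer pair of three elements were reversed before both other pairs, or after both, some
permutation would contain a cyclic order; these are `c1` and `c2`. Ties are governed by transitivity
of simultaneous reversal, `time_trans`. -/
theorem conf_valid (A : AllowableSeq n k) : A.conf.Valid where
  inj a b h := by
    have h : ((A.pos 0 a : ℕ) : ℝ) = (A.pos 0 b : ℕ) := h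
    exact (A.pos 0).injective (Fin.ext (by exact_mod_cast h))
  symm a b := by simp only [conf]; rw [A.time_comm]
  btw a b c hab hbc := by
    have hab : A.pos 0 a < A.pos 0 b := by
      have h : ((A.pos 0 a : ℕ) : ℝ) < (A.pos 0 b : ℕ) := hab
      exact_mod_cast h
    have hbc : A.pos 0 b < A.pos 0 c := by
      have h : ((A.pos 0 b : ℕ) : ℝ) < (A.pos 0 c : ℕ) := hbc
      exact_mod_cast h
    have hac := hab.trans hbc
    have nab : a ≠ b := by rintro rfl; exact lt_irrefl _ hab
    have nbc : b ≠ c := by rintro rfl; exact lt_irrefl _ hbc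
    have nac : a ≠ c := by rintro rfl; exact lt_irrefl _ hac
    have P := fun t => A.pos_lt_iff nab t
    have Q := fun t => A.pos_lt_iff nbc t
    have R := fun t => A.pos_lt_iff nac t
    simp only [hab, hbc, hac, true_iff] at P Q R
    have tab := A.time_lt nab
    have tac := A.time_lt nac
    have tbc := A.time_lt nbc
    have c1 : ¬ (A.time a c < A.time a b ∧ A.time a c < A.time b c) := by
      rintro ⟨h1, h2⟩
      have p := (P ⟨A.time a c + 1, by omega⟩).2 h1
      have q := (Q ⟨A.time a c + 1, by omega⟩).2 h2
      have r := (R ⟨A.time a c + 1, by omega⟩).1 (p.trans q)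
      simp at r
    have c2 : ¬ (A.time a b < A.time a c ∧ A.time b c < A.time a c) := by
      rintro ⟨h1, h2⟩
      have r := (R ⟨A.time a c, by omega⟩).2 le_rfl
      have p := mt (P ⟨A.time a c, by omega⟩).1 (by simpa using h1)
      have q := mt (Q ⟨A.time a c, by omega⟩).1 (by simpa using h2)
      exact absurd r (not_lt.2 ((not_lt.1 q).trans (not_lt.1 p)))
    have e1 := A.time_trans nab nac nbc
    have e2 := A.time_trans nac.symm nbc.symm nab
    rw [A.time_comm c a, A.time_comm c b] at e2
    have e3 := A.time_trans nab.symm nbc nac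
    rw [A.time_comm b a] at e3
    simp only [conf, SlopeBtw, Nat.cast_lt, Nat.cast_inj]
    omega

end AllowableSeq

/-! ### Realizations: switching angles and slopes -/

theorem inner_unitVec (p : Plane) (θ : ℝ) :
    inner ℝ p (unitVec θ) = p 0 * Real.cos θ + p 1 * Real.sin θ := by
  simp [unitVec, PiLp.inner_apply, Fin.sum_univ_two, mul_comm]

theorem inner_unitVec_add (p : Plane) (θ φ : ℝ) :
    inner ℝ p (unitVec (θ + φ)) = inner ℝ p (unitVec θ) * Real.cos φ +
      inner ℝ p (unitVec (θ + Real.pi / 2)) * Real.sin φ := by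
  simp only [inner_unitVec, Real.cos_add, Real.sin_add, Real.cos_pi_div_two, Real.sin_pi_div_two]
  ring

/-- The cotangent decreases on `(0, π)`. -/
theorem neg_cot_lt {φ ψ : ℝ} (h0 : 0 < φ) (h : φ < ψ) (hpi : ψ < Real.pi) :
    -Real.cos φ / Real.sin φ < -Real.cos ψ / Real.sin ψ := by
  have s1 := Real.sin_pos_of_pos_of_lt_pi h0 (h.trans hpi)
  have s2 := Real.sin_pos_of_pos_of_lt_pi (h0.trans h) hpi
  have s3 : 0 < Real.sin (ψ - φ) := Real.sin_pos_of_pos_of_lt_pi (by linarith) (by linarith)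
  rw [Real.sin_sub] at s3
  rw [div_lt_div_iff₀ s1 s2]
  linarith

/-- The projections of two points joined by a line of slope `m` agree in the direction orthogonal to
the line, which has angle `π/2 + arctan m`. -/
theorem cos_add_mul_sin_pos_iff {φ m : ℝ} (h0 : 0 < φ) (hpi : φ < Real.pi) :
    0 < Real.cos φ + m * Real.sin φ ↔ φ < Real.pi / 2 + Real.arctan m := by
  obtain ⟨ψ, rfl⟩ : ∃ ψ, φ = ψ + Real.pi / 2 := ⟨φ - Real.pi / 2, by ring⟩
  have hc : 0 < Real.cos ψ := Real.cos_pos_of_mem_Ioo ⟨by linarith, by linarith⟩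
  rw [Real.cos_add_pi_div_two, Real.sin_add_pi_div_two]
  have e : -Real.sin ψ + m * Real.cos ψ = Real.cos ψ * (m - Real.tan ψ) := by
    rw [Real.tan_eq_sin_div_cos]; field_simp; ring
  rw [e, mul_pos_iff_of_pos_left hc, sub_pos]
  have h1 : Real.arctan (Real.tan ψ) = ψ := Real.arctan_tan (by linarith) (by linarith)
  rw [← Real.arctan_lt_arctan_iff, h1]
  constructor <;> intro h <;> linarith

namespace AllowableSeq

variable {n k : ℕ}

/-- The two ends of a reversed substring are a reversed pair, so every move has a slope; this is
where nonemptiness of moves is needed. -/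
theorem exists_time_eq (A : AllowableSeq n k) (t : Fin k) :
    ∃ a b, A.pos 0 a < A.pos 0 b ∧ A.time a b = t := by
  obtain ⟨I, ⟨J, hJ⟩, h1, h2, h3, h4⟩ := A.isMove t
  have hlt := h1 J hJ
  set a := (A.pos t.castSucc).symm J.1 with ha
  set b := (A.pos t.castSucc).symm J.2 with hb
  have ea : A.pos t.castSucc a = J.1 := by simp [ha]
  have eb : A.pos t.castSucc b = J.2 := by simp [hb]
  have hne : a ≠ b := by
    intro h
    rw [← h, ea] at eb
    exact hlt.ne eb
  have r : A.Switched t a b := by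
    refine ⟨hne, ?_⟩
    have f1 := h3 J hJ a (by rw [ea]; exact ⟨le_rfl, hlt.le⟩)
    have f2 := h3 J hJ b (by rw [eb]; exact ⟨hlt.le, le_rfl⟩)
    rw [ea] at f1 ⊢
    rw [eb] at f2 ⊢
    simp only [Fin.lt_def] at *
    omega
  rcases lt_or_gt_of_ne ((A.pos 0).injective.ne hne) with h | h
  · exact ⟨a, b, h, r.time_eq⟩
  · exact ⟨b, a, h, by rw [A.time_comm, r.time_eq]⟩

/-- The difference of the projections of two points vanishes at their switching angle `φ`, which
makes their slope `-cot φ`. Since `-cot` increases on `(0, π)`, slopes are ordered like reversal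
times. -/
theorem Realizes.realized {A : AllowableSeq n k} {p : Fin n → Plane} (hp : A.Realizes p) :
    A.conf.Realized p := by
  obtain ⟨s, hs, hlast, H⟩ := hp
  have hs0 : ∀ j : Fin (k + 2), j ≠ 0 → j ≠ Fin.last _ → 0 < s j - s 0 ∧ s j - s 0 < Real.pi := by
    intro j h1 h2
    have h3 := hs (Fin.pos_iff_ne_zero.2 h1)
    have h4 := hs (lt_of_le_of_ne (Fin.le_last j) h2)
    constructor <;> linarith
  refine ⟨s 0, ?_⟩
  set X : Fin n → ℝ := fun a => inner ℝ (p a) (unitVec (s 0)) with hX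
  set Y : Fin n → ℝ := fun a => inner ℝ (p a) (unitVec (s 0 + Real.pi / 2)) with hY
  -- Permutation `t` lives between `s t` and `s (t + 1)`, so move `t` happens at the angle `s (t +
  -- 1)`. The default value is never used.
  let φ : ℕ → ℝ := fun t => if h : t < k then s ⟨t + 1, by omega⟩ - s 0 else 0
  have main : ∀ a b, A.pos 0 a < A.pos 0 b → X a < X b ∧
      (Y b - Y a) / (X b - X a) = -Real.cos (φ (A.time a b)) / Real.sin (φ (A.time a b)) := by
    intro a b hab
    have hne : a ≠ b := by rintro rfl; exact lt_irrefl _ hab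
    have ht := A.time_lt hne
    set g : ℝ → ℝ := fun θ => inner ℝ (p b) (unitVec θ) - inner ℝ (p a) (unitVec θ) with hg
    have gform : ∀ φ, g (s 0 + φ) = (X b - X a) * Real.cos φ + (Y b - Y a) * Real.sin φ := by
      intro φ
      simp only [hg, hX, hY, inner_unitVec_add _ (s 0) φ]
      ring
    have gcont : Continuous g := by
      simp only [hg, inner_unitVec]; fun_prop
    have gpos : ∀ i : Fin (k + 1), (i : ℕ) ≤ A.time a b →
        ∀ θ ∈ Set.Ioo (s i.castSucc) (s i.succ), 0 < g θ := by
      intro i hi θ hθ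
      have := (H i θ hθ a b).2 ((A.pos_lt_iff hne i).2 (by simp [hab, hi]))
      exact sub_pos.2 this
    have gneg : ∀ i : Fin (k + 1), ¬ (i : ℕ) ≤ A.time a b →
        ∀ θ ∈ Set.Ioo (s i.castSucc) (s i.succ), g θ < 0 := by
      intro i hi θ hθ
      have h1 : ¬ A.pos i a < A.pos i b := by
        rw [A.pos_lt_iff hne i]; simp [hab, hi]
      have := (H i θ hθ b a).2
        (lt_of_le_of_ne (not_lt.1 h1) ((A.pos i).injective.ne hne.symm))
      exact sub_neg.2 this
    have clos : ∀ i : Fin (k + 1), closure (Set.Ioo (s i.castSucc) (s i.succ)) =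
        Set.Icc (s i.castSucc) (s i.succ) := fun i =>
      closure_Ioo (hs i.castSucc_lt_succ).ne
    have gpos' : ∀ i : Fin (k + 1), (i : ℕ) ≤ A.time a b →
        ∀ θ ∈ Set.Icc (s i.castSucc) (s i.succ), 0 ≤ g θ := by
      intro i hi
      rw [← clos]
      exact fun θ hθ => closure_minimal (fun θ hθ => (gpos i hi θ hθ).le)
        (isClosed_le continuous_const gcont) hθ
    have gneg' : ∀ i : Fin (k + 1), ¬ (i : ℕ) ≤ A.time a b →
        ∀ θ ∈ Set.Icc (s i.castSucc) (s i.succ), g θ ≤ 0 := by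
      intro i hi
      rw [← clos]
      exact fun θ hθ => closure_minimal (fun θ hθ => (gneg i hi θ hθ).le)
        (isClosed_le gcont continuous_const) hθ
    let i1 : Fin (k + 1) := ⟨A.time a b, by omega⟩
    let i2 : Fin (k + 1) := ⟨A.time a b + 1, by omega⟩
    have e12 : i1.succ = i2.castSucc := by ext; simp [i1, i2]
    -- The angle is the common end of an interval on which `g ≥ 0` and one on which `g ≤ 0`.
    have hz : g (s i1.succ) = 0 := by
      apply le_antisymm
      · rw [e12]
        exact gneg' i2 (by simp [i2]) _ ⟨le_rfl, (hs i2.castSucc_lt_succ).le⟩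
      · exact gpos' i1 le_rfl _ ⟨(hs i1.castSucc_lt_succ).le, le_rfl⟩
    have hφ : φ (A.time a b) = s i1.succ - s 0 := by
      simp only [φ, dif_pos ht]; rfl
    obtain ⟨hφ0, hφ1⟩ := hs0 i1.succ (Fin.succ_ne_zero _) (by
      intro h; have := congrArg Fin.val h; simp [i1] at this; omega)
    rw [← hφ] at hφ0 hφ1
    have hsin := Real.sin_pos_of_pos_of_lt_pi hφ0 hφ1
    have hz' : (X b - X a) * Real.cos (φ (A.time a b)) +
        (Y b - Y a) * Real.sin (φ (A.time a b)) = 0 := by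
      rw [← gform, hφ, ← hz]; congr 1; ring
    have hx0 : 0 ≤ X b - X a := by
      have := gpos' 0 (by simp) (s 0) ⟨le_rfl, (hs (Fin.castSucc_lt_succ (i := 0))).le⟩
      simpa [hg] using this
    -- With equal abscissas the equation `hz'` would force equal ordinates, hence coinciding
    -- projections in all directions, against the strict order in the first interval.
    have hx : 0 < X b - X a := by
      refine lt_of_le_of_ne hx0 fun h => ?_
      rw [← h] at hz'
      have hy : Y b - Y a = 0 := by
        rcases mul_eq_zero.1 (show (Y b - Y a) * Real.sin (φ (A.time a b)) = 0 by linarith) with h | h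
        · exact h
        · exact absurd h hsin.ne'
      obtain ⟨θ, hθ⟩ := exists_between (hs (Fin.castSucc_lt_succ (i := (0 : Fin (k + 1)))))
      have h1 := gpos 0 (by simp) θ hθ
      have h2 := gform (θ - s 0)
      rw [← h, hy] at h2
      simp at h2
      exact h1.ne' h2
    refine ⟨by linarith, ?_⟩
    rw [div_eq_div_iff hx.ne' hsin.ne']
    linarith
  have hφ : ∀ t t' : ℕ, t < t' → t' < k → -Real.cos (φ t) / Real.sin (φ t) <
      -Real.cos (φ t') / Real.sin (φ t') := by
    intro t t' h h'
    simp only [φ, dif_pos h', dif_pos (h.trans h')]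
    apply neg_cot_lt
    · exact (hs0 _ (by simp [Fin.ext_iff]) (by simp [Fin.ext_iff]; omega)).1
    · have := @hs ⟨t + 1, by omega⟩ ⟨t' + 1, by omega⟩ (by simpa [Fin.lt_def] using h)
      linarith
    · exact (hs0 _ (by simp [Fin.ext_iff]) (by simp [Fin.ext_iff]; omega)).2
  have keyeq : ∀ a b, a ≠ b → (Conf.slope X Y).key a b =
      -Real.cos (φ (A.time a b)) / Real.sin (φ (A.time a b)) := by
    intro a b hne
    rcases lt_or_gt_of_ne ((A.pos 0).injective.ne hne) with h | h
    · exact (main a b h).2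
    · rw [Conf.slope_key_comm, A.time_comm]
      exact (main b a h).2
  have xlt : ∀ a b, A.pos 0 a < A.pos 0 b → X a < X b := fun a b h => (main a b h).1
  constructor
  · intro a b
    simp only [Conf.slope, conf, Nat.cast_lt, Fin.val_fin_lt]
    refine ⟨fun h => ?_, xlt a b⟩
    by_contra hcon
    rcases eq_or_lt_of_le (not_lt.1 hcon) with h' | h'
    · rw [(A.pos 0).injective h'] at h; exact lt_irrefl _ h
    · exact lt_asymm h (xlt _ _ h')
  · intro a b c d hab hcd
    rw [keyeq a b hab, keyeq c d hcd]
    simp only [conf, Nat.cast_lt]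
    refine ⟨fun h => ?_, fun h => hφ _ _ h (A.time_lt hcd)⟩
    by_contra hcon
    rcases eq_or_lt_of_le (not_lt.1 hcon) with h' | h'
    · rw [h'] at h; exact lt_irrefl _ h
    · exact lt_asymm h (hφ _ _ h' (A.time_lt hab))

theorem realizes_of_realized {A : AllowableSeq n k} {p : Fin n → Plane} (hp : A.conf.Realized p) :
    A.Realizes p := by
  obtain ⟨θ₀, h⟩ := hp
  set X : Fin n → ℝ := fun a => inner ℝ (p a) (unitVec θ₀) with hX
  set Y : Fin n → ℝ := fun a => inner ℝ (p a) (unitVec (θ₀ + Real.pi / 2)) with hY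
  choose a b hab hτ using A.exists_time_eq
  have hne : ∀ {a b}, A.pos 0 a < A.pos 0 b → a ≠ b := by
    rintro a b h rfl; exact lt_irrefl _ h
  let m : Fin k → ℝ := fun t => (Conf.slope X Y).key (a t) (b t)
  have hm : ∀ t t', t < t' → m t < m t' := by
    intro t t' h'
    refine (h.key_iff _ _ _ _ (hne (hab t)) (hne (hab t'))).2 ?_
    simp only [conf, hτ, Nat.cast_lt]
    exact h'
  have hkey : ∀ c d, c ≠ d → ∀ t : Fin k, A.time c d = t → (Conf.slope X Y).key c d = m t := by
    intro c d hcd t ht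
    refine (h.key_eq_iff hcd (hne (hab t))).2 ?_
    simp only [conf, hτ, ht]
  -- The inner angles are the directions orthogonal to the lines of slope `m t`, in which the pairs
  -- of move `t` have equal projections.
  let s : Fin (k + 2) → ℝ := fun i =>
    if h0 : (i : ℕ) = 0 then θ₀ else if h1 : (i : ℕ) < k + 1 then
      θ₀ + (Real.pi / 2 + Real.arctan (m ⟨i - 1, by omega⟩)) else θ₀ + Real.pi
  have s0 : s 0 = θ₀ := by simp [s]
  have slast : s (Fin.last (k + 1)) = θ₀ + Real.pi := by simp [s]
  have ssucc : ∀ (t : Fin k) (i : Fin (k + 2)), (i : ℕ) = t + 1 →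
      s i = θ₀ + (Real.pi / 2 + Real.arctan (m t)) := by
    intro t i hi
    simp only [s, hi]
    simp
  have hs : StrictMono s := by
    intro i j hij
    have b1 := fun t => Real.neg_pi_div_two_lt_arctan (m t)
    have b2 := fun t => Real.arctan_lt_pi_div_two (m t)
    have hij' : (i : ℕ) < j := hij
    have hj := j.isLt
    rcases Nat.eq_zero_or_pos i with hi | hi
    · have : i = 0 := Fin.ext hi
      rw [this, s0]
      by_cases hjl : (j : ℕ) = k + 1
      · rw [show j = Fin.last (k + 1) from Fin.ext hjl, slast]; linarith [Real.pi_pos]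
      · rw [ssucc ⟨j - 1, by omega⟩ j (by simp; omega)]
        linarith [b1 ⟨j - 1, by omega⟩]
    · rw [ssucc ⟨i - 1, by omega⟩ i (by simp; omega)]
      by_cases hjl : (j : ℕ) = k + 1
      · have sj : s j = θ₀ + Real.pi := by rw [show j = Fin.last (k + 1) from Fin.ext hjl, slast]
        rw [sj]
        linarith [b2 ⟨i - 1, by omega⟩]
      · rw [ssucc ⟨j - 1, by omega⟩ j (by simp; omega)]
        have := Real.arctan_lt_arctan_iff.2 (hm ⟨i - 1, by omega⟩ ⟨j - 1, by omega⟩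
          (by simp [Fin.lt_def]; omega))
        linarith
  refine ⟨s, hs, by rw [slast, s0], ?_⟩
  intro i θ hθ
  have lo : θ₀ < θ := by
    rw [← s0]; exact (hs.monotone (Fin.zero_le _)).trans_lt hθ.1
  have hi : θ < θ₀ + Real.pi := by
    rw [← slast]; exact hθ.2.trans_le (hs.monotone (Fin.le_last _))
  have main : ∀ c d, A.pos 0 c < A.pos 0 d →
      (inner ℝ (p c) (unitVec θ) < inner ℝ (p d) (unitVec θ) ↔ (i : ℕ) ≤ A.time c d) ∧
      inner ℝ (p c) (unitVec θ) ≠ inner ℝ (p d) (unitVec θ) := by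
    intro c d hcd
    have ht := A.time_lt (hne hcd)
    set t : Fin k := ⟨A.time c d, ht⟩ with htdef
    have hx : X c < X d := (h.pos_iff c d).2 (by simpa [conf] using hcd)
    have hk : (Y d - Y c) / (X d - X c) = m t := hkey c d (hne hcd) t rfl
    have hy : Y d - Y c = m t * (X d - X c) := by
      rw [← hk, div_mul_cancel₀ _ (sub_pos.2 hx).ne']
    have e : inner ℝ (p d) (unitVec θ) - inner ℝ (p c) (unitVec θ) =
        (X d - X c) * (Real.cos (θ - θ₀) + m t * Real.sin (θ - θ₀)) := by
      have e1 : ∀ a, inner ℝ (p a) (unitVec θ) =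
          X a * Real.cos (θ - θ₀) + Y a * Real.sin (θ - θ₀) := by
        intro a
        simp only [hX, hY]
        rw [← inner_unitVec_add]; congr 2; ring
      rw [e1, e1]
      linear_combination (Real.sin (θ - θ₀)) * hy
    have st := ssucc t ⟨t + 1, by omega⟩ rfl
    have hpos := cos_add_mul_sin_pos_iff (m := m t) (sub_pos.2 lo)
      (show θ - θ₀ < Real.pi by linarith)
    have c1 : (inner ℝ (p c) (unitVec θ) < inner ℝ (p d) (unitVec θ)) ↔
        θ < s ⟨t + 1, by omega⟩ := by
      rw [← sub_pos, e, mul_pos_iff_of_pos_left (sub_pos.2 hx), hpos, st]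
      constructor <;> intro h <;> linarith
    have c2 : θ < s ⟨t + 1, by omega⟩ ↔ (i : ℕ) ≤ A.time c d := by
      constructor
      · intro h1
        have := hs.lt_iff_lt.1 (hθ.1.trans h1)
        simp only [Fin.lt_def, Fin.val_castSucc, htdef] at this
        omega
      · intro h1
        refine hθ.2.trans_le (hs.monotone ?_)
        simp only [Fin.le_def, Fin.val_succ, htdef]
        omega
    refine ⟨c1.trans c2, fun heq => ?_⟩
    have h1 : Real.cos (θ - θ₀) + m t * Real.sin (θ - θ₀) = 0 := by
      rw [heq, sub_self] at e
      exact (mul_eq_zero.1 e.symm).resolve_left (sub_pos.2 hx).ne'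
    have h2 : ¬ θ < s ⟨t + 1, by omega⟩ := by
      rw [← c1, heq]; exact lt_irrefl _
    have h3 : ¬ (i : ℕ) ≤ A.time c d := by rwa [← c2]
    have h4 : s ⟨t + 1, by omega⟩ < θ := by
      refine (hs.monotone ?_).trans_lt hθ.1
      simp only [Fin.le_def, Fin.val_castSucc, htdef]
      omega
    rw [st] at h4
    have hsin := Real.sin_pos_of_pos_of_lt_pi (sub_pos.2 lo) (show θ - θ₀ < Real.pi by linarith)
    have h5 : m t = -Real.cos (θ - θ₀) / Real.sin (θ - θ₀) := by
      rw [eq_div_iff hsin.ne']; linarith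
    -- The sign criterion does not exclude a zero at `θ`. At `θ'`, between the switching angle and
    -- the supposed zero, monotonicity of `-cot` makes the expression positive, although the
    -- switching angle is already passed.
    obtain ⟨θ', h6, h7⟩ := exists_between h4
    have b1 := Real.neg_pi_div_two_lt_arctan (m t)
    have h8 := neg_cot_lt (φ := θ' - θ₀) (ψ := θ - θ₀) (by linarith) (by linarith) (by linarith)
    rw [← h5] at h8
    have h9 : 0 < Real.cos (θ' - θ₀) + m t * Real.sin (θ' - θ₀) := by
      have := Real.sin_pos_of_pos_of_lt_pi (show 0 < θ' - θ₀ by linarith)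
        (show θ' - θ₀ < Real.pi by linarith)
      rw [div_lt_iff₀ this] at h8
      linarith
    rw [cos_add_mul_sin_pos_iff (by linarith) (by linarith)] at h9
    linarith
  intro c d
  rcases eq_or_ne c d with rfl | hcd
  · simp
  rw [A.pos_lt_iff hcd i]
  rcases lt_or_gt_of_ne ((A.pos 0).injective.ne hcd) with h' | h'
  · rw [(main c d h').1]; simp [h']
  · obtain ⟨h1, h2⟩ := main d c h'
    rw [A.time_comm d c] at h1
    have h3 := h'.not_gt
    simp only [h3, false_iff, ← h1, not_lt]
    exact ⟨le_of_lt, fun h4 => lt_of_le_of_ne h4 h2.symm⟩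

theorem realizes_iff (A : AllowableSeq n k) (p : Fin n → Plane) :
    A.Realizes p ↔ A.conf.Realized p :=
  ⟨Realizes.realized, realizes_of_realized⟩

end AllowableSeq

/-! ### From data in general position to a simple allowable sequence -/

/-- Swapping two adjacent elements is a move. -/
theorem isMove_mul_swap {n : ℕ} (σ : Equiv.Perm (Fin n)) {a b : Fin n}
    (h : (σ a : ℕ) + 1 = σ b) : IsMove σ (σ * Equiv.swap a b) := by
  refine ⟨{(σ a, σ b)}, Finset.singleton_nonempty _, ?_, ?_, ?_, ?_⟩
  · simp only [Finset.mem_singleton, forall_eq, Fin.lt_def]; omega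
  · rintro J hJ K hK hne
    rw [Finset.mem_singleton] at hJ hK
    exact absurd (hJ.trans hK.symm) hne
  · simp only [Finset.mem_singleton, forall_eq, Set.mem_Icc, Fin.le_def]
    intro c hc
    have : (σ c : ℕ) = σ a ∨ (σ c : ℕ) = σ b := by omega
    rcases this with h' | h'
    · have : c = a := σ.injective (Fin.ext h')
      subst this; simp; omega
    · have : c = b := σ.injective (Fin.ext h')
      subst this; simp
  · simp only [Finset.mem_singleton, forall_eq, Set.mem_Icc, Fin.le_def]
    intro c hc
    have h1 : c ≠ a := by rintro rfl; apply hc; omega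
    have h2 : c ≠ b := by rintro rfl; apply hc; omega
    simp [Equiv.swap_apply_of_ne_of_ne h1 h2]

namespace Conf

variable {ι : Type}

/-- All connecting lines have different slopes. -/
def Generic (C : Conf ι) : Prop :=
  ∀ a b c d, a ≠ b → c ≠ d → C.key a b = C.key c d → (a = c ∧ b = d) ∨ (a = d ∧ b = c)

/-- The slopes can be replaced by their ranks. -/
theorem exists_rank [Fintype ι] (C : Conf ι) : ∃ (k : ℕ) (r : ι → ι → ℕ),
    (∀ a b, a ≠ b → r a b < k) ∧ (∀ t < k, ∃ a b, a ≠ b ∧ r a b = t) ∧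
    (∀ a b c d, a ≠ b → c ≠ d → (r a b < r c d ↔ C.key a b < C.key c d)) := by
  classical
  let S : Finset ℝ := (Finset.univ.filter fun q : ι × ι => q.1 ≠ q.2).image
    fun q => C.key q.1 q.2
  have hS : ∀ a b, a ≠ b → C.key a b ∈ S := fun a b h =>
    Finset.mem_image.2 ⟨(a, b), by simpa using h, rfl⟩
  let o := S.orderIsoOfFin rfl
  refine ⟨S.card, fun a b => if h : a ≠ b then (o.symm ⟨C.key a b, hS a b h⟩ : ℕ) else 0, ?_, ?_, ?_⟩
  · intro a b h
    simp only [dif_pos h]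
    exact Fin.is_lt _
  · intro t ht
    obtain ⟨⟨a, b⟩, hab, he⟩ := Finset.mem_image.1 (o ⟨t, ht⟩).2
    have hab' : a ≠ b := by simpa using hab
    refine ⟨a, b, hab', ?_⟩
    simp only [dif_pos hab']
    have : (⟨C.key a b, hS a b hab'⟩ : S) = o ⟨t, ht⟩ := Subtype.ext he
    rw [this]; simp
  · intro a b c d hab hcd
    simp only [dif_pos hab, dif_pos hcd, Fin.val_fin_lt, OrderIso.lt_iff_lt, Subtype.mk_lt_mk]

/-- `a` stands before `b` after the reversal of the pairs of rank below `t`. -/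
def Prec (C : Conf ι) (r : ι → ι → ℕ) (t : ℕ) (a b : ι) : Prop :=
  a ≠ b ∧ (C.pos a < C.pos b ↔ t ≤ r a b)

@[simp]
theorem not_prec_self (C : Conf ι) (r : ι → ι → ℕ) (t : ℕ) (a : ι) : ¬ C.Prec r t a a :=
  fun h => h.1 rfl

section rank

variable {C : Conf ι} (hC : C.Valid) {k : ℕ} {r : ι → ι → ℕ}
  (hr : ∀ a b c d, a ≠ b → c ≠ d → (r a b < r c d ↔ C.key a b < C.key c d))

include hC hr

theorem rank_comm {a b : ι} (h : a ≠ b) : r a b = r b a := by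
  have h1 := hr a b b a h h.symm
  have h2 := hr b a a b h.symm h
  rw [hC.symm a b, lt_self_iff_false, iff_false] at h1 h2
  omega

theorem rank_btw {a b c : ι} (hab : C.pos a < C.pos b) (hbc : C.pos b < C.pos c) :
    (r a b < r a c ∧ r a c < r b c) ∨ (r b c < r a c ∧ r a c < r a b) ∨
      (r a b = r a c ∧ r a c = r b c) := by
  have nab : a ≠ b := by rintro rfl; exact lt_irrefl _ hab
  have nbc : b ≠ c := by rintro rfl; exact lt_irrefl _ hbc
  have nac : a ≠ c := by rintro rfl; exact lt_asymm hab hbc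
  have h := hC.btw a b c hab hbc
  have e1 := hr a b a c nab nac
  have e2 := hr a c a b nac nab
  have e3 := hr a c b c nac nbc
  have e4 := hr b c a c nbc nac
  rcases h with h | h | h
  · exact Or.inl ⟨e1.2 h.1, e3.2 h.2⟩
  · exact Or.inr (Or.inl ⟨e4.2 h.1, e2.2 h.2⟩)
  · rw [h.1, lt_self_iff_false, iff_false] at e1 e2
    rw [h.2, lt_self_iff_false, iff_false] at e3 e4
    omega

theorem Prec.asymm {t : ℕ} {a b : ι} (h : C.Prec r t a b) : ¬ C.Prec r t b a := by
  rintro ⟨-, h'⟩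
  obtain ⟨hne, h⟩ := h
  rw [rank_comm hC hr hne.symm] at h'
  have := lt_or_gt_of_ne (hC.inj.ne hne)
  have := @lt_asymm _ _ (C.pos a) (C.pos b)
  tauto

theorem Prec.total {t : ℕ} {a b : ι} (hne : a ≠ b) : C.Prec r t a b ∨ C.Prec r t b a := by
  unfold Prec
  rw [rank_comm hC hr hne.symm]
  have h1 := hne.symm
  have := lt_or_gt_of_ne (hC.inj.ne hne)
  have := @lt_asymm _ _ (C.pos a) (C.pos b)
  tauto

/-- For three elements the rank of the outer pair lies between the ranks of the other two pairs
(`rank_btw`), so no threshold `t` reverses them into a cycle. -/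
theorem Prec.trans {t : ℕ} {a b c : ι} (hab : C.Prec r t a b) (hbc : C.Prec r t b c) :
    C.Prec r t a c := by
  have hne : a ≠ c := by
    rintro rfl; exact Prec.asymm hC hr hab hbc
  obtain ⟨n1, h1⟩ := hab
  obtain ⟨n2, h2⟩ := hbc
  refine ⟨hne, ?_⟩
  have c1 := rank_comm hC hr n1
  have c2 := rank_comm hC hr n2
  have c3 := rank_comm hC hr hne
  rcases lt_or_gt_of_ne (hC.inj.ne n1) with h3 | h3 <;>
  rcases lt_or_gt_of_ne (hC.inj.ne n2) with h4 | h4 <;>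
  rcases lt_or_gt_of_ne (hC.inj.ne hne) with h5 | h5 <;>
  simp only [h3, h4, h5, h3.not_gt, h4.not_gt, h5.not_gt, true_iff, false_iff] at h1 h2 ⊢
  · have := rank_btw hC hr h3 h4; omega
  · exact absurd (h3.trans h4) h5.not_gt
  · have := rank_btw hC hr h5 h4; omega
  · have := rank_btw hC hr h5 h3; omega
  · have := rank_btw hC hr h3 h5; omega
  · have := rank_btw hC hr h4 h5; omega
  · exact absurd (h4.trans h3) h5.not_gt
  · have := rank_btw hC hr h4 h3; omega

-- `Prec` is a strict linear order on a finite set, so counting predecessors numbers the elements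
-- bijectively.
open Classical in
theorem exists_prec_equiv [Fintype ι] (t : ℕ) : ∃ e : ι ≃ Fin (Fintype.card ι),
    ∀ a, (e a : ℕ) = (Finset.univ.filter fun c => C.Prec r t c a).card := by
  have hlt : ∀ a, (Finset.univ.filter fun c => C.Prec r t c a).card < Fintype.card ι := by
    intro a
    refine Finset.card_lt_univ_of_notMem (x := a) ?_
    simp
  have hinj : Function.Injective
      fun a => (⟨_, hlt a⟩ : Fin (Fintype.card ι)) := by
    have key : ∀ a b, C.Prec r t a b → (Finset.univ.filter fun c => C.Prec r t c a).card <
        (Finset.univ.filter fun c => C.Prec r t c b).card := by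
      intro a b hab
      apply Finset.card_lt_card
      rw [Finset.ssubset_iff_of_subset]
      · exact ⟨a, by simpa using hab, by simp⟩
      · intro c hc
        simp only [Finset.mem_filter, Finset.mem_univ, true_and] at hc ⊢
        exact Prec.trans hC hr hc hab
    intro a b hab
    by_contra hne
    have h := congrArg Fin.val hab
    rcases Prec.total hC hr (t := t) hne with h' | h'
    · exact (key _ _ h').ne h
    · exact (key _ _ h').ne h.symm
  refine ⟨Equiv.ofBijective _ ((Fintype.bijective_iff_injective_and_card _).2 ⟨hinj, by simp⟩), ?_⟩
  intro a; rfl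

end rank

open Classical in
/-- Data in general position come from a simple allowable sequence. -/
theorem exists_simple [Fintype ι] {C : Conf ι} (hC : C.Valid) (hg : C.Generic) :
    ∃ (k : ℕ) (A : AllowableSeq (Fintype.card ι) k) (ε : ι ≃ Fin (Fintype.card ι)),
      A.IsSimple ∧ (A.conf.comap ε).Equiv C := by
  obtain ⟨k, r, hrk, hrs, hr⟩ := C.exists_rank
  choose e he using fun t => exists_prec_equiv hC hr t
  have elt : ∀ t a b, e t a < e t b ↔ C.Prec r t a b := by
    have key : ∀ t a b, C.Prec r t a b → e t a < e t b := by
      intro t a b hab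
      rw [Fin.lt_def, he, he]
      apply Finset.card_lt_card
      rw [Finset.ssubset_iff_of_subset]
      · exact ⟨a, by simpa using hab, by simp⟩
      · intro c hc
        simp only [Finset.mem_filter, Finset.mem_univ, true_and] at hc ⊢
        exact Prec.trans hC hr hc hab
    intro t a b
    refine ⟨fun h => ?_, key t a b⟩
    have hne : a ≠ b := by rintro rfl; exact lt_irrefl _ h
    exact (Prec.total hC hr hne).resolve_right fun h' => lt_asymm h (key _ _ _ h')
  -- only the pair of rank `t` changes its order in the move `t`
  have hchange : ∀ t a b, a ≠ b → r a b ≠ t → (C.Prec r (t + 1) a b ↔ C.Prec r t a b) := by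
    intro t a b hne h
    have : t + 1 ≤ r a b ↔ t ≤ r a b := by omega
    simp only [Prec, this]
  have hswap : ∀ t a b, r a b = t → C.Prec r t a b → C.Prec r (t + 1) b a := by
    intro t a b h hab
    refine (Prec.total hC hr hab.1).resolve_left fun h' => ?_
    have h1 := hab.2
    have h2 := h'.2
    rw [h] at h1 h2
    simp at h1 h2
    exact absurd h1 (not_lt.2 h2)
  have hmove : ∀ t < k, ∃ a b, a ≠ b ∧ r a b = t ∧ (e t a : ℕ) + 1 = e t b ∧
      ∀ c, e (t + 1) c = e t (Equiv.swap a b c) := by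
    intro t ht
    obtain ⟨a, b, hab, hrt, hp⟩ : ∃ a b, a ≠ b ∧ r a b = t ∧ C.Prec r t a b := by
      obtain ⟨a, b, hne, h⟩ := hrs t ht
      rcases Prec.total hC hr (t := t) hne with h' | h'
      · exact ⟨a, b, hne, h, h'⟩
      · exact ⟨b, a, hne.symm, by rw [rank_comm hC hr hne.symm, h], h'⟩
    -- Genericity enters here: each rank belongs to a single unordered pair.
    have honly : ∀ c d, c ≠ d → r c d = t → (c = a ∧ d = b) ∨ (c = b ∧ d = a) := by
      intro c d hcd h
      apply hg _ _ _ _ hcd hab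
      have h1 := hr c d a b hcd hab
      have h2 := hr a b c d hab hcd
      rw [h, hrt, lt_self_iff_false, false_iff] at h1 h2
      exact le_antisymm (not_lt.1 h2) (not_lt.1 h1)
    have hsw := hswap t a b hrt hp
    -- An element strictly between `a` and `b` would stay after `a` and before `b`, as only the pair
    -- `a, b` switches, but afterwards `b` precedes `a`. Hence `a` and `b` are adjacent.
    have hA : (Finset.univ.filter fun c => C.Prec r t c b) =
        insert a (Finset.univ.filter fun c => C.Prec r t c a) := by
      ext c
      simp only [Finset.mem_filter, Finset.mem_univ, true_and, Finset.mem_insert]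
      constructor
      · intro hc
        rcases eq_or_ne c a with h | h
        · exact Or.inl h
        · right
          refine (Prec.total hC hr h).resolve_right fun h' => ?_
          have h1 : C.Prec r (t + 1) a c := (hchange _ _ _ h.symm (fun h2 => by
            rcases honly _ _ h.symm h2 with h3 | h3
            · exact hc.1 h3.2
            · exact hab h3.1)).2 h'
          have h2 : C.Prec r (t + 1) c b := (hchange _ _ _ hc.1 (fun h2 => by
            rcases honly _ _ hc.1 h2 with h3 | h3
            · exact h h3.1
            · exact hab h3.2.symm)).2 hc
          exact Prec.asymm hC hr hsw (Prec.trans hC hr h1 h2)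
      · rintro (rfl | h)
        · exact hp
        · exact Prec.trans hC hr h hp
    have e1 : (e t a : ℕ) + 1 = e t b := by
      rw [he, he, hA, Finset.card_insert_of_notMem (by simp)]
    refine ⟨a, b, hab, hrt, e1, ?_⟩
    have hB : (Finset.univ.filter fun c => C.Prec r (t + 1) c b) =
        (Finset.univ.filter fun c => C.Prec r t c a) := by
      ext c
      simp only [Finset.mem_filter, Finset.mem_univ, true_and]
      rcases eq_or_ne c a with rfl | h
      · constructor
        · intro h; exact absurd h (Prec.asymm hC hr hsw)
        · intro h; exact absurd rfl h.1
      rcases eq_or_ne c b with rfl | h'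
      · constructor
        · intro h; exact absurd rfl h.1
        · intro h; exact absurd h (Prec.asymm hC hr hp)
      rw [hchange _ _ _ h' (fun h2 => by
            rcases honly _ _ h' h2 with h3 | h3
            · exact h h3.1
            · exact h' h3.1)]
      have := congrArg (c ∈ ·) hA
      simpa [h] using this
    have hA' : (Finset.univ.filter fun c => C.Prec r (t + 1) c a) =
        insert b (Finset.univ.filter fun c => C.Prec r t c a) := by
      ext c
      simp only [Finset.mem_filter, Finset.mem_univ, true_and, Finset.mem_insert]
      rcases eq_or_ne c b with rfl | h
      · simpa using hsw
      rcases eq_or_ne c a with rfl | h'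
      · simp [Prec, hab]
      rw [hchange _ _ _ h' (fun h2 => by
            rcases honly _ _ h' h2 with h3 | h3
            · exact h' h3.1
            · exact h h3.1)]
      simp [h]
    intro c
    apply Fin.ext
    rcases eq_or_ne c a with rfl | h
    · rw [Equiv.swap_apply_left, ← e1, he, he, hA', Finset.card_insert_of_notMem]
      simpa using Prec.asymm hC hr hp
    rcases eq_or_ne c b with rfl | h'
    · rw [Equiv.swap_apply_right, he, he, hB]
    rw [Equiv.swap_apply_of_ne_of_ne h h', he, he]
    congr 1
    ext d
    simp only [Finset.mem_filter, Finset.mem_univ, true_and]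
    rcases eq_or_ne d c with rfl | h2
    · simp [Prec]
    · exact hchange _ _ _ h2 fun h3 => by
        rcases honly _ _ h2 h3 with h4 | h4
        · exact h' h4.2
        · exact h h4.2
  let ε := e 0
  -- The elements are named by their initial positions, so that `π 0` is the identity.
  let π : ℕ → Equiv.Perm (Fin (Fintype.card ι)) := fun t => ε.symm.trans (e t)
  have hstep : ∀ t < k, ∃ a b, a ≠ b ∧ r (ε.symm a) (ε.symm b) = t ∧ (π t a : ℕ) + 1 = π t b ∧
      π (t + 1) = π t * Equiv.swap a b := by
    intro t ht
    obtain ⟨a, b, h1, h2, h3, h4⟩ := hmove t ht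
    refine ⟨ε a, ε b, ε.injective.ne h1, by simpa using h2, by simpa [π] using h3, ?_⟩
    ext c
    obtain ⟨c, rfl⟩ := ε.surjective c
    simp only [π, Equiv.trans_apply, Equiv.symm_apply_apply, Equiv.Perm.mul_apply, h4]
    rw [← ε.injective.map_swap, Equiv.symm_apply_apply]
  have hrev : ∀ t a b, a ≠ b → (Reversed (π t) (π (t + 1)) a b ↔
      t = r (ε.symm a) (ε.symm b)) := by
    intro t a b hab
    obtain ⟨a, rfl⟩ := ε.surjective a
    obtain ⟨b, rfl⟩ := ε.surjective b
    have hne : a ≠ b := fun h => hab (by rw [h])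
    simp only [Reversed, π, Equiv.trans_apply, Equiv.symm_apply_apply, elt, ne_eq, hab,
      not_false_eq_true, true_and]
    by_cases h : t = r a b
    · simp only [h, iff_true]
      constructor
      · intro h1; exact hswap _ _ _ rfl h1
      · intro h1
        refine (Prec.total hC hr hne).resolve_right fun h2 => ?_
        exact Prec.asymm hC hr (hswap _ b a (rank_comm hC hr hne.symm) h2) h1
    · simp only [h, iff_false]
      rw [hchange t b a hne.symm (by rw [rank_comm hC hr hne.symm]; exact fun h' => h h'.symm)]
      intro h1
      rcases Prec.total hC hr (t := t) hne with h2 | h2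
      · exact Prec.asymm hC hr h2 (h1.1 h2)
      · exact Prec.asymm hC hr h2 (h1.2 h2)
  let A : AllowableSeq (Fintype.card ι) k :=
    { pos := fun t => π t
      isMove := fun t => by
        obtain ⟨a, b, -, -, h3, h4⟩ := hstep t t.isLt
        simp only [Fin.val_castSucc, Fin.val_succ]
        rw [h4]
        exact isMove_mul_swap _ h3
      reversed_once := fun a b hab => by
        have hlt := hrk (ε.symm a) (ε.symm b) (ε.symm.injective.ne hab)
        refine ⟨⟨_, hlt⟩, (hrev _ a b hab).2 rfl, fun t ht => Fin.ext ((hrev _ a b hab).1 ht)⟩ }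
  refine ⟨k, A, ε, ?_, ?_, ?_⟩
  · intro t
    obtain ⟨a, b, -, -, h3, h4⟩ := hstep t t.isLt
    exact ⟨a, b, h3, h4⟩
  · intro a b
    have h : A.pos 0 (ε a) < A.pos 0 (ε b) ↔ C.Prec r 0 a b := by
      rw [← elt]; simp [A, π, ε]
    simp only [comap, AllowableSeq.conf, Nat.cast_lt, Fin.val_fin_lt, h]
    constructor
    · intro h; exact h.2.2 (Nat.zero_le _)
    · intro h; exact ⟨by rintro rfl; exact lt_irrefl _ h, by simpa using h⟩
  · have ht : ∀ a b, a ≠ b → A.time (ε a) (ε b) = r a b := by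
      intro a b hab
      have : A.Switched ⟨r a b, hrk a b hab⟩ (ε a) (ε b) :=
        (hrev _ _ _ (ε.injective.ne hab)).2 (by simp)
      exact this.time_eq
    intro a b c d hab hcd
    simp only [comap, AllowableSeq.conf, ht a b hab, ht c d hcd, Nat.cast_lt, hr a b c d hab hcd]

end Conf

open Filter Topology

/-! ### A flat quadrilateral -/

/-- The coordinates of the vertices of a small quadrilateral around the origin along one axis. -/
def quadX (ρ : ℝ) : Fin 4 → ℝ := ![1 + ρ ^ 2, 1, -ρ - ρ ^ 2 - ρ ^ 3, -ρ]

/-- The reflection of the quadrilateral in its diagonal. -/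
def quadFlip : Fin 4 → Fin 4 := ![0, 3, 2, 1]

/-- The coordinates of the vertices along the other axis. -/
def quadZ (ρ : ℝ) (r : Fin 4) : ℝ := quadX ρ (quadFlip r)

/-- The slope of a side or diagonal of the quadrilateral. -/
noncomputable def quadSlope (ρ : ℝ) (r q : Fin 4) : ℝ :=
  (quadZ ρ r - quadZ ρ q) / (quadX ρ r - quadX ρ q)

/-- The vertex has positive coordinate. -/
def IsRight (r : Fin 4) : Prop := (r : ℕ) < 2

instance : DecidablePred IsRight := fun r => inferInstanceAs (Decidable ((r : ℕ) < 2))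

/-- The rank of the vertex along the axis. -/
def quadRank : Fin 4 → ℕ := ![3, 2, 0, 1]

/-- The rank of the slope of a side or diagonal; it has the sign of the slope. -/
def slopeRank : Fin 4 → Fin 4 → ℤ := ![![0, 6, 4, 2], ![6, 0, 3, -2], ![4, 3, 0, 5], ![2, -2, 5, 0]]

theorem quadX_lt {ρ : ℝ} (h : 0 < ρ) {r q : Fin 4} (hrq : quadRank r < quadRank q) :
    quadX ρ r < quadX ρ q := by
  have h2 := pow_pos h 2
  have h3 := pow_pos h 3
  fin_cases r <;> fin_cases q <;> simp [quadRank, quadX] at hrq ⊢ <;> linarith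

theorem quadRank_injective : Function.Injective quadRank := by decide

theorem quadX_lt_iff {ρ : ℝ} (h : 0 < ρ) {r q : Fin 4} :
    quadX ρ r < quadX ρ q ↔ quadRank r < quadRank q := by
  refine ⟨fun h' => ?_, quadX_lt h⟩
  by_contra hcon
  rcases eq_or_lt_of_le (not_lt.1 hcon) with e | e
  · rw [quadRank_injective e] at h'; exact lt_irrefl _ h'
  · exact lt_asymm h' (quadX_lt h e)

theorem quadX_pos {ρ : ℝ} {r : Fin 4} (hr : IsRight r) : 0 < quadX ρ r := by
  fin_cases r <;> simp [IsRight, quadX] at hr ⊢; positivity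

theorem quadX_neg {ρ : ℝ} (h : 0 < ρ) {r : Fin 4} (hr : ¬ IsRight r) : quadX ρ r < 0 := by
  have h2 := pow_pos h 2
  have h3 := pow_pos h 3
  fin_cases r <;> simp [IsRight, quadX] at hr ⊢ <;> linarith

theorem quadX_injective {ρ : ℝ} (h : 0 < ρ) : Function.Injective (quadX ρ) := by
  intro r q hrq
  rcases lt_trichotomy (quadRank r) (quadRank q) with e | e | e
  · exact absurd hrq (quadX_lt h e).ne
  · exact quadRank_injective e
  · exact absurd hrq (quadX_lt h e).ne'

theorem quadSlope_comm (ρ : ℝ) (r q : Fin 4) : quadSlope ρ r q = quadSlope ρ q r := by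
  unfold quadSlope
  rw [← neg_div_neg_eq]; congr 1 <;> ring

theorem slopeRank_eq {r q r' q' : Fin 4} (h : r ≠ q) (h' : slopeRank r q = slopeRank r' q') :
    (r = r' ∧ q = q') ∨ (r = q' ∧ q = r') := by
  revert r q r' q'; decide

/-- The values `-1, 0, 1` stay free for lines through old elements. Near the slope of `xy`, the
slopes of new pairs deviate by order `δ`, those of an old and a new element only by order `δ²`, and
those of old pairs not at all. -/
theorem slopeRank_cases {r q : Fin 4} (h : r ≠ q) : slopeRank r q = -2 ∨ 2 ≤ slopeRank r q := by
  revert r q; decide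

/-- Reflection in the diagonal inverts slopes, so two of the positive slopes are reciprocals of two
others, the diagonals having slopes `1` and `-1`. Without the term `ρ ^ 3` in vertex 2 the figure
would be a parallelogram with parallel opposite sides; the cubic term makes all six slopes
different. -/
theorem quadSlope_lt {ρ : ℝ} (h : 0 < ρ) :
    quadSlope ρ 1 3 < 0 ∧ 0 < quadSlope ρ 0 3 ∧ quadSlope ρ 0 3 < quadSlope ρ 1 2 ∧
    quadSlope ρ 1 2 < quadSlope ρ 0 2 ∧ quadSlope ρ 0 2 < quadSlope ρ 2 3 ∧
    quadSlope ρ 2 3 < quadSlope ρ 0 1 := by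
  have p := h.le
  have e13 : quadSlope ρ 1 3 = -1 := by
    simp only [quadSlope, quadZ, quadX, quadFlip]
    simp
    rw [div_eq_iff (by positivity)]; ring
  have e02 : quadSlope ρ 0 2 = 1 := by
    simp only [quadSlope, quadZ, quadX, quadFlip]
    simp
    have : 0 < 1 + ρ ^ 2 - (-ρ - ρ ^ 2 - ρ ^ 3) := by ring_nf; positivity
    exact this.ne'
  have e03 : quadSlope ρ 0 3 = ρ ^ 2 / (1 + ρ + ρ ^ 2) := by
    simp only [quadSlope, quadZ, quadX, quadFlip]
    simp
    congr 1; ring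
  have e01 : quadSlope ρ 0 1 = (1 + ρ + ρ ^ 2) / ρ ^ 2 := by
    simp only [quadSlope, quadZ, quadX, quadFlip]
    simp
    congr 1; ring
  have e12 : quadSlope ρ 1 2 = (ρ ^ 2 + ρ ^ 3) / (1 + ρ + ρ ^ 2 + ρ ^ 3) := by
    simp only [quadSlope, quadZ, quadX, quadFlip]
    simp
    congr 1 <;> ring
  have e23 : quadSlope ρ 2 3 = (1 + ρ + ρ ^ 2 + ρ ^ 3) / (ρ ^ 2 + ρ ^ 3) := by
    rw [quadSlope_comm]
    simp only [quadSlope, quadZ, quadX, quadFlip]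
    simp
    congr 1 <;> ring
  rw [e13, e02, e03, e01, e12, e23]
  refine ⟨by norm_num, by positivity, ?_, ?_, ?_, ?_⟩
  · rw [div_lt_div_iff₀ (by positivity) (by positivity), ← sub_pos]; ring_nf; positivity
  · rw [div_lt_one (by positivity), ← sub_pos]; ring_nf; positivity
  · rw [one_lt_div (by positivity), ← sub_pos]; ring_nf; positivity
  · rw [div_lt_div_iff₀ (by positivity) (by positivity), ← sub_pos]; ring_nf; positivity

theorem quadSlope_cases {r q : Fin 4} (h : r ≠ q) (ρ : ℝ) :
    (slopeRank r q = -2 ∧ quadSlope ρ r q = quadSlope ρ 1 3) ∨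
    (slopeRank r q = 2 ∧ quadSlope ρ r q = quadSlope ρ 0 3) ∨
    (slopeRank r q = 3 ∧ quadSlope ρ r q = quadSlope ρ 1 2) ∨
    (slopeRank r q = 4 ∧ quadSlope ρ r q = quadSlope ρ 0 2) ∨
    (slopeRank r q = 5 ∧ quadSlope ρ r q = quadSlope ρ 2 3) ∨
    (slopeRank r q = 6 ∧ quadSlope ρ r q = quadSlope ρ 0 1) := by
  have e := quadSlope_comm ρ
  fin_cases r <;> fin_cases q <;> simp [slopeRank, e 3, e 2 0, e 2 1, e 1 0] at h ⊢

theorem quadSlope_lt_of_rank {ρ : ℝ} (h : 0 < ρ) {r q r' q' : Fin 4} (hrq : r ≠ q) (hrq' : r' ≠ q')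
    (hlt : slopeRank r q < slopeRank r' q') : quadSlope ρ r q < quadSlope ρ r' q' := by
  obtain ⟨h1, h2, h3, h4, h5, h6⟩ := quadSlope_lt h
  rcases quadSlope_cases hrq ρ with ⟨e, e'⟩ | ⟨e, e'⟩ | ⟨e, e'⟩ | ⟨e, e'⟩ | ⟨e, e'⟩ | ⟨e, e'⟩ <;>
  rcases quadSlope_cases hrq' ρ with ⟨g, g'⟩ | ⟨g, g'⟩ | ⟨g, g'⟩ | ⟨g, g'⟩ | ⟨g, g'⟩ | ⟨g, g'⟩ <;>
  rw [e, g] at hlt <;> first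
    | (exfalso; revert hlt; norm_num; done)
    | (rw [e', g']; linarith)

theorem quadSlope_pos {ρ : ℝ} (h : 0 < ρ) {r q : Fin 4} (hrq : r ≠ q)
    (hlt : 0 < slopeRank r q) : 0 < quadSlope ρ r q := by
  obtain ⟨h1, h2, h3, h4, h5, h6⟩ := quadSlope_lt h
  rcases quadSlope_cases hrq ρ with ⟨e, e'⟩ | ⟨e, e'⟩ | ⟨e, e'⟩ | ⟨e, e'⟩ | ⟨e, e'⟩ | ⟨e, e'⟩ <;>
    rw [e'] <;> linarith

theorem quadSlope_neg {ρ : ℝ} (h : 0 < ρ) {r q : Fin 4} (hrq : r ≠ q)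
    (hlt : slopeRank r q < 0) : quadSlope ρ r q < 0 := by
  obtain ⟨h1, h2, h3, h4, h5, h6⟩ := quadSlope_lt h
  rcases quadSlope_cases hrq ρ with ⟨e, e'⟩ | ⟨e, e'⟩ | ⟨e, e'⟩ | ⟨e, e'⟩ | ⟨e, e'⟩ | ⟨e, e'⟩ <;>
    rw [e'] <;> linarith

/-! ### The quotients of coordinates of the quadrilateral by distances -/

/-- The order-theoretic meaning of `(a - c)⁻¹ < (b - c)⁻¹`. -/
def InvLt (c a b : ℝ) : Prop := (a < c ∧ c < b) ∨ (b < a ∧ (c < b ∨ a < c))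

theorem InvLt.lt {c a b : ℝ} (h : InvLt c a b) : (a - c)⁻¹ < (b - c)⁻¹ := by
  rcases h with ⟨h1, h2⟩ | ⟨h1, h2 | h2⟩
  · exact (inv_lt_zero.2 (sub_neg.2 h1)).trans (inv_pos.2 (sub_pos.2 h2))
  · rw [inv_lt_inv₀ (by linarith) (by linarith)]; linarith
  · rw [inv_lt_inv_of_neg (by linarith) (by linarith)]; linarith

theorem InvLt.total {c a b : ℝ} (ha : a ≠ c) (hb : b ≠ c) (hab : a ≠ b) :
    InvLt c a b ∨ InvLt c b a := by
  unfold InvLt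
  rcases lt_or_gt_of_ne ha with h1 | h1 <;> rcases lt_or_gt_of_ne hb with h2 | h2 <;>
  rcases lt_or_gt_of_ne hab with h3 | h3 <;> simp [h1, h2, h3]

/-- The order-theoretic meaning of `x r / (a - c) < x q / (b - c)` for a small quadrilateral with
coordinates `x`. -/
def QuotLt (c : ℝ) (r : Fin 4) (a : ℝ) (q : Fin 4) (b : ℝ) : Prop :=
  (IsRight r ∧ IsRight q ∧ InvLt c a b) ∨ (¬ IsRight r ∧ ¬ IsRight q ∧ InvLt c b a) ∨
  (IsRight r ∧ ¬ IsRight q ∧ a < c) ∨ (¬ IsRight r ∧ IsRight q ∧ c < b) ∨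
  ((IsRight r ↔ IsRight q) ∧ a = b ∧
    ((c < a ∧ quadRank r < quadRank q) ∨ (a < c ∧ quadRank q < quadRank r)))

/-- Two quotients tie only for the same vertex and the same abscissa. This gives different slopes to
different lines that join old elements to vertices. -/
theorem QuotLt.total {c a b : ℝ} {r q : Fin 4} (ha : a ≠ c) (hb : b ≠ c) :
    QuotLt c r a q b ∨ QuotLt c q b r a ∨ (a = b ∧ r = q) := by
  unfold QuotLt
  by_cases hr : IsRight r <;> by_cases hq : IsRight q <;>
    simp only [hr, hq, true_and, not_true, false_and, or_false, false_or, not_false_eq_true,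
      iff_true, iff_false]
  · rcases eq_or_ne a b with rfl | hab
    · rcases lt_trichotomy (quadRank r) (quadRank q) with h | h | h
      · rcases lt_or_gt_of_ne ha with h' | h' <;> simp [h, h']
      · simp [quadRank_injective h]
      · rcases lt_or_gt_of_ne ha with h' | h' <;> simp [h, h']
    · have := InvLt.total ha hb hab
      tauto
  · rcases lt_or_gt_of_ne ha with h' | h' <;> simp [h']
  · rcases lt_or_gt_of_ne hb with h' | h' <;> simp [h']
  · rcases eq_or_ne a b with rfl | hab
    · rcases lt_trichotomy (quadRank r) (quadRank q) with h | h | h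
      · rcases lt_or_gt_of_ne ha with h' | h' <;> simp [h, h']
      · simp [quadRank_injective h]
      · rcases lt_or_gt_of_ne ha with h' | h' <;> simp [h, h']
    · have := InvLt.total ha hb hab
      tauto

theorem continuous_quadX (r : Fin 4) : Continuous fun ρ => quadX ρ r := by
  fin_cases r <;> simp only [quadX] <;> simp <;> fun_prop

theorem tendsto_quadX_right {r : Fin 4} (hr : IsRight r) :
    Tendsto (fun ρ => quadX ρ r) (𝓝[>] 0) (𝓝 1) := by
  have h := ((continuous_quadX r).tendsto 0).mono_left (nhdsWithin_le_nhds (s := Set.Ioi 0))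
  have e : quadX 0 r = 1 := by
    fin_cases r <;> simp [IsRight, quadX] at hr ⊢
  rwa [e] at h

theorem tendsto_quadX_left {r : Fin 4} (hr : ¬ IsRight r) :
    Tendsto (fun ρ => quadX ρ r) (𝓝[>] 0) (𝓝 0) := by
  have h := ((continuous_quadX r).tendsto 0).mono_left (nhdsWithin_le_nhds (s := Set.Ioi 0))
  have e : quadX 0 r = 0 := by
    fin_cases r <;> simp [IsRight, quadX] at hr ⊢
  rwa [e] at h

theorem tendsto_quadX_left_div {r : Fin 4} (hr : ¬ IsRight r) :
    Tendsto (fun ρ => quadX ρ r / ρ) (𝓝[>] 0) (𝓝 (-1)) := by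
  have h : Tendsto (fun ρ : ℝ => (![0, 0, -1 - ρ - ρ ^ 2, -1] : Fin 4 → ℝ) r) (𝓝[>] 0) (𝓝 (-1)) := by
    have hc : Continuous fun ρ : ℝ => (![0, 0, -1 - ρ - ρ ^ 2, -1] : Fin 4 → ℝ) r := by
      fin_cases r <;> simp <;> fun_prop
    have h := (hc.tendsto 0).mono_left (nhdsWithin_le_nhds (s := Set.Ioi 0))
    have e : (![0, 0, -1 - (0 : ℝ) - 0 ^ 2, -1] : Fin 4 → ℝ) r = -1 := by
      fin_cases r <;> simp [IsRight] at hr ⊢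
    rwa [e] at h
  refine h.congr' ?_
  filter_upwards [self_mem_nhdsWithin] with ρ hρ
  have : ρ ≠ 0 := (Set.mem_Ioi.1 hρ).ne'
  fin_cases r <;> simp [IsRight, quadX] at hr ⊢
  · field_simp
  · field_simp

/-- Coordinates of right vertices tend to `1` and those of left vertices to `0` like `-ρ`. Limits
therefore decide all comparisons, after division by `ρ` for two left vertices. Only for `a = b` and
vertices on the same side do the exact coordinates matter. -/
theorem QuotLt.eventually {c a b : ℝ} {r q : Fin 4} (h : QuotLt c r a q b) :
    ∀ᶠ ρ in 𝓝[>] (0 : ℝ), quadX ρ r / (a - c) < quadX ρ q / (b - c) := by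
  rcases h with ⟨hr, hq, h⟩ | ⟨hr, hq, h⟩ | ⟨hr, hq, h⟩ | ⟨hr, hq, h⟩ | ⟨-, rfl, h⟩
  · have h1 := (tendsto_quadX_right hr).div_const (a - c)
    have h2 := (tendsto_quadX_right hq).div_const (b - c)
    exact h1.eventually_lt h2 (by simpa using h.lt)
  · have h1 := (tendsto_quadX_left_div hr).div_const (a - c)
    have h2 := (tendsto_quadX_left_div hq).div_const (b - c)
    filter_upwards [h1.eventually_lt h2 (by simpa [neg_div] using h.lt), self_mem_nhdsWithin]
      with ρ h3 h4
    have h4 : 0 < ρ := h4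
    have h5 := mul_lt_mul_of_pos_left h3 h4
    have e : ∀ r d, ρ * (quadX ρ r / ρ / d) = quadX ρ r / d := by
      intro r d; field_simp
    rwa [e, e] at h5
  · have h1 := (tendsto_quadX_right hr).div_const (a - c)
    have h2 := (tendsto_quadX_left hq).div_const (b - c)
    exact h1.eventually_lt h2 (by simpa using h)
  · have h1 := (tendsto_quadX_left hr).div_const (a - c)
    have h2 := (tendsto_quadX_right hq).div_const (b - c)
    exact h1.eventually_lt h2 (by simpa using h)
  · filter_upwards [self_mem_nhdsWithin] with ρ hρ
    rcases h with ⟨h1, h2⟩ | ⟨h1, h2⟩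
    · exact div_lt_div_of_pos_right (quadX_lt hρ h2) (sub_pos.2 h1)
    · exact div_lt_div_of_neg_of_lt (sub_neg.2 h1) (quadX_lt hρ h2)

theorem quadX_div_pos {c a ρ : ℝ} (hρ : 0 < ρ) {r : Fin 4} (ha : a ≠ c) (h : IsRight r ↔ c < a) :
    0 < quadX ρ r / (a - c) := by
  rcases lt_or_gt_of_ne ha with h' | h'
  · exact div_pos_of_neg_of_neg (quadX_neg hρ (by rw [h]; exact h'.not_gt)) (sub_neg.2 h')
  · exact div_pos (quadX_pos (h.2 h')) (sub_pos.2 h')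

theorem quadX_div_neg {c a ρ : ℝ} (hρ : 0 < ρ) {r : Fin 4} (ha : a ≠ c) (h : IsRight r ↔ a < c) :
    quadX ρ r / (a - c) < 0 := by
  rcases lt_or_gt_of_ne ha with h' | h'
  · exact div_neg_of_pos_of_neg (quadX_pos (h.2 h')) (sub_neg.2 h')
  · exact div_neg_of_neg_of_pos (quadX_neg hρ (by rw [h]; exact h'.not_gt)) (sub_pos.2 h')

/-! ### Replacing an element by a small quadrilateral -/

/-- The pairs of elements after the element `x` is replaced by four elements: two old elements, an
old and a new one, or two new ones. -/
inductive ExtPair {ι : Type} (x : ι) : Type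
  | oo (j k : {a // a ≠ x}) : ExtPair x
  | on (j : {a // a ≠ x}) (r : Fin 4) : ExtPair x
  | nn (r q : Fin 4) : ExtPair x

namespace ExtPair

variable {ι : Type} {x : ι}

instance [Finite ι] : Finite (ExtPair x) := by
  let g : ({a // a ≠ x} × {a // a ≠ x}) ⊕ ({a // a ≠ x} × Fin 4) ⊕ (Fin 4 × Fin 4) → ExtPair x :=
    Sum.elim (fun z => oo z.1 z.2) (Sum.elim (fun z => on z.1 z.2) (fun z => nn z.1 z.2))
  refine Finite.of_surjective g ?_
  rintro (⟨j, k⟩ | ⟨j, r⟩ | ⟨r, q⟩)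
  · exact ⟨Sum.inl (j, k), rfl⟩
  · exact ⟨Sum.inr (Sum.inl (j, r)), rfl⟩
  · exact ⟨Sum.inr (Sum.inr (r, q)), rfl⟩

/-- The two elements of the pair are different. -/
def Proper : ExtPair x → Prop
  | oo j k => j ≠ k
  | on _ _ => True
  | nn r q => r ≠ q

/-- The pair of original elements whose slope the slope of the pair is close to; two new elements
lie close to the line through `x` and `y`. -/
def base (y : ι) : ExtPair x → ι × ι
  | oo j k => (j, k)
  | on j _ => (j, x)
  | nn _ _ => (y, x)

theorem base_ne {y : ι} (hy : y ≠ x) {P : ExtPair x} (hP : P.Proper) :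
    (P.base y).1 ≠ (P.base y).2 := by
  cases P with
  | oo j k => exact fun h => hP (Subtype.ext h)
  | on j r => exact j.2
  | nn r q => exact hy

/-- The two pairs are equal up to order, or consist of old elements and have equal slopes. -/
def Same (C : Conf ι) : ExtPair x → ExtPair x → Prop
  | oo j k, oo l m => C.key j k = C.key l m
  | on j r, on k q => j = k ∧ r = q
  | nn r q, nn r' q' => (r = r' ∧ q = q') ∨ (r = q' ∧ q = r')
  | _, _ => False

end ExtPair

namespace Conf

variable {ι : Type} {x : ι}

open ExtPair

/-- The slope to which the slope of a pair is close. -/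
def baseKey (C : Conf ι) (y : ι) (P : ExtPair x) : ℝ := C.key (P.base y).1 (P.base y).2

/-- The deviation of the slope of a pair from the original slope, divided by the size `δ` of the
quadrilateral. -/
noncomputable def rate (C : Conf ι) (y : ι) (ρ δ : ℝ) : ExtPair x → ℝ
  | oo _ _ => 0
  | on j r => ((C.key j x - C.key y x) * quadX ρ r - δ * quadZ ρ r) /
      (C.pos j - C.pos x - δ * quadX ρ r)
  | nn r q => quadSlope ρ r q

/-- The slope of a pair. -/
noncomputable def extKey (C : Conf ι) (y : ι) (ρ δ : ℝ) (P : ExtPair x) : ℝ :=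
  C.baseKey y P + δ * C.rate y ρ δ P

/-- The pair of two elements. -/
def _root_.extPair : {a // a ≠ x} ⊕ Fin 4 → {a // a ≠ x} ⊕ Fin 4 → ExtPair x
  | .inl j, .inl k => oo j k
  | .inl j, .inr r => on j r
  | .inr r, .inl j => on j r
  | .inr r, .inr q => nn r q

theorem _root_.extPair_proper {a b : {a // a ≠ x} ⊕ Fin 4} (h : a ≠ b) : (extPair a b).Proper := by
  rcases a with j | r <;> rcases b with k | q <;> simp_all [extPair, Proper]

/-- The data after `x` is replaced by four elements. -/
noncomputable def ext (C : Conf ι) (x y : ι) (ρ δ : ℝ) : Conf ({a // a ≠ x} ⊕ Fin 4) where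
  pos := Sum.elim (fun j => C.pos j) (fun r => C.pos x + δ * quadX ρ r)
  key a b := C.extKey y ρ δ (extPair a b)

/-- The slope of the pair of an old element `j` and a new element `r` is greater than the slope of
the line through `j` and `x`. -/
def Above (C : Conf ι) (x y j : ι) (r : Fin 4) : Prop :=
  (C.key j x = C.key y x ∧ (IsRight (quadFlip r) ↔ C.pos j < C.pos x)) ∨
  (C.key y x < C.key j x ∧ (IsRight r ↔ C.pos x < C.pos j)) ∨
  (C.key j x < C.key y x ∧ (IsRight r ↔ C.pos j < C.pos x))

open Classical in
/-- The rank of a slope among the slopes that are close to the same original slope. -/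
noncomputable def slopeClass (C : Conf ι) (y : ι) : ExtPair x → ℤ
  | oo _ _ => 0
  | on j r => if C.Above x y j r then 1 else -1
  | nn r q => slopeRank r q

/-- The order of slopes that are close to the same original slope. -/
def SubLt (C : Conf ι) (y : ι) : ExtPair x → ExtPair x → Prop
  | on j r, on k q =>
      (C.key j x = C.key y x ∧
        QuotLt (C.pos x) (quadFlip q) (C.pos k) (quadFlip r) (C.pos j)) ∨
      (C.key y x < C.key j x ∧ QuotLt (C.pos x) r (C.pos j) q (C.pos k)) ∨
      (C.key j x < C.key y x ∧ QuotLt (C.pos x) q (C.pos k) r (C.pos j))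
  | P, Q => C.slopeClass y P < C.slopeClass y Q

/-- The order of the slopes of pairs, for a small quadrilateral, described in terms of the orders
of the original data. -/
def ExtLt (C : Conf ι) (y : ι) (P Q : ExtPair x) : Prop :=
  C.baseKey y P < C.baseKey y Q ∨ (C.baseKey y P = C.baseKey y Q ∧ C.SubLt y P Q)

/-- Since this symbolic order is total up to `Same`, it suffices to prove that `ExtLt` implies the
strict inequality of slopes; the converse implications follow. -/
theorem ExtLt.total {C : Conf ι} (hC : C.Valid) {y : ι} {P Q : ExtPair x}
    (hP : P.Proper) (hQ : Q.Proper) : C.ExtLt y P Q ∨ C.ExtLt y Q P ∨ Same C P Q := by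
  rcases lt_trichotomy (C.baseKey y P) (C.baseKey y Q) with h | h | h
  · exact Or.inl (Or.inl h)
  · suffices hs : C.SubLt y P Q ∨ C.SubLt y Q P ∨ Same C P Q by
      unfold ExtLt; simp only [h, lt_irrefl, true_and, false_or]; exact hs
    have hpm : ∀ (j : {a // a ≠ x}) r, C.slopeClass y (on j r) = 1 ∨
        C.slopeClass y (on j r) = -1 := by
      intro j r; unfold slopeClass; simp only; split_ifs <;> simp
    rcases P with ⟨j, k⟩ | ⟨j, r⟩ | ⟨r, q⟩ <;> rcases Q with ⟨j', k'⟩ | ⟨j', r'⟩ | ⟨r', q'⟩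
    · exact Or.inr (Or.inr h)
    · have := hpm j' r'
      simp only [SubLt, Same, or_false]
      have e : C.slopeClass y (oo j k) = 0 := rfl
      omega
    · simp only [SubLt, Same, or_false]
      have e : C.slopeClass y (oo j k) = 0 := rfl
      have e' : C.slopeClass y (nn r' q' : ExtPair x) = slopeRank r' q' := rfl
      have := slopeRank_cases hQ
      omega
    · have := hpm j r
      simp only [SubLt, Same, or_false]
      have e : C.slopeClass y (oo j' k') = 0 := rfl
      omega
    · have h' : C.key j x = C.key j' x := h
      have hj := hC.inj.ne j.2
      have hj' := hC.inj.ne j'.2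
      have inj : ∀ {r r' : Fin 4}, quadFlip r = quadFlip r' → r = r' := by decide
      have pinj : C.pos j = C.pos j' → j = j' := fun h => Subtype.ext (hC.inj h)
      simp only [SubLt, Same, ← h']
      rcases lt_trichotomy (C.key j x) (C.key y x) with e | e | e
      · simp only [e, e.ne, e.not_gt, false_and, false_or, true_and]
        have := QuotLt.total (r := r) (q := r') hj hj'
        tauto
      · simp only [e, lt_irrefl, false_and, or_false, true_and]
        have := QuotLt.total (r := quadFlip r) (q := quadFlip r') hj hj'
        have := @inj r r'
        tauto
      · simp only [e, e.ne', e.not_gt, false_and, false_or, true_and, or_false]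
        have := QuotLt.total (r := r) (q := r') hj hj'
        tauto
    · have := hpm j r
      simp only [SubLt, Same, or_false]
      have e' : C.slopeClass y (nn r' q' : ExtPair x) = slopeRank r' q' := rfl
      have := slopeRank_cases hQ
      omega
    · simp only [SubLt, Same, or_false]
      have e : C.slopeClass y (oo j' k') = 0 := rfl
      have e' : C.slopeClass y (nn r q : ExtPair x) = slopeRank r q := rfl
      have := slopeRank_cases hP
      omega
    · have := hpm j' r'
      simp only [SubLt, Same, or_false]
      have e' : C.slopeClass y (nn r q : ExtPair x) = slopeRank r q := rfl
      have := slopeRank_cases hP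
      omega
    · have := fun h => slopeRank_eq (r := r) (q := q) (r' := r') (q' := q') hP h
      simp only [SubLt, Same]
      have e' : C.slopeClass y (nn r q : ExtPair x) = slopeRank r q := rfl
      have e'' : C.slopeClass y (nn r' q' : ExtPair x) = slopeRank r' q' := rfl
      rcases lt_trichotomy (slopeRank r q) (slopeRank r' q') with h1 | h1 | h1
      · left; rw [e', e'']; exact h1
      · right; right; exact this h1
      · right; left; rw [e', e'']; exact h1
  · exact Or.inr (Or.inl (Or.inl h))

section invariance

variable {C D : Conf ι}

theorem Equiv.pos_eq_iff (h : Equiv C D) {a b : ι} : C.pos a = C.pos b ↔ D.pos a = D.pos b := by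
  have h1 := h.1 a b
  have h2 := h.1 b a
  constructor <;> intro e
  · exact le_antisymm (not_lt.1 fun h => absurd (h2.2 h) (by simp [e]))
      (not_lt.1 fun h => absurd (h1.2 h) (by simp [e]))
  · exact le_antisymm (not_lt.1 fun h => absurd (h2.1 h) (by simp [e]))
      (not_lt.1 fun h => absurd (h1.1 h) (by simp [e]))

/-- `ExtLt` is composed of comparisons of old positions and old slopes. So the order of new slopes
is the same for all metric versions of the same data, which is the point of the shape of the
quadrilateral. -/
theorem ExtLt.congr (h : Equiv C D) {y : ι} (hy : y ≠ x) {P Q : ExtPair x} (hP : P.Proper)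
    (hQ : Q.Proper) : C.ExtLt y P Q ↔ D.ExtLt y P Q := by
  have h1 := h.key_iff _ _ _ _ (base_ne hy hP) (base_ne hy hQ)
  have h2 := h.key_eq_iff (base_ne hy hP) (base_ne hy hQ)
  have k1 : ∀ j : {a // a ≠ x}, C.key j x < C.key y x ↔ D.key j x < D.key y x :=
    fun j => h.key_iff _ _ _ _ j.2 hy
  have k2 : ∀ j : {a // a ≠ x}, C.key y x < C.key j x ↔ D.key y x < D.key j x :=
    fun j => h.key_iff _ _ _ _ hy j.2
  have k3 : ∀ j : {a // a ≠ x}, C.key j x = C.key y x ↔ D.key j x = D.key y x :=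
    fun j => h.key_eq_iff j.2 hy
  have h3 : ∀ P : ExtPair x, C.slopeClass y P = D.slopeClass y P := by
    intro P
    rcases P with ⟨j, k⟩ | ⟨j, r⟩ | ⟨r, q⟩
    · rfl
    · have : C.Above x y j r ↔ D.Above x y j r := by
        simp only [Above, k1, k2, k3, h.pos_iff]
      by_cases hA : C.Above x y j r
      · simp only [slopeClass, if_pos hA, if_pos (this.1 hA)]
      · simp only [slopeClass, if_neg hA, if_neg (mt this.2 hA)]
    · rfl
  have h4 : C.SubLt y P Q ↔ D.SubLt y P Q := by
    rcases P with ⟨j, k⟩ | ⟨j, r⟩ | ⟨r, q⟩ <;> rcases Q with ⟨j', k'⟩ | ⟨j', r'⟩ | ⟨r', q'⟩ <;>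
      simp only [SubLt, h3]
    simp only [QuotLt, InvLt, k1, k2, k3, h.pos_iff, h.pos_eq_iff]
  simp only [ExtLt, baseKey, h1, h2, h4]

theorem Same.congr (h : Equiv C D) {P Q : ExtPair x} (hP : P.Proper)
    (hQ : Q.Proper) : Same C P Q ↔ Same D P Q := by
  rcases P with ⟨j, k⟩ | ⟨j, r⟩ | ⟨r, q⟩ <;> rcases Q with ⟨j', k'⟩ | ⟨j', r'⟩ | ⟨r', q'⟩ <;>
    simp only [Same]
  exact h.key_eq_iff (fun h => hP (Subtype.ext h)) (fun h => hQ (Subtype.ext h))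

end invariance

theorem extKey_eq_of_same {C : Conf ι} {y : ι} {ρ δ : ℝ} {P Q : ExtPair x} (h : Same C P Q) :
    C.extKey y ρ δ P = C.extKey y ρ δ Q := by
  rcases P with ⟨j, k⟩ | ⟨j, r⟩ | ⟨r, q⟩ <;> rcases Q with ⟨j', k'⟩ | ⟨j', r'⟩ | ⟨r', q'⟩ <;>
    simp only [Same] at h
  · simp only [extKey, baseKey, base, rate, h]
  · rw [h.1, h.2]
  · rcases h with ⟨rfl, rfl⟩ | ⟨rfl, rfl⟩
    · rfl
    · simp only [extKey, baseKey, base, rate, quadSlope_comm]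

/-! ### The order of slopes for small parameters -/

/-- The limit of `rate` for a small quadrilateral. -/
noncomputable def rateLim (C : Conf ι) (y : ι) (ρ : ℝ) : ExtPair x → ℝ
  | oo _ _ => 0
  | on j r => (C.key j x - C.key y x) * (quadX ρ r / (C.pos j - C.pos x))
  | nn r q => quadSlope ρ r q

/-- The limit of `rate` divided by the size, for lines close to the line through `x` and `y`. -/
noncomputable def rateLim' (C : Conf ι) (ρ : ℝ) : ExtPair x → ℝ
  | oo _ _ => 0
  | on j r => -(quadZ ρ r / (C.pos j - C.pos x))
  | nn _ _ => 0

/-- The pair contains an old element. -/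
def _root_.ExtPair.Old : ExtPair x → Prop
  | nn _ _ => False
  | _ => True

theorem tendsto_rate {C : Conf ι} (hC : C.Valid) (y : ι) (ρ : ℝ) (P : ExtPair x) :
    Tendsto (fun δ => C.rate y ρ δ P) (𝓝[>] 0) (𝓝 (C.rateLim y ρ P)) := by
  rcases P with ⟨j, k⟩ | ⟨j, r⟩ | ⟨r, q⟩
  · exact tendsto_const_nhds
  · simp only [rate, rateLim]
    have hd : C.pos j - C.pos x ≠ 0 := sub_ne_zero.2 (hC.inj.ne j.2)
    have h : ContinuousAt (fun δ => ((C.key j x - C.key y x) * quadX ρ r - δ * quadZ ρ r) /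
        (C.pos j - C.pos x - δ * quadX ρ r)) 0 := by
      refine ContinuousAt.div (by fun_prop) (by fun_prop) (by simpa using hd)
    have h' := h.tendsto.mono_left (nhdsWithin_le_nhds (s := Set.Ioi 0))
    simp only [zero_mul, sub_zero] at h'
    rwa [mul_div_assoc] at h'
  · exact tendsto_const_nhds

/-- In the direction of `xy` the term of order `δ` in the slope cancels, and the height `δ²` of the
quadrilateral supplies the leading term. -/
theorem tendsto_rate' {C : Conf ι} (hC : C.Valid) {y : ι} (ρ : ℝ) {P : ExtPair x} (hP : P.Old)
    (h : C.baseKey y P = C.key y x) :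
    Tendsto (fun δ => C.rate y ρ δ P / δ) (𝓝[>] 0) (𝓝 (C.rateLim' ρ P)) := by
  rcases P with ⟨j, k⟩ | ⟨j, r⟩ | ⟨r, q⟩
  · simp [rate, rateLim']
  · simp only [rate, rateLim']
    have hd : C.pos j - C.pos x ≠ 0 := sub_ne_zero.2 (hC.inj.ne j.2)
    have h0 : C.key j x = C.key y x := h
    have hc : ContinuousAt (fun δ => -(quadZ ρ r / (C.pos j - C.pos x - δ * quadX ρ r))) 0 := by
      refine (ContinuousAt.div (by fun_prop) (by fun_prop) (by simpa using hd)).neg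
    have h' := hc.tendsto.mono_left (nhdsWithin_le_nhds (s := Set.Ioi 0))
    simp only [zero_mul, sub_zero] at h'
    refine h'.congr' ?_
    filter_upwards [self_mem_nhdsWithin] with δ hδ
    have : δ ≠ 0 := (Set.mem_Ioi.1 hδ).ne'
    rw [h0, sub_self, zero_mul, zero_sub, neg_div, neg_div, div_right_comm, mul_div_cancel_left₀ _ this]
  · exact absurd hP (by simp [Old])

/-- The slopes are compared lexicographically: limit slope, coefficient of `δ`, and, for pairs with
an old element in the direction of `xy`, coefficient of `δ²`. -/
theorem extKey_eventually_lt {C : Conf ι} (hC : C.Valid) {y : ι} {ρ : ℝ} {P Q : ExtPair x}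
    (h : C.baseKey y P < C.baseKey y Q ∨
      (C.baseKey y P = C.baseKey y Q ∧ C.rateLim y ρ P < C.rateLim y ρ Q) ∨
      (C.baseKey y P = C.baseKey y Q ∧ C.baseKey y P = C.key y x ∧ P.Old ∧ Q.Old ∧
        C.rateLim' ρ P < C.rateLim' ρ Q)) :
    ∀ᶠ δ in 𝓝[>] (0 : ℝ), C.extKey y ρ δ P < C.extKey y ρ δ Q := by
  have hid : Tendsto (fun δ : ℝ => δ) (𝓝[>] 0) (𝓝 0) := nhdsWithin_le_nhds
  rcases h with h | ⟨h, h'⟩ | ⟨h, h0, hP, hQ, h'⟩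
  · have e : ∀ P : ExtPair x, Tendsto (fun δ => C.extKey y ρ δ P) (𝓝[>] 0) (𝓝 (C.baseKey y P)) := by
      intro P
      have := (tendsto_const_nhds (x := C.baseKey y P)).add (hid.mul (tendsto_rate hC y ρ P))
      simpa [extKey] using this
    exact (e P).eventually_lt (e Q) h
  · filter_upwards [(tendsto_rate hC y ρ P).eventually_lt (tendsto_rate hC y ρ Q) h',
      self_mem_nhdsWithin] with δ h1 h2
    simp only [extKey, h]
    have := mul_lt_mul_of_pos_left h1 (Set.mem_Ioi.1 h2)
    linarith
  · filter_upwards [(tendsto_rate' hC ρ hP h0).eventually_lt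
      (tendsto_rate' hC ρ hQ (h ▸ h0)) h', self_mem_nhdsWithin] with δ h1 h2
    simp only [extKey, h]
    have h2 : 0 < δ := h2
    rw [div_lt_div_iff_of_pos_right h2] at h1
    have := mul_lt_mul_of_pos_left h1 h2
    linarith

/-- `Above` encodes the sign of the leading coefficient of the deviation, which has order `δ` off
the direction of `xy` and order `δ²` along it. -/
theorem above_sign {C : Conf ι} (hC : C.Valid) {y : ι} {ρ : ℝ} (hρ : 0 < ρ) {j : {a // a ≠ x}}
    {r : Fin 4} (h : C.Above x y j r) :
    (C.key j x ≠ C.key y x ∧ 0 < C.rateLim y ρ (on j r)) ∨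
    (C.key j x = C.key y x ∧ 0 < C.rateLim' ρ (on j r)) := by
  have hj := hC.inj.ne j.2
  rcases h with ⟨h1, h2⟩ | ⟨h1, h2⟩ | ⟨h1, h2⟩
  · exact Or.inr ⟨h1, neg_pos.2 (quadX_div_neg hρ hj h2)⟩
  · exact Or.inl ⟨h1.ne', mul_pos (sub_pos.2 h1) (quadX_div_pos hρ hj h2)⟩
  · exact Or.inl ⟨h1.ne, mul_pos_of_neg_of_neg (sub_neg.2 h1) (quadX_div_neg hρ hj h2)⟩

theorem not_above_sign {C : Conf ι} (hC : C.Valid) {y : ι} {ρ : ℝ} (hρ : 0 < ρ) {j : {a // a ≠ x}}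
    {r : Fin 4} (h : ¬ C.Above x y j r) :
    (C.key j x ≠ C.key y x ∧ C.rateLim y ρ (on j r) < 0) ∨
    (C.key j x = C.key y x ∧ C.rateLim' ρ (on j r) < 0) := by
  have hj := hC.inj.ne j.2
  have hj' := lt_or_gt_of_ne hj
  have hj'' := @lt_asymm _ _ (C.pos j) (C.pos x)
  unfold Above at h
  rcases lt_trichotomy (C.key j x) (C.key y x) with e | e | e
  · simp only [e, e.ne, e.not_gt, false_and, false_or, true_and] at h
    have : IsRight r ↔ C.pos x < C.pos j := by tauto
    exact Or.inl ⟨e.ne, mul_neg_of_neg_of_pos (sub_neg.2 e) (quadX_div_pos hρ hj this)⟩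
  · simp only [e, lt_irrefl, false_and, or_false, true_and] at h
    have : IsRight (quadFlip r) ↔ C.pos x < C.pos j := by tauto
    exact Or.inr ⟨e, neg_lt_zero.2 (quadX_div_pos hρ hj this)⟩
  · simp only [e, e.ne', e.not_gt, false_and, false_or, true_and, or_false] at h
    have : IsRight r ↔ C.pos j < C.pos x := by tauto
    exact Or.inl ⟨e.ne', mul_neg_of_pos_of_neg (sub_pos.2 e) (quadX_div_neg hρ hj this)⟩

/-- An old-new pair meets a new-new pair only in the direction of `xy`, where its coefficient of `δ`
is zero while that of the new pair is not. Two old-new pairs are compared by `QuotLt.eventually`,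
multiplied by the difference between their slope and that of `xy`, or at order `δ²` by `-1`. -/
theorem rateLim_eventually_lt {C : Conf ι} (hC : C.Valid) {y : ι} {P Q : ExtPair x}
    (hP : P.Proper) (hQ : Q.Proper) (h : C.baseKey y P = C.baseKey y Q) (hlt : C.SubLt y P Q) :
    ∀ᶠ ρ in 𝓝[>] (0 : ℝ), C.rateLim y ρ P < C.rateLim y ρ Q ∨
      (C.baseKey y P = C.key y x ∧ P.Old ∧ Q.Old ∧ C.rateLim' ρ P < C.rateLim' ρ Q) := by
  have hc0 : ∀ j k : {a // a ≠ x}, C.slopeClass y (oo j k) = 0 := fun _ _ => rfl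
  have hcn : ∀ r q, C.slopeClass y (nn r q : ExtPair x) = slopeRank r q := fun _ _ => rfl
  have hco : ∀ (j : {a // a ≠ x}) r, (C.Above x y j r ∧ C.slopeClass y (on j r) = 1) ∨
      (¬ C.Above x y j r ∧ C.slopeClass y (on j r) = -1) := by
    intro j r; unfold slopeClass; simp only; split_ifs with h <;> simp [h]
  rcases P with ⟨j, k⟩ | ⟨j, r⟩ | ⟨r, q⟩ <;> rcases Q with ⟨j', k'⟩ | ⟨j', r'⟩ | ⟨r', q'⟩ <;>
    simp only [SubLt, hc0, hcn] at hlt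
  · exact absurd hlt (lt_irrefl _)
  · filter_upwards [self_mem_nhdsWithin] with ρ hρ
    rcases hco j' r' with ⟨h1, h2⟩ | ⟨h1, h2⟩
    · rcases above_sign hC (Set.mem_Ioi.1 hρ) h1 with ⟨-, h3⟩ | ⟨h3, h4⟩
      · exact Or.inl h3
      · exact Or.inr ⟨h.trans h3, trivial, trivial, h4⟩
    · omega
  · filter_upwards [self_mem_nhdsWithin] with ρ hρ
    exact Or.inl (quadSlope_pos hρ hQ hlt)
  · filter_upwards [self_mem_nhdsWithin] with ρ hρ
    rcases hco j r with ⟨h1, h2⟩ | ⟨h1, h2⟩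
    · omega
    · rcases not_above_sign hC (Set.mem_Ioi.1 hρ) h1 with ⟨-, h3⟩ | ⟨h3, h4⟩
      · exact Or.inl h3
      · exact Or.inr ⟨h3, trivial, trivial, h4⟩
  · have h' : C.key j x = C.key j' x := h
    rcases hlt with ⟨h1, h2⟩ | ⟨h1, h2⟩ | ⟨h1, h2⟩
    · filter_upwards [h2.eventually] with ρ hρ
      exact Or.inr ⟨h1, trivial, trivial, neg_lt_neg hρ⟩
    · filter_upwards [h2.eventually] with ρ hρ
      left
      simp only [rateLim, ← h']
      exact mul_lt_mul_of_pos_left hρ (sub_pos.2 h1)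
    · filter_upwards [h2.eventually] with ρ hρ
      left
      simp only [rateLim, ← h']
      exact mul_lt_mul_of_neg_left hρ (sub_neg.2 h1)
  · filter_upwards [self_mem_nhdsWithin] with ρ hρ
    have h' : C.key j x = C.key y x := h
    left
    simp only [rateLim, h', sub_self, zero_mul]
    have h1 := slopeRank_cases hQ
    have h2 := hco j r
    exact quadSlope_pos hρ hQ (by omega)
  · filter_upwards [self_mem_nhdsWithin] with ρ hρ
    exact Or.inl (quadSlope_neg hρ hP hlt)
  · filter_upwards [self_mem_nhdsWithin] with ρ hρ
    have h' : C.key y x = C.key j' x := h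
    left
    simp only [rateLim, h', sub_self, zero_mul]
    have h1 := slopeRank_cases hP
    have h2 := hco j' r'
    exact quadSlope_neg hρ hP (by omega)
  · filter_upwards [self_mem_nhdsWithin] with ρ hρ
    exact Or.inl (quadSlope_lt_of_rank hρ hP hQ hlt)

/-- The parameters are small enough: the order of slopes is as described by `ExtLt`, and the new
elements are close to `x`. -/
structure Small (C : Conf ι) (x y : ι) (ρ δ : ℝ) : Prop where
  rho_pos : 0 < ρ
  delta_pos : 0 < δ
  key_lt : ∀ P Q : ExtPair x, P.Proper → Q.Proper → C.ExtLt y P Q →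
    C.extKey y ρ δ P < C.extKey y ρ δ Q
  lt_pos : ∀ j r, C.pos j < C.pos x → C.pos j < C.pos x + δ * quadX ρ r
  pos_lt : ∀ j r, C.pos x < C.pos j → C.pos x + δ * quadX ρ r < C.pos j

/-- The limits are nested: `ρ → 0` makes the leading coefficients strictly ordered, and for each
such `ρ` the limit `δ → 0` transfers this order to the slopes. Finitely many comparisons can be
satisfied at once. -/
theorem eventually_small [Finite ι] {C : Conf ι} (hC : C.Valid) (x y : ι) :
    ∀ᶠ ρ in 𝓝[>] (0 : ℝ), ∀ᶠ δ in 𝓝[>] (0 : ℝ), C.Small x y ρ δ := by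
  have key : ∀ᶠ ρ in 𝓝[>] (0 : ℝ), ∀ P Q : ExtPair x, P.Proper → Q.Proper → C.ExtLt y P Q →
      ∀ᶠ δ in 𝓝[>] (0 : ℝ), C.extKey y ρ δ P < C.extKey y ρ δ Q := by
    simp only [eventually_all]
    intro P Q hP hQ h
    rcases h with h | ⟨h, h'⟩
    · exact Eventually.of_forall fun ρ => extKey_eventually_lt hC (Or.inl h)
    · filter_upwards [rateLim_eventually_lt hC hP hQ h h'] with ρ hρ
      apply extKey_eventually_lt hC
      right
      rcases hρ with hρ | hρ
      · exact Or.inl ⟨h, hρ⟩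
      · exact Or.inr ⟨h, hρ⟩
  filter_upwards [key, self_mem_nhdsWithin] with ρ hρ hρ0
  have h1 : ∀ᶠ δ in 𝓝[>] (0 : ℝ), ∀ P Q : ExtPair x, P.Proper → Q.Proper → C.ExtLt y P Q →
      C.extKey y ρ δ P < C.extKey y ρ δ Q := by
    simp only [eventually_all]
    exact hρ
  have ht : ∀ r, Tendsto (fun δ => C.pos x + δ * quadX ρ r) (𝓝[>] 0) (𝓝 (C.pos x)) := by
    intro r
    have h : ContinuousAt (fun δ => C.pos x + δ * quadX ρ r) 0 := by fun_prop
    have h' := h.tendsto.mono_left (nhdsWithin_le_nhds (s := Set.Ioi 0))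
    simpa using h'
  have h2 : ∀ᶠ δ in 𝓝[>] (0 : ℝ), ∀ j r, C.pos j < C.pos x →
      C.pos j < C.pos x + δ * quadX ρ r := by
    simp only [eventually_all]
    exact fun j r h => (ht r).eventually_const_lt h
  have h3 : ∀ᶠ δ in 𝓝[>] (0 : ℝ), ∀ j r, C.pos x < C.pos j →
      C.pos x + δ * quadX ρ r < C.pos j := by
    simp only [eventually_all]
    exact fun j r h => (ht r).eventually_lt_const h
  filter_upwards [h1, h2, h3, self_mem_nhdsWithin] with δ h1 h2 h3 h4
  exact ⟨hρ0, h4, h1, h2, h3⟩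

end Conf

/-! ### Order type, validity and geometric meaning of the extended data -/

namespace Conf

variable {ι : Type} {x y : ι} {C D : Conf ι} {ρ δ : ℝ}

open ExtPair

/-- In a valid configuration, slopes of lines through a common point that agree belong to one
line. -/
theorem Valid.key_trans (hC : C.Valid) {a b c : ι} (hab : a ≠ b) (hac : a ≠ c) (hbc : b ≠ c)
    (h : C.key a b = C.key a c) : C.key b c = C.key a b := by
  have s1 := hC.symm a b
  have s2 := hC.symm a c
  have s3 := hC.symm b c
  have key : ∀ u v w : ι, C.pos u < C.pos v → C.pos v < C.pos w →
      (C.key u v = C.key u w ∨ C.key u w = C.key v w ∨ C.key u v = C.key v w) →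
      C.key u v = C.key u w ∧ C.key u w = C.key v w := by
    intro u v w h1 h2 h3
    rcases hC.btw u v w h1 h2 with h | h | h
    · rcases h3 with h3 | h3 | h3 <;> linarith
    · rcases h3 with h3 | h3 | h3 <;> linarith
    · exact h
  rcases lt_or_gt_of_ne (hC.inj.ne hab) with h1 | h1 <;>
  rcases lt_or_gt_of_ne (hC.inj.ne hbc) with h2 | h2 <;>
  rcases lt_or_gt_of_ne (hC.inj.ne hac) with h3 | h3
  · have := key _ _ _ h1 h2 (by tauto); linarith
  · exact absurd (h1.trans h2) h3.not_gt
  · have := key _ _ _ h3 h2 (by simp only [← s3]; tauto); linarith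
  · have := key _ _ _ h3 h1 (by simp only [← s2, ← s3]; rw [s2] at h; simp [h, s2]); linarith
  · have := key _ _ _ h1 h3 (by simp only [← s1]; simp [h]); linarith
  · have := key _ _ _ h2 h3 (by simp only [← s1, ← s2]; simp [h]); linarith
  · exact absurd (h2.trans h1) h3.not_gt
  · have := key _ _ _ h2 h1 (by simp only [← s1, ← s2, ← s3]; simp [h]); linarith

/-- Both extensions realize the symbolic order, which depends only on the common order type. Hence
neither the parameters nor the metric version of the data matters. -/
theorem ext_equiv (hC : C.Valid) (h : Equiv C D) (hy : y ≠ x) {ρ' δ' : ℝ}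
    (hs : C.Small x y ρ δ) (hs' : D.Small x y ρ' δ') :
    Equiv (C.ext x y ρ δ) (D.ext x y ρ' δ') := by
  constructor
  · rintro (j | r) (k | q) <;> simp only [ext, Sum.elim_inl, Sum.elim_inr]
    · exact h.pos_iff _ _
    · rcases lt_or_gt_of_ne (hC.inj.ne j.2) with h' | h'
      · exact iff_of_true (hs.lt_pos _ _ h') (hs'.lt_pos _ _ ((h.pos_iff _ _).1 h'))
      · exact iff_of_false (hs.pos_lt _ _ h').not_gt (hs'.pos_lt _ _ ((h.pos_iff _ _).1 h')).not_gt
    · rcases lt_or_gt_of_ne (hC.inj.ne k.2) with h' | h'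
      · exact iff_of_false (hs.lt_pos _ _ h').not_gt (hs'.lt_pos _ _ ((h.pos_iff _ _).1 h')).not_gt
      · exact iff_of_true (hs.pos_lt _ _ h') (hs'.pos_lt _ _ ((h.pos_iff _ _).1 h'))
    · rw [add_lt_add_iff_left, add_lt_add_iff_left, mul_lt_mul_iff_right₀ hs.delta_pos,
        mul_lt_mul_iff_right₀ hs'.delta_pos, quadX_lt_iff hs.rho_pos, quadX_lt_iff hs'.rho_pos]
  · intro a b c d hab hcd
    have hP := extPair_proper hab
    have hQ := extPair_proper hcd
    simp only [ext]
    rcases ExtLt.total hC (y := y) hP hQ with h' | h' | h'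
    · exact iff_of_true (hs.key_lt _ _ hP hQ h')
        (hs'.key_lt _ _ hP hQ ((ExtLt.congr h hy hP hQ).1 h'))
    · exact iff_of_false (hs.key_lt _ _ hQ hP h').not_gt
        (hs'.key_lt _ _ hQ hP ((ExtLt.congr h hy hQ hP).1 h')).not_gt
    · rw [extKey_eq_of_same h', extKey_eq_of_same ((Same.congr h hP hQ).1 h')]
      simp

theorem Small.sub_ne (hC : C.Valid) (hs : C.Small x y ρ δ) (j : {a // a ≠ x}) (r : Fin 4) :
    C.pos j - C.pos x - δ * quadX ρ r ≠ 0 := by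
  rcases lt_or_gt_of_ne (hC.inj.ne j.2) with h | h
  · have := hs.lt_pos _ r h
    exact (show _ < (0 : ℝ) by linarith).ne
  · have := hs.pos_lt _ r h
    exact (show (0 : ℝ) < _ by linarith).ne'

/-- This is the slope in a planar picture with `x` at the origin: `j` lies on its line through `x`,
with its own abscissa, and the vertices lie in the flat quadrilateral. -/
theorem Small.extKey_on (hC : C.Valid) (hs : C.Small x y ρ δ) (j : {a // a ≠ x}) (r : Fin 4) :
    C.extKey y ρ δ (on j r) =
      (C.key y x * (δ * quadX ρ r) + δ ^ 2 * quadZ ρ r - C.key j x * (C.pos j - C.pos x)) /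
        (δ * quadX ρ r - (C.pos j - C.pos x)) := by
  have h := hs.sub_ne hC j r
  have h' : δ * quadX ρ r - (C.pos j - C.pos x) ≠ 0 := by
    intro h0; apply h; linarith
  simp only [extKey, baseKey, base, rate]
  rw [eq_div_iff h', add_mul, mul_div_assoc', div_mul_eq_mul_div,
    show δ * quadX ρ r - (C.pos j - C.pos x) = -(C.pos j - C.pos x - δ * quadX ρ r) by ring,
    mul_neg, mul_neg, neg_div, mul_div_assoc, div_self h]
  ring

theorem Small.extKey_nn (hs : C.Small x y ρ δ) {r q : Fin 4} (h : r ≠ q) :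
    C.extKey y ρ δ (nn r q : ExtPair x) =
      (C.key y x * (δ * quadX ρ q) + δ ^ 2 * quadZ ρ q -
        (C.key y x * (δ * quadX ρ r) + δ ^ 2 * quadZ ρ r)) /
        (δ * quadX ρ q - δ * quadX ρ r) := by
  have h0 := hs.delta_pos.ne'
  have h1 : quadX ρ r - quadX ρ q ≠ 0 := sub_ne_zero.2 ((quadX_injective hs.rho_pos).ne h)
  have h2 : δ * quadX ρ q - δ * quadX ρ r ≠ 0 := by
    rw [← mul_sub]; exact mul_ne_zero h0 (by intro h; apply h1; linarith)
  simp only [extKey, baseKey, base, rate, quadSlope]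
  field_simp
  rw [eq_div_iff (by intro h; apply h1; linarith)]
  ring

/-- A triple whose three slopes all agree with the planar picture around `x` satisfies the law
because real triangles do. The other triples containing a vertex have two old elements not collinear
with `x`; the strict inequalities of their base slopes survive. Triples of old elements are
unchanged. -/
theorem ext_valid (hC : C.Valid) (hs : C.Small x y ρ δ) : (C.ext x y ρ δ).Valid := by
  have inj : Function.Injective (C.ext x y ρ δ).pos := by
    rintro (j | r) (k | q) h <;> simp only [ext, Sum.elim_inl, Sum.elim_inr] at h
    · rw [Subtype.ext (hC.inj h)]
    · exact absurd (show C.pos j - C.pos x - δ * quadX ρ q = 0 by linarith) (hs.sub_ne hC j q)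
    · exact absurd (show C.pos k - C.pos x - δ * quadX ρ r = 0 by linarith) (hs.sub_ne hC k r)
    · rw [quadX_injective hs.rho_pos (mul_left_cancel₀ hs.delta_pos.ne' (add_left_cancel h))]
  have symm : ∀ a b, (C.ext x y ρ δ).key a b = (C.ext x y ρ δ).key b a := by
    rintro (j | r) (k | q) <;> simp only [ext, extPair]
    · simp only [extKey, baseKey, base, rate]; rw [hC.symm]
    · simp only [extKey, baseKey, base, rate]; rw [quadSlope_comm]
  refine ⟨inj, symm, ?_⟩
  let u : {a // a ≠ x} ⊕ Fin 4 → ℝ := Sum.elim (fun j => C.pos j - C.pos x) (fun r => δ * quadX ρ r)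
  let w : {a // a ≠ x} ⊕ Fin 4 → ℝ := Sum.elim (fun j => C.key j x * (C.pos j - C.pos x))
    (fun r => C.key y x * (δ * quadX ρ r) + δ ^ 2 * quadZ ρ r)
  have hu : ∀ a, (C.ext x y ρ δ).pos a = u a + C.pos x := by
    rintro (j | r) <;> simp only [ext, u, Sum.elim_inl, Sum.elim_inr] <;> ring
  have symm' : ∀ a b, (C.ext x y ρ δ).key a b = (w b - w a) / (u b - u a) →
      (C.ext x y ρ δ).key b a = (w a - w b) / (u a - u b) := by
    intro a b h
    rw [symm, h, ← neg_div_neg_eq]; congr 1 <;> ring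
  have on' : ∀ j r, (C.ext x y ρ δ).key (.inl j) (.inr r) =
      (w (.inr r) - w (.inl j)) / (u (.inr r) - u (.inl j)) := fun j r => hs.extKey_on hC j r
  have no' := fun j r => symm' _ _ (on' j r)
  have nn' : ∀ r q, r ≠ q → (C.ext x y ρ δ).key (.inr r) (.inr q) =
      (w (.inr q) - w (.inr r)) / (u (.inr q) - u (.inr r)) := fun r q h => hs.extKey_nn h
  -- Only for old elements collinear with `x` does the picture reproduce their mutual slope; all
  -- other old pairs keep an abstract slope that need not fit into the plane.
  have oo' : ∀ j k : {a // a ≠ x}, j ≠ k → C.key j x = C.key k x → (C.ext x y ρ δ).key (.inl j) (.inl k) =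
      (w (.inl k) - w (.inl j)) / (u (.inl k) - u (.inl j)) := by
    intro j k hjk h
    have hjk' : (j : ι) ≠ k := fun h => hjk (Subtype.ext h)
    have e := hC.key_trans j.2.symm k.2.symm hjk' (by rw [hC.symm x j, hC.symm x k, h])
    have hne : C.pos k - C.pos j ≠ 0 := sub_ne_zero.2 (hC.inj.ne hjk'.symm)
    simp only [w, u, Sum.elim_inl]
    rw [← h, ← mul_sub, sub_sub_sub_cancel_right, mul_div_assoc, div_self hne, mul_one]
    simp only [ext, extPair, extKey, baseKey, base, rate, mul_zero, add_zero]
    rw [e, hC.symm]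
  have planar : ∀ a b c, (C.ext x y ρ δ).pos a < (C.ext x y ρ δ).pos b →
      (C.ext x y ρ δ).pos b < (C.ext x y ρ δ).pos c →
      (C.ext x y ρ δ).key a b = (w b - w a) / (u b - u a) →
      (C.ext x y ρ δ).key a c = (w c - w a) / (u c - u a) →
      (C.ext x y ρ δ).key b c = (w c - w b) / (u c - u b) →
      SlopeBtw ((C.ext x y ρ δ).key a b) ((C.ext x y ρ δ).key a c) ((C.ext x y ρ δ).key b c) := by
    intro a b c h1 h2 h3 h4 h5
    rw [hu, hu] at h1 h2
    rw [h3, h4, h5]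
    exact btw_slope (by linarith) (by linarith)
  have old_lt : ∀ (j : {a // a ≠ x}) r, (C.ext x y ρ δ).pos (.inl j) < (C.ext x y ρ δ).pos (.inr r) →
      C.pos j < C.pos x := by
    intro j r h
    exact (lt_or_gt_of_ne (hC.inj.ne j.2)).resolve_right fun h' =>
      lt_asymm h (hs.pos_lt j r h')
  have lt_old : ∀ (j : {a // a ≠ x}) r, (C.ext x y ρ δ).pos (.inr r) < (C.ext x y ρ δ).pos (.inl j) →
      C.pos x < C.pos j := by
    intro j r h
    exact (lt_or_gt_of_ne (hC.inj.ne j.2)).resolve_left fun h' =>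
      lt_asymm h (hs.lt_pos j r h')
  have base_lt : ∀ P Q : ExtPair x, P.Proper → Q.Proper → C.baseKey y P < C.baseKey y Q →
      C.extKey y ρ δ P < C.extKey y ρ δ Q := fun P Q hP hQ h => hs.key_lt P Q hP hQ (Or.inl h)
  rintro (j | r) (k | q) (l | t) h1 h2
  · have := hC.btw _ _ _ h1 h2
    simpa only [ext, extPair, extKey, baseKey, base, rate, mul_zero, add_zero] using this
  · have hjk : j ≠ k := by rintro rfl; exact lt_irrefl _ h1
    by_cases he : C.key j x = C.key k x
    · exact planar _ _ _ h1 h2 (oo' j k hjk he) (on' j t) (on' k t)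
    · have := hC.btw j k x h1 (old_lt _ _ h2)
      rcases this with h | h | h
      · exact Or.inl ⟨base_lt (oo j k) (on j t) hjk trivial h.1, base_lt (on j t) (on k t) trivial trivial h.2⟩
      · exact Or.inr (Or.inl ⟨base_lt (on k t) (on j t) trivial trivial h.1, base_lt (on j t) (oo j k) trivial hjk h.2⟩)
      · exact absurd h.2 he
  · have hjl : j ≠ l := by rintro rfl; exact lt_asymm h1 h2
    by_cases he : C.key j x = C.key l x
    · exact planar _ _ _ h1 h2 (on' j q) (oo' j l hjl he) (no' l q)
    · have := hC.btw j x l (old_lt _ _ h1) (lt_old _ _ h2)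
      rw [hC.symm x l] at this
      rcases this with h | h | h
      · exact Or.inl ⟨base_lt (on j q) (oo j l) trivial hjl h.1, base_lt (oo j l) (on l q) hjl trivial h.2⟩
      · exact Or.inr (Or.inl ⟨base_lt (on l q) (oo j l) trivial hjl h.1, base_lt (oo j l) (on j q) hjl trivial h.2⟩)
      · exact absurd (h.1.trans h.2) he
  · have hqt : q ≠ t := by rintro rfl; exact lt_irrefl _ h2
    exact planar _ _ _ h1 h2 (on' j q) (on' j t) (nn' q t hqt)
  · have hkl : k ≠ l := by rintro rfl; exact lt_irrefl _ h2
    by_cases he : C.key k x = C.key l x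
    · exact planar _ _ _ h1 h2 (no' k r) (no' l r) (oo' k l hkl he)
    · have := hC.btw x k l (lt_old _ _ h1) h2
      rw [hC.symm x l, hC.symm x k] at this
      rcases this with h | h | h
      · exact Or.inl ⟨base_lt (on k r) (on l r) trivial trivial h.1, base_lt (on l r) (oo k l) trivial hkl h.2⟩
      · exact Or.inr (Or.inl ⟨base_lt (oo k l) (on l r) hkl trivial h.1, base_lt (on l r) (on k r) trivial trivial h.2⟩)
      · exact absurd h.1 he
  · have hrt : r ≠ t := by rintro rfl; exact lt_asymm h1 h2
    exact planar _ _ _ h1 h2 (no' k r) (nn' r t hrt) (on' k t)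
  · have hrq : r ≠ q := by rintro rfl; exact lt_irrefl _ h1
    exact planar _ _ _ h1 h2 (nn' r q hrq) (no' l r) (no' l q)
  · have hrq : r ≠ q := by rintro rfl; exact lt_irrefl _ h1
    have hqt : q ≠ t := by rintro rfl; exact lt_irrefl _ h2
    have hrt : r ≠ t := by rintro rfl; exact lt_asymm h1 h2
    exact planar _ _ _ h1 h2 (nn' r q hrq) (nn' r t hrt) (nn' q t hqt)

/-- New pairs have slopes different from those of all other pairs. -/
theorem ext_key_ne (hC : C.Valid) (hs : C.Small x y ρ δ) {P Q : ExtPair x} (hP : P.Proper)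
    (hQ : Q.Proper) (h : C.extKey y ρ δ P = C.extKey y ρ δ Q) : Same C P Q := by
  rcases ExtLt.total hC (y := y) hP hQ with h' | h' | h'
  · exact absurd h (hs.key_lt _ _ hP hQ h').ne
  · exact absurd h (hs.key_lt _ _ hQ hP h').ne'
  · exact h'

/-- For a real point configuration the extended data are those of a small quadrilateral. -/
theorem slope_ext_equiv {X Y : ι → ℝ} (hC : (slope X Y).Valid)
    (hs : (slope X Y).Small x y ρ δ) :
    Equiv (slope
      (Sum.elim (fun j : {a // a ≠ x} => X j) (fun r => X x + δ * quadX ρ r))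
      (Sum.elim (fun j : {a // a ≠ x} => Y j)
        (fun r => Y x + ((slope X Y).key y x * (δ * quadX ρ r) + δ ^ 2 * quadZ ρ r))))
      ((slope X Y).ext x y ρ δ) := by
  set S := slope
      (Sum.elim (fun j : {a // a ≠ x} => X j) (fun r => X x + δ * quadX ρ r))
      (Sum.elim (fun j : {a // a ≠ x} => Y j)
        (fun r => Y x + ((slope X Y).key y x * (δ * quadX ρ r) + δ ^ 2 * quadZ ρ r))) with hS
  have on' : ∀ j r, S.key (.inl j) (.inr r) = ((slope X Y).ext x y ρ δ).key (.inl j) (.inr r) := by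
    intro j r
    have hd : X x - X j ≠ 0 := sub_ne_zero.2 (hC.inj.ne j.2).symm
    have e : (slope X Y).key j x * (X j - X x) = Y j - Y x := by
      have : (slope X Y).key j x = (Y x - Y j) / (X x - X j) := rfl
      rw [this, div_mul_eq_mul_div, div_eq_iff hd]; ring
    refine Eq.trans ?_ (hs.extKey_on hC j r).symm
    have e' : (slope X Y).pos = X := rfl
    rw [e', e]
    simp only [hS]
    change (_ - _) / (_ - _) = _
    simp only [Sum.elim_inl, Sum.elim_inr]
    congr 1 <;> ring
  have hkey : ∀ a b, a ≠ b → S.key a b = ((slope X Y).ext x y ρ δ).key a b := by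
    rintro (j | r) (k | q) hab
    · simp only [ext, extPair, extKey, baseKey, base, rate, mul_zero, add_zero]
      rfl
    · exact on' j q
    · rw [(ext_valid hC hs).symm, ← on', hS, slope_key_comm]
    · refine Eq.trans ?_ (hs.extKey_nn (fun h => hab (by rw [h]))).symm
      simp only [hS]
      change (_ - _) / (_ - _) = _
      simp only [Sum.elim_inr]
      congr 1 <;> ring
  refine ⟨fun a b => Iff.rfl, fun a b c d hab hcd => ?_⟩
  rw [hkey a b hab, hkey c d hcd]

end Conf

/-! ### Putting the replaced element back -/

/-- Four points in the four open quadrants of two lines surround the intersection of the lines. -/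
theorem exists_quad_weights {a b : Fin 4 → ℝ} (ha : ∀ r, IsRight (quadFlip r) → 0 < a r)
    (ha' : ∀ r, ¬ IsRight (quadFlip r) → a r < 0) (hb : ∀ r, IsRight r → 0 < b r)
    (hb' : ∀ r, ¬ IsRight r → b r < 0) :
    ∃ w : Fin 4 → ℝ, (∀ r, 0 < w r) ∧ ∑ r, w r = 1 ∧ ∑ r, w r * a r = 0 ∧ ∑ r, w r * b r = 0 := by
  have a0 : 0 < a 0 := ha 0 (by decide)
  have a3 : 0 < a 3 := ha 3 (by decide)
  have a1 : 0 < -a 1 := neg_pos.2 (ha' 1 (by decide))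
  have a2 : 0 < -a 2 := neg_pos.2 (ha' 2 (by decide))
  have b0 : 0 < b 0 := hb 0 (by decide)
  have b1 : 0 < b 1 := hb 1 (by decide)
  have b2 : 0 < -b 2 := neg_pos.2 (hb' 2 (by decide))
  have b3 : 0 < -b 3 := neg_pos.2 (hb' 3 (by decide))
  set B := -a 1 * b 0 + a 0 * b 1 with hB
  set B' := a 3 * -b 2 + -a 2 * -b 3 with hB'
  have hBp : 0 < B := by positivity
  have hBp' : 0 < B' := by positivity
  -- The first two weights cancel `a` along the side `0, 1` and the last two along the side `2, 3`.
  -- The remaining values of `b` are `B` and `-B'`, which the factors `B'` and `B` balance.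
  let v : Fin 4 → ℝ := ![B' * -a 1, B' * a 0, B * a 3, B * -a 2]
  have hv : ∀ r, 0 < v r := by
    intro r; fin_cases r <;> simp only [v] <;> simp <;> nlinarith
  have hs : 0 < ∑ r, v r := Finset.sum_pos (fun r _ => hv r) Finset.univ_nonempty
  refine ⟨fun r => v r / ∑ r, v r, fun r => div_pos (hv r) hs, ?_, ?_, ?_⟩
  · rw [← Finset.sum_div, div_self hs.ne']
  · simp only [div_mul_eq_mul_div]
    rw [← Finset.sum_div, div_eq_zero_iff]; left
    simp [Fin.sum_univ_four, v]; ring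
  · simp only [div_mul_eq_mul_div]
    rw [← Finset.sum_div, div_eq_zero_iff]; left
    simp only [Fin.sum_univ_four, v]
    simp
    rw [hB, hB']; ring

/-- An affine function of a weighted mean is the weighted mean of the values. -/
theorem affine_sum {w X Y : Fin 4 → ℝ} (hw : ∑ r, w r = 1) (A B D : ℝ) :
    A + B * ∑ r, w r * X r + D * ∑ r, w r * Y r = ∑ r, w r * (A + B * X r + D * Y r) := by
  simp only [Fin.sum_univ_four] at *
  linear_combination -A * hw

theorem sum_weight_pos {w g : Fin 4 → ℝ} (hw : ∀ r, 0 < w r) (hg : ∀ r, 0 < g r) :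
    0 < ∑ r, w r * g r :=
  Finset.sum_pos (fun r _ => mul_pos (hw r) (hg r)) Finset.univ_nonempty

/-- A value separating two families of numbers. -/
theorem exists_separating {κ : Type} [Fintype κ] (p : κ → Prop) (f : κ → ℝ)
    (h : ∀ r q, ¬ p r → p q → f r < f q) : ∃ m, ∀ r, (p r → m < f r) ∧ (¬ p r → f r < m) := by
  classical
  obtain ⟨m, h1, h2⟩ := Order.exists_between_finsets
    ((Finset.univ.filter fun r => ¬ p r).image f) ((Finset.univ.filter p).image f) (by
      intro a ha b hb
      simp only [Finset.mem_image, Finset.mem_filter, Finset.mem_univ, true_and] at ha hb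
      obtain ⟨r, hr, rfl⟩ := ha
      obtain ⟨q, hq, rfl⟩ := hb
      exact h r q hr hq)
  exact ⟨m, fun r => ⟨fun hr => h2 _ (Finset.mem_image_of_mem _ (by simpa using hr)),
    fun hr => h1 _ (Finset.mem_image_of_mem _ (by simpa using hr))⟩⟩

namespace Conf

variable {ι : Type} {x y : ι} {C : Conf ι} {ρ δ : ℝ}

open ExtPair

/-- Guarantees, for each old element `j`, a gap between the slopes to the vertices below and above
the line `jx`, into which a separating slope fits. -/
theorem extLt_of_above (hC : C.Valid) {j : {a // a ≠ x}} {r q : Fin 4} (hr : ¬ C.Above x y j r)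
    (hq : C.Above x y j q) : C.ExtLt y (on j r) (on j q) := by
  refine Or.inr ⟨rfl, ?_⟩
  have hj := lt_or_gt_of_ne (hC.inj.ne j.2)
  have hj' := @lt_asymm _ _ (C.pos j) (C.pos x)
  simp only [SubLt, Above, QuotLt] at *
  rcases lt_trichotomy (C.key j x) (C.key y x) with e | e | e
  · simp only [e, e.ne, e.not_gt, false_and, false_or, true_and] at hr hq ⊢
    tauto
  · simp only [e, lt_irrefl, false_and, or_false, true_and] at hr hq ⊢
    tauto
  · simp only [e, e.ne', e.not_gt, false_and, false_or, true_and, or_false] at hr hq ⊢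
    tauto

section restore

variable {X Y : {a // a ≠ x} ⊕ Fin 4 → ℝ}

theorem key_lt_of_extLt (hs : C.Small x y ρ δ) (h : Equiv (slope X Y) (C.ext x y ρ δ))
    {a b c d : {a // a ≠ x} ⊕ Fin 4} (hab : a ≠ b) (hcd : c ≠ d)
    (hlt : C.ExtLt y (extPair a b) (extPair c d)) :
    (slope X Y).key a b < (slope X Y).key c d :=
  (h.key_iff a b c d hab hcd).2
    (hs.key_lt _ _ (extPair_proper hab) (extPair_proper hcd) hlt)

/-- The slope of a line through an old point that separates the new points as it should. -/
theorem exists_slope (hC : C.Valid) (hs : C.Small x y ρ δ)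
    (h : Equiv (slope X Y) (C.ext x y ρ δ)) (j : {a // a ≠ x}) :
    ∃ m, (∀ k l : {a // a ≠ x}, k ≠ l → C.key k l = C.key j x →
        (slope X Y).key (.inl k) (.inl l) = m) ∧
      ∀ r, (C.Above x y j r → m < (slope X Y).key (.inl j) (.inr r)) ∧
        (¬ C.Above x y j r → (slope X Y).key (.inl j) (.inr r) < m) := by
  -- If old pairs already have the slope of `jx`, their realized slope is forced on `m`; it
  -- separates the vertices because old pairs have class `0`, between `-1` and `1`. Otherwise any
  -- number in the gap serves.
  by_cases hex : ∃ k l : {a // a ≠ x}, k ≠ l ∧ C.key k l = C.key j x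
  · obtain ⟨k, l, hkl, hk⟩ := hex
    have hkl' : (Sum.inl k : {a // a ≠ x} ⊕ Fin 4) ≠ Sum.inl l := Sum.inl_injective.ne hkl
    refine ⟨(slope X Y).key (.inl k) (.inl l), fun k' l' hkl2 hk2 => ?_, fun r => ⟨fun hr => ?_, fun hr => ?_⟩⟩
    · rw [h.key_eq_iff (Sum.inl_injective.ne hkl2) hkl']
      exact extKey_eq_of_same (hk2.trans hk.symm)
    · refine key_lt_of_extLt hs h hkl' (by simp) (Or.inr ⟨hk, ?_⟩)
      simp [extPair, SubLt, slopeClass, hr]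
    · refine key_lt_of_extLt hs h (by simp) hkl' (Or.inr ⟨hk.symm, ?_⟩)
      simp [extPair, SubLt, slopeClass, hr]
  · obtain ⟨m, hm⟩ := exists_separating (C.Above x y j)
      (fun r => (slope X Y).key (.inl j) (.inr r)) fun r q hr hq =>
        key_lt_of_extLt hs h (by simp) (by simp) (extLt_of_above hC hr hq)
    exact ⟨m, fun k l hkl hk => absurd ⟨k, l, hkl, hk⟩ hex, hm⟩

theorem slope_lt_iff {x₁ x₂ y₁ y₂ m : ℝ} (h : x₁ < x₂) :
    (y₂ - y₁) / (x₂ - x₁) < m ↔ 0 < y₁ - m * x₁ + m * x₂ + -1 * y₂ := by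
  rw [div_lt_iff₀ (sub_pos.2 h)]; constructor <;> intro h <;> linarith

theorem lt_slope_iff {x₁ x₂ y₁ y₂ m : ℝ} (h : x₁ < x₂) :
    m < (y₂ - y₁) / (x₂ - x₁) ↔ 0 < m * x₁ - y₁ + -m * x₂ + 1 * y₂ := by
  rw [lt_div_iff₀ (sub_pos.2 h)]; constructor <;> intro h <;> linarith

theorem slope_lt_iff' {x₁ x₂ y₁ y₂ m : ℝ} (h : x₂ < x₁) :
    (y₂ - y₁) / (x₂ - x₁) < m ↔ 0 < m * x₁ - y₁ + -m * x₂ + 1 * y₂ := by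
  rw [div_lt_iff_of_neg (sub_neg.2 h)]; constructor <;> intro h <;> linarith

theorem lt_slope_iff' {x₁ x₂ y₁ y₂ m : ℝ} (h : x₂ < x₁) :
    m < (y₂ - y₁) / (x₂ - x₁) ↔ 0 < y₁ - m * x₁ + m * x₂ + -1 * y₂ := by
  rw [lt_div_iff_of_neg (sub_neg.2 h)]; constructor <;> intro h <;> linarith

open Classical in
/-- From a point configuration that realizes the extended data one gets a realization of the
original data, with `x` among the four new points. -/
theorem exists_restore (hC : C.Valid) (hs : C.Small x y ρ δ) (hy : y ≠ x)
    (h : Equiv (slope X Y) (C.ext x y ρ δ)) {s : ℝ}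
    (hbad : ∀ j k l, j ≠ x → k ≠ x → l ≠ x → k ≠ l → C.key j x = C.key k l →
      C.key j x = C.key y x ∨ C.key j x = s) :
    ∃ w : Fin 4 → ℝ, (∀ r, 0 < w r) ∧ ∑ r, w r = 1 ∧
      Equiv (slope
        (fun a => if ha : a = x then ∑ r, w r * X (.inr r) else X (.inl ⟨a, ha⟩))
        (fun a => if ha : a = x then ∑ r, w r * Y (.inr r) else Y (.inl ⟨a, ha⟩))) C := by
  choose m hm hm' using exists_slope hC hs h
  have posr : ∀ (j : {a // a ≠ x}) r, C.pos j < C.pos x → X (.inl j) < X (.inr r) :=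
    fun j r hj => (h.pos_iff (.inl j) (.inr r)).2 (hs.lt_pos j r hj)
  have posl : ∀ (j : {a // a ≠ x}) r, C.pos x < C.pos j → X (.inr r) < X (.inl j) :=
    fun j r hj => (h.pos_iff (.inr r) (.inl j)).2 (hs.pos_lt j r hj)
  -- the position of the new points with respect to the separating lines
  let L : {a // a ≠ x} → Fin 4 → ℝ := fun j r =>
    (m j * X (.inl j) - Y (.inl j)) + -m j * X (.inr r) + 1 * Y (.inr r)
  -- A larger slope from `j` means a point above the line if `j` is on the left of the new points,
  -- and below it if `j` is on the right.
  have hL : ∀ (j : {a // a ≠ x}) r, ((C.Above x y j r ↔ C.pos j < C.pos x) → 0 < L j r) ∧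
      (¬ (C.Above x y j r ↔ C.pos j < C.pos x) → L j r < 0) := by
    intro j r
    rcases lt_or_gt_of_ne (hC.inj.ne j.2) with hj | hj
    · have hx := posr j r hj
      simp only [hj, iff_true]
      constructor
      · intro ha
        exact (lt_slope_iff hx).1 ((hm' j r).1 ha)
      · intro ha
        have := (slope_lt_iff hx).1 ((hm' j r).2 ha)
        simp only [L]; linarith
    · have hx := posl j r hj
      simp only [hj.not_gt, iff_false, not_not]
      constructor
      · intro ha
        exact (slope_lt_iff' hx).1 ((hm' j r).2 ha)
      · intro ha
        have := (lt_slope_iff' hx).1 ((hm' j r).1 ha)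
        simp only [L]; linarith
  have hasymm : ∀ j : {a // a ≠ x}, C.pos j < C.pos x → ¬ C.pos x < C.pos j := fun j h => h.not_gt
  have htot : ∀ j : {a // a ≠ x}, C.pos j < C.pos x ∨ C.pos x < C.pos j :=
    fun j => lt_or_gt_of_ne (hC.inj.ne j.2)
  have hLy : ∀ r, (IsRight (quadFlip r) → 0 < L ⟨y, hy⟩ r) ∧
      (¬ IsRight (quadFlip r) → L ⟨y, hy⟩ r < 0) := by
    intro r
    have h1 := hL ⟨y, hy⟩ r
    simp only [Above, lt_irrefl, false_and, or_false, true_and] at h1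
    have := htot ⟨y, hy⟩
    constructor <;> intro h2
    · exact h1.1 (by tauto)
    · exact h1.2 (by tauto)
  -- The second separating line: the one in the second special direction if that direction occurs,
  -- with the sign adjusted, and otherwise a vertical line, used only to fix a point.
  obtain ⟨B, hB, hB', hBs⟩ : ∃ B : Fin 4 → ℝ, (∀ r, IsRight r → 0 < B r) ∧
      (∀ r, ¬ IsRight r → B r < 0) ∧ ∀ (w : Fin 4 → ℝ), ∑ r, w r * B r = 0 →
      (∃ j : {a // a ≠ x}, C.key j x = s ∧ C.key j x ≠ C.key y x) →
      ∃ j : {a // a ≠ x}, C.key j x = s ∧ ∑ r, w r * L j r = 0 := by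
    by_cases hex : ∃ j : {a // a ≠ x}, C.key j x = s ∧ C.key j x ≠ C.key y x
    · obtain ⟨j, hj, hj'⟩ := hex
      have h0 := htot j
      have h1 := fun r => hL j r
      rcases lt_or_gt_of_ne hj' with e | e
      · simp only [Above, e, e.ne, e.not_gt, false_and, false_or, true_and] at h1
        refine ⟨L j, fun r hr => (h1 r).1 (by tauto), fun r hr => (h1 r).2 (by tauto),
          fun w hw _ => ⟨j, hj, hw⟩⟩
      · simp only [Above, e, e.ne', e.not_gt, false_and, false_or, or_false, true_and] at h1
        have := hasymm j
        refine ⟨fun r => -L j r, fun r hr => neg_pos.2 ((h1 r).2 (by tauto)),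
          fun r hr => neg_lt_zero.2 ((h1 r).1 (by tauto)), fun w hw _ => ⟨j, hj, ?_⟩⟩
        simpa using hw
    · obtain ⟨c, hc⟩ := exists_separating IsRight (fun r => X (.inr r)) (by
        intro r q hr hq
        refine (h.pos_iff (.inr r) (.inr q)).2 ?_
        simp only [ext, Sum.elim_inr]
        have h1 : quadX ρ r < quadX ρ q := (quadX_neg hs.rho_pos hr).trans (quadX_pos hq)
        have h2 := mul_lt_mul_of_pos_left h1 hs.delta_pos
        linarith)
      exact ⟨fun r => X (.inr r) - c, fun r hr => sub_pos.2 ((hc r).1 hr),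
        fun r hr => sub_neg.2 ((hc r).2 hr), fun w hw hex' => absurd hex' hex⟩
  obtain ⟨w, hw, hw1, hwL, hwB⟩ := exists_quad_weights (fun r => (hLy r).1) (fun r => (hLy r).2) hB hB'
  replace hBs := hBs w hwB
  refine ⟨w, hw, hw1, ?_⟩
  set px := ∑ r, w r * X (.inr r) with hpx
  set py := ∑ r, w r * Y (.inr r) with hpy
  have aff : ∀ A B D : ℝ, A + B * px + D * py =
      ∑ r, w r * (A + B * X (.inr r) + D * Y (.inr r)) := affine_sum hw1
  have affpos : ∀ A B D : ℝ, (∀ r, 0 < A + B * X (.inr r) + D * Y (.inr r)) →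
      0 < A + B * px + D * py := by
    intro A B D hpos
    rw [aff]; exact sum_weight_pos hw hpos
  have pposr : ∀ j : {a // a ≠ x}, C.pos j < C.pos x → X (.inl j) < px := by
    intro j hj
    have := affpos (-X (.inl j)) 1 0 (fun r => by have := posr j r hj; linarith)
    linarith
  have pposl : ∀ j : {a // a ≠ x}, C.pos x < C.pos j → px < X (.inl j) := by
    intro j hj
    have := affpos (X (.inl j)) (-1) 0 (fun r => by have := posl j r hj; linarith)
    linarith
  -- slopes of lines through the new position of `x`
  let t : {a // a ≠ x} → ℝ := fun j => (py - Y (.inl j)) / (px - X (.inl j))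
  have hkey : ∀ j r, (slope X Y).key (.inl j) (.inr r) =
    (Y (.inr r) - Y (.inl j)) / (X (.inr r) - X (.inl j)) := fun _ _ => rfl
  -- A bound on the slope from `j` confines the vertices to a half-plane, which then contains their
  -- mean.
  have t_lt : ∀ j c, (∀ r, (slope X Y).key (.inl j) (.inr r) < c) → t j < c := by
    intro j c hc
    simp only [hkey] at hc
    rcases htot j with hj | hj
    · exact (slope_lt_iff (pposr j hj)).2
        (affpos _ _ _ fun r => (slope_lt_iff (posr j r hj)).1 (hc r))
    · exact (slope_lt_iff' (pposl j hj)).2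
        (affpos _ _ _ fun r => (slope_lt_iff' (posl j r hj)).1 (hc r))
  have lt_t : ∀ j c, (∀ r, c < (slope X Y).key (.inl j) (.inr r)) → c < t j := by
    intro j c hc
    simp only [hkey] at hc
    rcases htot j with hj | hj
    · exact (lt_slope_iff (pposr j hj)).2
        (affpos _ _ _ fun r => (lt_slope_iff (posr j r hj)).1 (hc r))
    · exact (lt_slope_iff' (pposl j hj)).2
        (affpos _ _ _ fun r => (lt_slope_iff' (posl j r hj)).1 (hc r))
  have tt_lt : ∀ j k : {a // a ≠ x}, C.key j x < C.key k x → t j < t k := by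
    intro j k hjk
    have h1 : ∀ r q, (slope X Y).key (.inl j) (.inr r) < (slope X Y).key (.inl k) (.inr q) :=
      fun r q => key_lt_of_extLt hs h (by simp) (by simp) (Or.inl hjk)
    obtain ⟨c, h2, h3⟩ := Order.exists_between_finsets
      (Finset.univ.image fun r => (slope X Y).key (.inl j) (.inr r))
      (Finset.univ.image fun r => (slope X Y).key (.inl k) (.inr r)) (by
        intro a ha b hb
        simp only [Finset.mem_image, Finset.mem_univ, true_and] at ha hb
        obtain ⟨r, rfl⟩ := ha
        obtain ⟨q, rfl⟩ := hb
        exact h1 r q)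
    exact (t_lt j c fun r => h2 _ (Finset.mem_image_of_mem _ (Finset.mem_univ r))).trans
      (lt_t k c fun r => h3 _ (Finset.mem_image_of_mem _ (Finset.mem_univ r)))
  have ot_lt : ∀ j k l : {a // a ≠ x}, k ≠ l → C.key k l < C.key j x →
      (slope X Y).key (.inl k) (.inl l) < t j := by
    intro j k l hkl hlt
    exact lt_t _ _ fun r => key_lt_of_extLt hs h (Sum.inl_injective.ne hkl) (by simp) (Or.inl hlt)
  have to_lt : ∀ j k l : {a // a ≠ x}, k ≠ l → C.key j x < C.key k l →
      t j < (slope X Y).key (.inl k) (.inl l) := by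
    intro j k l hkl hlt
    exact t_lt _ _ fun r => key_lt_of_extLt hs h (by simp) (Sum.inl_injective.ne hkl) (Or.inl hlt)
  have pne : ∀ j : {a // a ≠ x}, px - X (.inl j) ≠ 0 := by
    intro j
    rcases htot j with hj | hj
    · exact (sub_pos.2 (pposr j hj)).ne'
    · exact (sub_neg.2 (pposl j hj)).ne
  -- If the mean lies on the line of `j₀`, then it is collinear with every old `j` whose line to `x`
  -- had the same slope, as such `j` lies on that same line.
  have one_line : ∀ j₀ : {a // a ≠ x}, ∑ r, w r * L j₀ r = 0 → ∀ j k l : {a // a ≠ x}, k ≠ l →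
      C.key j x = C.key k l → C.key j x = C.key j₀ x →
      t j = (slope X Y).key (.inl k) (.inl l) := by
    intro j₀ h0 j k l hkl hjk hj0
    have e1 : (slope X Y).key (.inl k) (.inl l) = m j₀ := hm j₀ k l hkl (by rw [← hjk, hj0])
    rw [← aff] at h0
    have e2 : Y (.inl j₀) - Y (.inl j) = m j₀ * (X (.inl j₀) - X (.inl j)) := by
      rcases eq_or_ne j j₀ with rfl | hne
      · ring
      · have hne' : (j : ι) ≠ j₀ := fun h => hne (Subtype.ext h)
        have e3 := hC.key_trans j.2.symm j₀.2.symm hne' (by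
          rw [hC.symm x j, hC.symm x j₀, hj0])
        have e4 : (Y (.inl j₀) - Y (.inl j)) / (X (.inl j₀) - X (.inl j)) = m j₀ :=
          hm j₀ j j₀ hne (by rw [e3, hC.symm x j, hj0])
        have hx : X (.inl j₀) - X (.inl j) ≠ 0 := by
          rcases lt_or_gt_of_ne (hC.inj.ne hne') with h1 | h1
          · exact (sub_pos.2 ((h.pos_iff (.inl j) (.inl j₀)).2 h1)).ne'
          · exact (sub_neg.2 ((h.pos_iff (.inl j₀) (.inl j)).2 h1)).ne
        rw [← e4, div_mul_cancel₀ _ hx]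
    rw [e1, div_eq_iff (pne j)]
    linarith
  -- By `hbad` equalities occur in two directions only, and the weights were chosen to satisfy both.
  have to_eq : ∀ j k l : {a // a ≠ x}, k ≠ l → C.key j x = C.key k l →
      t j = (slope X Y).key (.inl k) (.inl l) := by
    intro j k l hkl hjk
    by_cases hjy : C.key j x = C.key y x
    · exact one_line ⟨y, hy⟩ hwL j k l hkl hjk hjy
    · have hj : C.key j x = s := (hbad j k l j.2 k.2 l.2 (fun h => hkl (Subtype.ext h)) hjk).resolve_left hjy
      obtain ⟨j₀, h1, h2⟩ := hBs ⟨j, hj, hjy⟩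
      exact one_line j₀ h2 j k l hkl hjk (hj.trans h1.symm)
  have tt_eq : ∀ j k : {a // a ≠ x}, C.key j x = C.key k x → t j = t k := by
    intro j k hjk
    rcases eq_or_ne j k with rfl | hne
    · rfl
    have hne' : (j : ι) ≠ k := fun h => hne (Subtype.ext h)
    have e := hC.key_trans j.2.symm k.2.symm hne' (by rw [hC.symm x j, hC.symm x k, hjk])
    rw [hC.symm x j] at e
    rw [to_eq j j k hne e.symm, to_eq k j k hne (by rw [e, hjk])]
  have oo_iff : ∀ j k l i : {a // a ≠ x}, j ≠ k → l ≠ i →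
      ((slope X Y).key (.inl j) (.inl k) < (slope X Y).key (.inl l) (.inl i) ↔
        C.key j k < C.key l i) := by
    intro j k l i hjk hli
    rw [h.key_iff _ _ _ _ (Sum.inl_injective.ne hjk) (Sum.inl_injective.ne hli)]
    simp only [ext, extPair, extKey, baseKey, base, rate, mul_zero, add_zero]
  set T := slope (fun a => if ha : a = x then px else X (.inl ⟨a, ha⟩))
        (fun a => if ha : a = x then py else Y (.inl ⟨a, ha⟩)) with hT
  have rep : ∀ a b, a ≠ b → (∃ j k : {a // a ≠ x}, j ≠ k ∧
      T.key a b = (slope X Y).key (.inl j) (.inl k) ∧ C.key a b = C.key j k) ∨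
      (∃ j : {a // a ≠ x}, T.key a b = t j ∧ C.key a b = C.key j x) := by
    intro a b hab
    by_cases ha : a = x
    · subst ha
      right
      refine ⟨⟨b, hab.symm⟩, ?_, hC.symm _ _⟩
      rw [hT, slope_key_comm]
      simp [slope, hab.symm, t]
    · by_cases hb : b = x
      · subst hb
        right
        refine ⟨⟨a, ha⟩, ?_, rfl⟩
        simp [hT, slope, ha, t]
      · left
        refine ⟨⟨a, ha⟩, ⟨b, hb⟩, fun h => hab (congrArg Subtype.val h), ?_, rfl⟩
        simp [hT, slope, ha, hb]
  constructor
  · intro a b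
    by_cases ha : a = x
    · subst ha
      by_cases hb : b = a
      · subst hb; simp
      · simp only [hT, slope, dif_pos, dif_neg hb]
        rcases htot ⟨b, hb⟩ with h1 | h1
        · exact iff_of_false (pposr _ h1).not_gt h1.not_gt
        · exact iff_of_true (pposl _ h1) h1
    · by_cases hb : b = x
      · subst hb
        simp only [hT, slope, dif_pos, dif_neg ha]
        rcases htot ⟨a, ha⟩ with h1 | h1
        · exact iff_of_true (pposr _ h1) h1
        · exact iff_of_false (pposl _ h1).not_gt h1.not_gt
      · simp only [hT, slope, dif_neg ha, dif_neg hb]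
        exact h.pos_iff (.inl ⟨a, ha⟩) (.inl ⟨b, hb⟩)
  · have klt : ∀ a b c d, a ≠ b → c ≠ d → C.key a b < C.key c d → T.key a b < T.key c d := by
      intro a b c d hab hcd hlt
      rcases rep a b hab with ⟨j, k, hjk, e1, e2⟩ | ⟨j, e1, e2⟩ <;>
      rcases rep c d hcd with ⟨l, i, hli, e3, e4⟩ | ⟨l, e3, e4⟩ <;>
      rw [e1, e3] <;> rw [e2, e4] at hlt
      · exact (oo_iff _ _ _ _ hjk hli).2 hlt
      · exact ot_lt _ _ _ hjk hlt
      · exact to_lt _ _ _ hli hlt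
      · exact tt_lt _ _ hlt
    have keq : ∀ a b c d, a ≠ b → c ≠ d → C.key a b = C.key c d → T.key a b = T.key c d := by
      intro a b c d hab hcd heq
      rcases rep a b hab with ⟨j, k, hjk, e1, e2⟩ | ⟨j, e1, e2⟩ <;>
      rcases rep c d hcd with ⟨l, i, hli, e3, e4⟩ | ⟨l, e3, e4⟩ <;>
      rw [e1, e3] <;> rw [e2, e4] at heq
      · have h1 := oo_iff _ _ _ _ hjk hli
        have h2 := oo_iff _ _ _ _ hli hjk
        rw [heq, lt_self_iff_false, iff_false] at h1 h2
        exact le_antisymm (not_lt.1 h2) (not_lt.1 h1)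
      · exact (to_eq _ _ _ hjk heq.symm).symm
      · exact to_eq _ _ _ hli heq
      · exact tt_eq _ _ heq
    intro a b c d hab hcd
    refine ⟨fun hlt => ?_, klt a b c d hab hcd⟩
    by_contra hcon
    rcases eq_or_lt_of_le (not_lt.1 hcon) with e | e
    · exact hlt.ne (keq _ _ _ _ hcd hab e).symm
    · exact lt_asymm hlt (klt _ _ _ _ hcd hab e)

end restore

end Conf

/-! ### Points of the plane in rotated coordinates -/

/-- The point with coordinates `x` and `y` in the frame rotated by `θ`. -/
noncomputable def framePt (θ x y : ℝ) : Plane :=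
  x • unitVec θ + y • unitVec (θ + Real.pi / 2)

theorem inner_framePt_fst (θ x y : ℝ) : inner ℝ (framePt θ x y) (unitVec θ) = x := by
  rw [inner_unitVec]
  simp [framePt, unitVec, Real.cos_add_pi_div_two, Real.sin_add_pi_div_two]
  linear_combination x * Real.sin_sq_add_cos_sq θ

theorem inner_framePt_snd (θ x y : ℝ) :
    inner ℝ (framePt θ x y) (unitVec (θ + Real.pi / 2)) = y := by
  rw [inner_unitVec]
  simp [framePt, unitVec, Real.cos_add_pi_div_two, Real.sin_add_pi_div_two]
  linear_combination y * Real.sin_sq_add_cos_sq θ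

theorem framePt_inner (θ : ℝ) (p : Plane) :
    framePt θ (inner ℝ p (unitVec θ)) (inner ℝ p (unitVec (θ + Real.pi / 2))) = p := by
  rw [inner_unitVec, inner_unitVec]
  ext i
  fin_cases i <;> simp [framePt, unitVec, Real.cos_add_pi_div_two, Real.sin_add_pi_div_two]
  · linear_combination p 0 * Real.sin_sq_add_cos_sq θ
  · linear_combination p 1 * Real.sin_sq_add_cos_sq θ

theorem frame_ext (θ : ℝ) {p q : Plane} (h : inner ℝ p (unitVec θ) = inner ℝ q (unitVec θ))
    (h' : inner ℝ p (unitVec (θ + Real.pi / 2)) = inner ℝ q (unitVec (θ + Real.pi / 2))) :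
    p = q := by
  rw [← framePt_inner θ p, h, h', framePt_inner]

/-- The doubled oriented area of the triangle `v 0, v 1, v 3` in the frame rotated by `θ`. -/
noncomputable def quadArea (θ : ℝ) (v : Fin 4 → Plane) : ℝ :=
  inner ℝ (v 1 - v 0) (unitVec θ) * inner ℝ (v 3 - v 0) (unitVec (θ + Real.pi / 2)) -
  inner ℝ (v 3 - v 0) (unitVec θ) * inner ℝ (v 1 - v 0) (unitVec (θ + Real.pi / 2))

theorem linearIndependent_of_quadArea {θ : ℝ} {v : Fin 4 → Plane} (h : quadArea θ v ≠ 0) :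
    LinearIndependent ℝ ![v 1 - v 0, v 3 - v 0] := by
  rw [LinearIndependent.pair_iff]
  intro s t hst
  have h1 := congrArg (fun z => inner ℝ z (unitVec θ)) hst
  have h2 := congrArg (fun z => inner ℝ z (unitVec (θ + Real.pi / 2))) hst
  simp only [inner_add_left, inner_smul_left, inner_zero_left] at h1 h2
  simp only [conj_trivial] at h1 h2
  unfold quadArea at h
  constructor
  · refine (mul_eq_zero.1 (?_ : s * _ = 0)).resolve_right h
    linear_combination inner ℝ (v 3 - v 0) (unitVec (θ + Real.pi / 2)) * h1 -
      inner ℝ (v 3 - v 0) (unitVec θ) * h2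
  · refine (mul_eq_zero.1 (?_ : t * _ = 0)).resolve_right h
    linear_combination inner ℝ (v 1 - v 0) (unitVec θ) * h2 -
      inner ℝ (v 1 - v 0) (unitVec (θ + Real.pi / 2)) * h1

/-- A mean with positive weights of points that are not collinear is an interior point of their
convex hull. -/
theorem sum_mem_interior {θ : ℝ} {v : Fin 4 → Plane} (h : quadArea θ v ≠ 0) {w : Fin 4 → ℝ}
    (hw : ∀ r, 0 < w r) (hw1 : ∑ r, w r = 1) :
    ∑ r, w r • v r ∈ interior (convexHull ℝ (Set.range v)) := by
  set c := ∑ r, w r • v r with hc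
  -- Cramer's rule: `α` and `β` are the coordinates of `q - c` in the basis `v 1 - v 0`, `v 3 - v
  -- 0`. Near `c` they change the weights of the vertices 0, 1, 3 so little that these stay
  -- positive.
  let α : Plane → ℝ := fun q =>
    (inner ℝ (q - c) (unitVec θ) * inner ℝ (v 3 - v 0) (unitVec (θ + Real.pi / 2)) -
    inner ℝ (v 3 - v 0) (unitVec θ) * inner ℝ (q - c) (unitVec (θ + Real.pi / 2))) / quadArea θ v
  let β : Plane → ℝ := fun q =>
    (inner ℝ (v 1 - v 0) (unitVec θ) * inner ℝ (q - c) (unitVec (θ + Real.pi / 2)) -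
    inner ℝ (q - c) (unitVec θ) * inner ℝ (v 1 - v 0) (unitVec (θ + Real.pi / 2))) / quadArea θ v
  have hα : Continuous α := by fun_prop
  have hβ : Continuous β := by fun_prop
  have hq : ∀ q, q = c + α q • (v 1 - v 0) + β q • (v 3 - v 0) := by
    intro q
    rw [add_assoc, ← sub_eq_iff_eq_add']
    have e1 : α q * quadArea θ v = inner ℝ (q - c) (unitVec θ) *
      inner ℝ (v 3 - v 0) (unitVec (θ + Real.pi / 2)) -
      inner ℝ (v 3 - v 0) (unitVec θ) * inner ℝ (q - c) (unitVec (θ + Real.pi / 2)) :=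
      div_mul_cancel₀ _ h
    have e2 : β q * quadArea θ v = inner ℝ (v 1 - v 0) (unitVec θ) *
      inner ℝ (q - c) (unitVec (θ + Real.pi / 2)) -
      inner ℝ (q - c) (unitVec θ) * inner ℝ (v 1 - v 0) (unitVec (θ + Real.pi / 2)) :=
      div_mul_cancel₀ _ h
    apply frame_ext θ <;> rw [inner_add_left, inner_smul_left, inner_smul_left] <;>
      simp only [conj_trivial] <;> apply mul_right_cancel₀ h
    · rw [add_mul, mul_right_comm, e1, mul_right_comm (β q), e2]
      unfold quadArea; ring
    · rw [add_mul, mul_right_comm, e1, mul_right_comm (β q), e2]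
      unfold quadArea; ring
  have hα0 : α c = 0 := by simp [α]
  have hβ0 : β c = 0 := by simp [β]
  rw [mem_interior]
  refine ⟨{q | 0 < w 0 - α q - β q ∧ 0 < w 1 + α q ∧ 0 < w 3 + β q}, ?_, ?_, ?_⟩
  · rintro q ⟨h0, h1, h3⟩
    have e : q = ∑ r, (![w 0 - α q - β q, w 1 + α q, w 2, w 3 + β q] : Fin 4 → ℝ) r • v r := by
      conv_lhs => rw [hq q, hc]
      simp only [Fin.sum_univ_four]
      simp only [Matrix.cons_val]
      module
    rw [e]
    refine (convex_convexHull ℝ (Set.range v)).sum_mem (fun r _ => ?_) ?_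
      (fun r _ => subset_convexHull ℝ _ ⟨r, rfl⟩)
    · have := hw 2
      fin_cases r <;> simp <;> linarith
    · simp only [Fin.sum_univ_four] at hw1 ⊢
      simp only [Matrix.cons_val]
      linarith
  · have o0 : IsOpen {q | 0 < w 0 - α q - β q} := isOpen_lt continuous_const (by fun_prop)
    have o1 : IsOpen {q | 0 < w 1 + α q} := isOpen_lt continuous_const (by fun_prop)
    have o3 : IsOpen {q | 0 < w 3 + β q} := isOpen_lt continuous_const (by fun_prop)
    exact o0.inter (o1.inter o3)
  · change 0 < w 0 - α c - β c ∧ 0 < w 1 + α c ∧ 0 < w 3 + β c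
    rw [hα0, hβ0]
    exact ⟨by simpa using hw 0, by simpa using hw 1, by simpa using hw 3⟩

/-- Points that are strict maxima of linear functions are in convex position. -/
theorem convexIndependent_of_maxima {κ : Type} {v : κ → Plane}
    (h : ∀ i, ∃ n : Plane, ∀ j, j ≠ i → inner ℝ n (v j) < (inner ℝ n (v i) : ℝ)) :
    ConvexIndependent ℝ v := by
  intro s i hi
  by_contra his
  obtain ⟨n, hn⟩ := h i
  have hconv : Convex ℝ {z : Plane | inner ℝ n z < (inner ℝ n (v i) : ℝ)} := by
    have := convex_halfSpace_lt (𝕜 := ℝ) (f := fun z : Plane => (inner ℝ n z : ℝ))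
      ⟨fun x y => inner_add_right _ _ _, fun c x => by
        rw [inner_smul_right]; rfl⟩ (inner ℝ n (v i))
    exact this
  have : (inner ℝ n (v i) : ℝ) < inner ℝ n (v i) := convexHull_min (t := {z : Plane | inner ℝ n z < (inner ℝ n (v i) : ℝ)}) (by
    rintro _ ⟨j, hj, rfl⟩
    exact hn j (by rintro rfl; exact his hj)) hconv hi
  exact lt_irrefl _ this

/-! ### The two directions of a single replacement -/

namespace Conf

variable {ι : Type} {x y : ι} {C : Conf ι} {ρ δ : ℝ}

open ExtPair

theorem slope_valid {X Y : ι → ℝ} (h : Function.Injective X) : (slope X Y).Valid :=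
  ⟨h, slope_key_comm X Y, fun _ _ _ hab hbc => btw_slope hab hbc⟩

theorem Equiv.slope_valid {X Y : ι → ℝ} (h : Equiv (slope X Y) C) (hC : C.Valid) :
    (slope X Y).Valid := by
  apply Conf.slope_valid
  intro a b hab
  have := h.pos_eq_iff (a := a) (b := b)
  exact hC.inj (this.1 hab)

/-- The given realization gets its own parameters `ρ'` and `δ'`, as small as it requires; by
`ext_equiv` the result still realizes the data extended with the fixed `ρ` and `δ`. -/
theorem Realized.exists_quad [Finite ι] (hC : C.Valid) (hs : C.Small x y ρ δ) (hy : y ≠ x)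
    {p : ι → Plane} (hp : C.Realized p) {ε : ℝ} (hε : 0 < ε) :
    ∃ v : Fin 4 → Plane, (C.ext x y ρ δ).Realized (Sum.elim (fun j => p j) v) ∧
      (∀ r, dist (v r) (p x) < ε) ∧ p x ∈ interior (convexHull ℝ (Set.range v)) ∧
      IsPerturbedParallelogram ε v := by
  obtain ⟨θ, hθ⟩ := hp
  set X : ι → ℝ := fun a => inner ℝ (p a) (unitVec θ) with hX
  set Y : ι → ℝ := fun a => inner ℝ (p a) (unitVec (θ + Real.pi / 2)) with hY
  have hD := hθ.slope_valid hC
  set s := (slope X Y).key y x with hs0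
  let V : ℝ → ℝ → Fin 4 → Plane := fun ρ δ r =>
    p x + framePt θ (δ * quadX ρ r) (s * (δ * quadX ρ r) + δ ^ 2 * quadZ ρ r)
  -- Both coefficients of the perturbed parallelogram turn out to be `1 + ρ ^ 3 / (1 + ρ + 2 * ρ ^
  -- 2)`, so this bounds the error; it does not depend on `δ`.
  have h3 : ∀ᶠ ρ : ℝ in 𝓝[>] 0, ρ ^ 3 < ε := by
    have : ContinuousAt (fun ρ : ℝ => ρ ^ 3) 0 := by fun_prop
    have := this.tendsto.mono_left (nhdsWithin_le_nhds (s := Set.Ioi 0))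
    exact this.eventually_lt_const (by simpa using hε)
  obtain ⟨ρ', hρ1, hρ2⟩ := ((eventually_small hD x y).and h3).exists
  have hdist : ∀ᶠ δ : ℝ in 𝓝[>] 0, ∀ r, dist (V ρ' δ r) (p x) < ε := by
    rw [eventually_all]
    intro r
    have : ContinuousAt (fun δ : ℝ => dist (V ρ' δ r) (p x)) 0 := by
      simp only [V, framePt]; fun_prop
    have := this.tendsto.mono_left (nhdsWithin_le_nhds (s := Set.Ioi 0))
    refine this.eventually_lt_const ?_
    simp [V, framePt, hε]
  obtain ⟨δ', hδ1, hδ2⟩ := (hρ1.and hdist).exists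
  have fst : ∀ r, inner ℝ (V ρ' δ' r) (unitVec θ) = X x + δ' * quadX ρ' r := by
    intro r; simp only [V, inner_add_left, inner_framePt_fst]; rfl
  have snd : ∀ r, inner ℝ (V ρ' δ' r) (unitVec (θ + Real.pi / 2)) =
      Y x + (s * (δ' * quadX ρ' r) + δ' ^ 2 * quadZ ρ' r) := by
    intro r; simp only [V, inner_add_left, inner_framePt_snd]; rfl
  have hρ0 := hδ1.rho_pos
  have hδ0 := hδ1.delta_pos
  have x0 : quadX ρ' 0 = 1 + ρ' ^ 2 := rfl
  have x1 : quadX ρ' 1 = 1 := rfl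
  have x2 : quadX ρ' 2 = -ρ' - ρ' ^ 2 - ρ' ^ 3 := rfl
  have x3 : quadX ρ' 3 = -ρ' := rfl
  have z0 : quadZ ρ' 0 = 1 + ρ' ^ 2 := rfl
  have z1 : quadZ ρ' 1 = -ρ' := rfl
  have z2 : quadZ ρ' 2 = -ρ' - ρ' ^ 2 - ρ' ^ 3 := rfl
  have z3 : quadZ ρ' 3 = 1 := rfl
  have harea : quadArea θ (V ρ' δ') ≠ 0 := by
    have : quadArea θ (V ρ' δ') = -(δ' ^ 3 * ((1 + ρ') * (1 + ρ' + 2 * ρ' ^ 2))) := by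
      simp only [quadArea, inner_sub_left, fst, snd, x0, x1, x3, z0, z1, z3]
      ring
    rw [this]
    exact neg_ne_zero.2 (by positivity)
  refine ⟨V ρ' δ', ?_, hδ2, ?_, linearIndependent_of_quadArea harea, ?_⟩
  · refine ⟨θ, ?_⟩
    have h1 := (slope_ext_equiv hD hδ1).trans (ext_equiv hD hθ hy hδ1 hs)
    convert h1 using 2
    · ext (j | r)
      · rfl
      · exact fst r
    · ext (j | r)
      · rfl
      · exact snd r
  · obtain ⟨w, hw, hw1, hwa, hwb⟩ := exists_quad_weights (a := quadZ ρ') (b := quadX ρ')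
      (fun r => quadX_pos) (fun r => quadX_neg hρ0) (fun r => quadX_pos) (fun r => quadX_neg hρ0)
    have e : p x = ∑ r, w r • V ρ' δ' r := by
      simp only [V, framePt, Fin.sum_univ_four] at *
      have e1 : p x = (w 0 + w 1 + w 2 + w 3) • p x +
          (δ' * (w 0 * quadX ρ' 0 + w 1 * quadX ρ' 1 + w 2 * quadX ρ' 2 + w 3 * quadX ρ' 3)) •
            unitVec θ + (s * δ' * (w 0 * quadX ρ' 0 + w 1 * quadX ρ' 1 + w 2 * quadX ρ' 2 +
              w 3 * quadX ρ' 3) + δ' ^ 2 * (w 0 * quadZ ρ' 0 + w 1 * quadZ ρ' 1 +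
              w 2 * quadZ ρ' 2 + w 3 * quadZ ρ' 3)) • unitVec (θ + Real.pi / 2) := by
        rw [hw1, hwa, hwb]; simp
      refine e1.trans ?_
      module
    rw [e]
    exact sum_mem_interior harea hw hw1
  · have hpos : 0 < 1 + ρ' + 2 * ρ' ^ 2 := by positivity
    have hα : |1 + ρ' ^ 3 / (1 + ρ' + 2 * ρ' ^ 2) - 1| < ε := by
      rw [add_sub_cancel_left, abs_of_pos (by positivity)]
      refine lt_of_le_of_lt (div_le_self (by positivity) ?_) hρ2
      have : 0 < ρ' ^ 2 := by positivity
      linarith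
    refine ⟨_, _, hα, hα, ?_⟩
    obtain ⟨v, hv⟩ : ∃ v, v = V ρ' δ' := ⟨_, rfl⟩
    rw [← hv] at fst snd ⊢
    apply frame_ext θ <;> rw [inner_add_left, inner_add_left, inner_smul_left, inner_smul_left] <;>
      simp only [conj_trivial, inner_sub_left, fst, snd, x0, x1, x2, x3, z0, z1, z2, z3] <;>
      field_simp <;> ring

-- The mean from `exists_restore` is interior because its weights are positive. Convex position is
-- visible in the order type of the four vertices.
open Classical in
theorem Realized.exists_center (hC : C.Valid) (hs : C.Small x y ρ δ) (hy : y ≠ x)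
    {s : ℝ} (hbad : ∀ j k l, j ≠ x → k ≠ x → l ≠ x → k ≠ l → C.key j x = C.key k l →
      C.key j x = C.key y x ∨ C.key j x = s)
    {q : {a // a ≠ x} ⊕ Fin 4 → Plane} (hq : (C.ext x y ρ δ).Realized q) :
    ∃ c : Plane, C.Realized (fun a => if ha : a = x then c else q (.inl ⟨a, ha⟩)) ∧
      ConvexIndependent ℝ (fun r => q (.inr r)) ∧
      c ∈ interior (convexHull ℝ (Set.range fun r => q (.inr r))) := by
  obtain ⟨θ, hθ⟩ := hq
  set X : {a // a ≠ x} ⊕ Fin 4 → ℝ := fun a => inner ℝ (q a) (unitVec θ) with hX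
  set Y : {a // a ≠ x} ⊕ Fin 4 → ℝ := fun a => inner ℝ (q a) (unitVec (θ + Real.pi / 2)) with hY
  obtain ⟨w, hw, hw1, hE⟩ := exists_restore hC hs hy hθ hbad
  have hlt : ∀ r t, quadRank r < quadRank t → X (.inr r) < X (.inr t) := by
    intro r t hrt
    refine (hθ.pos_iff _ _).2 ?_
    have := mul_lt_mul_of_pos_left (quadX_lt hs.rho_pos hrt) hs.delta_pos
    simp only [ext, Sum.elim_inr]
    linarith
  have hslope : ∀ r t r' t', r ≠ t → r' ≠ t' → slopeRank r t < slopeRank r' t' →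
      (Y (.inr t) - Y (.inr r)) / (X (.inr t) - X (.inr r)) <
      (Y (.inr t') - Y (.inr r')) / (X (.inr t') - X (.inr r')) := by
    intro r t r' t' h1 h2 h3
    exact key_lt_of_extLt hs hθ (a := .inr r) (b := .inr t) (c := .inr r') (d := .inr t')
      (Sum.inr_injective.ne h1) (Sum.inr_injective.ne h2) (Or.inr ⟨rfl, h3⟩)
  have l23 := hlt 2 3 (by decide)
  have l31 := hlt 3 1 (by decide)
  have l10 := hlt 1 0 (by decide)
  set m := (Y (.inr 0) - Y (.inr 2)) / (X (.inr 0) - X (.inr 2)) with hm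
  -- Compared with the diagonal `0, 2` of slope `m`, the order of slopes puts vertex 1 below and
  -- vertex 3 above.
  have m23 := (lt_slope_iff l23).1 (hslope 2 0 2 3 (by decide) (by decide) (by decide))
  have m10 := (lt_slope_iff l10).1 (hslope 2 0 1 0 (by decide) (by decide) (by decide))
  have m31 := (slope_lt_iff l31).1 (hslope 3 1 2 0 (by decide) (by decide) (by decide))
  have m30 := (slope_lt_iff (l31.trans l10)).1 (hslope 3 0 2 0 (by decide) (by decide) (by decide))
  have m21 := (slope_lt_iff (l23.trans l31)).1 (hslope 2 1 2 0 (by decide) (by decide) (by decide))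
  rw [← hm] at m23 m10 m31 m30 m21
  have harea : quadArea θ (fun r => q (.inr r)) ≠ 0 := by
    intro h0
    have h1 := (slope_lt_iff (l31.trans l10)).1
      (hslope 3 0 1 0 (by decide) (by decide) (by decide))
    have h2 : (Y (.inr 0) - Y (.inr 1)) / (X (.inr 0) - X (.inr 1)) * (X (.inr 0) - X (.inr 1)) =
      Y (.inr 0) - Y (.inr 1) := div_mul_cancel₀ _ (sub_pos.2 l10).ne'
    set m' := (Y (.inr 0) - Y (.inr 1)) / (X (.inr 0) - X (.inr 1))
    have h3 : quadArea θ (fun r => q (.inr r)) =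
        (X (.inr 1) - X (.inr 0)) * (Y (.inr 3) - Y (.inr 0)) -
        (X (.inr 3) - X (.inr 0)) * (Y (.inr 1) - Y (.inr 0)) := by
      simp only [quadArea, inner_sub_left, hX, hY]
    rw [h0] at h3
    have h4 : 0 < (X (.inr 0) - X (.inr 1)) *
        (Y (.inr 3) - m' * X (.inr 3) + m' * X (.inr 0) + -1 * Y (.inr 0)) :=
      mul_pos (sub_pos.2 l10) h1
    apply h4.ne'
    linear_combination h3 + (X (.inr 0) - X (.inr 3)) * h2
  have inn : ∀ (a b : ℝ) z, inner ℝ (a • unitVec θ + b • unitVec (θ + Real.pi / 2)) (q z) =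
      a * X z + b * Y z := by
    intro a b z
    rw [inner_add_left, inner_smul_left, inner_smul_left, real_inner_comm,
      real_inner_comm (q z) (unitVec (θ + Real.pi / 2))]
    rfl
  refine ⟨∑ r, w r • q (.inr r), ⟨θ, ?_⟩, ?_, sum_mem_interior harea hw hw1⟩
  · convert hE using 2
    · ext a
      by_cases ha : a = x
      · simp only [dif_pos ha, sum_inner, inner_smul_left, hX]; rfl
      · simp only [dif_neg ha, hX]
    · ext a
      by_cases ha : a = x
      · simp only [dif_pos ha, sum_inner, inner_smul_left, hY]; rfl
      · simp only [dif_neg ha, hY]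
  · apply convexIndependent_of_maxima
    intro i
    -- The vertices 0 and 2 are extreme in the direction of the first axis, 1 and 3 orthogonally to
    -- the diagonal `0, 2`.
    fin_cases i
    · refine ⟨(1 : ℝ) • unitVec θ + (0 : ℝ) • unitVec (θ + Real.pi / 2), fun j hj => ?_⟩
      simp only [inn]
      fin_cases j <;> simp at hj ⊢ <;> linarith
    · refine ⟨m • unitVec θ + (-1 : ℝ) • unitVec (θ + Real.pi / 2), fun j hj => ?_⟩
      simp only [inn]
      fin_cases j <;> simp at hj ⊢ <;> linarith
    · refine ⟨(-1 : ℝ) • unitVec θ + (0 : ℝ) • unitVec (θ + Real.pi / 2), fun j hj => ?_⟩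
      simp only [inn]
      fin_cases j <;> simp at hj ⊢ <;> linarith
    · refine ⟨(-m) • unitVec θ + (1 : ℝ) • unitVec (θ + Real.pi / 2), fun j hj => ?_⟩
      simp only [inn]
      fin_cases j <;> simp at hj ⊢ <;> linarith

end Conf

namespace Conf

variable {ι : Type} {x y : ι} {C : Conf ι} {ρ δ : ℝ}

open ExtPair

/-- The original element that an element of the extended data stands for. -/
def extBase (x : ι) : {a // a ≠ x} ⊕ Fin 4 → ι := Sum.elim (fun j => j) (fun _ => x)

theorem ext_key_lt (hC : C.Valid) (hs : C.Small x y ρ δ) {a b c d : {a // a ≠ x} ⊕ Fin 4}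
    (hab : extBase x a ≠ extBase x b) (hcd : extBase x c ≠ extBase x d)
    (h : C.key (extBase x a) (extBase x b) < C.key (extBase x c) (extBase x d)) :
    (C.ext x y ρ δ).key a b < (C.ext x y ρ δ).key c d := by
  have hb : ∀ {a b : {a // a ≠ x} ⊕ Fin 4}, extBase x a ≠ extBase x b →
      C.baseKey y (extPair a b) = C.key (extBase x a) (extBase x b) := by
    rintro (j | r) (k | q) hab
    · rfl
    · rfl
    · exact hC.symm _ _
    · exact absurd rfl hab
  have hne : ∀ {a b : {a // a ≠ x} ⊕ Fin 4}, extBase x a ≠ extBase x b → a ≠ b := by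
    rintro a b hab rfl; exact hab rfl
  exact hs.key_lt _ _ (extPair_proper (hne hab)) (extPair_proper (hne hcd))
    (Or.inl (by rw [hb hab, hb hcd]; exact h))

theorem ext_pos_lt_iff (hC : C.Valid) (hs : C.Small x y ρ δ) {a b : {a // a ≠ x} ⊕ Fin 4}
    (hab : extBase x a ≠ extBase x b) :
    (C.ext x y ρ δ).pos a < (C.ext x y ρ δ).pos b ↔
      C.pos (extBase x a) < C.pos (extBase x b) := by
  rcases a with j | r <;> rcases b with k | q
  · rfl
  · simp only [ext, extBase, Sum.elim_inl, Sum.elim_inr]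
    rcases lt_or_gt_of_ne (hC.inj.ne j.2) with h | h
    · exact iff_of_true (hs.lt_pos _ _ h) h
    · exact iff_of_false (hs.pos_lt _ _ h).not_gt h.not_gt
  · simp only [ext, extBase, Sum.elim_inl, Sum.elim_inr]
    rcases lt_or_gt_of_ne (hC.inj.ne k.2) with h | h
    · exact iff_of_false (hs.lt_pos _ _ h).not_gt h.not_gt
    · exact iff_of_true (hs.pos_lt _ _ h) h
  · exact absurd rfl hab

theorem ext_key_old (j k : {a // a ≠ x}) :
    (C.ext x y ρ δ).key (.inl j) (.inl k) = C.key j k := by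
  simp [ext, extPair, extKey, baseKey, base, rate]

end Conf

/-! ### Induction along the constructibility order -/

namespace AllowableSeq

variable {n k : ℕ}

/-- The element `e j` is replaced by four elements once the elements from the index `i` on are
treated. -/
def Replaced (A : AllowableSeq n k) (e : Equiv.Perm (Fin n)) (i : ℕ) (j : Fin n) : Prop :=
  i ≤ j ∧ (A.linesAt e j).Nonempty

/-- The data obtained from `A` after the elements from the index `i` on are treated. The element
`c` is replaced by the elements `Q c r`. -/
structure Stage (A : AllowableSeq n k) (e : Equiv.Perm (Fin n)) (i : ℕ) : Type 1 where
  /-- the elements -/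
  ι : Type
  finite : Finite ι
  /-- the data -/
  C : Conf ι
  /-- the replaced element -/
  f : ι → Fin n
  /-- the replacing elements -/
  Q : Fin n → Fin 4 → ι
  valid : C.Valid
  Q_f : ∀ a, ∃ r, Q (f a) r = a
  f_Q : ∀ j r, f (Q j r) = j
  Q_inj : ∀ j, A.Replaced e i j → Function.Injective (Q (e j))
  -- An element that is not replaced fills all four slots.
  Q_const : ∀ j, ¬ A.Replaced e i j → ∀ r, Q (e j) r = Q (e j) 0
  pos_iff : ∀ a b, f a ≠ f b → (C.pos a < C.pos b ↔ A.conf.pos (f a) < A.conf.pos (f b))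
  key_lt : ∀ a b c d, f a ≠ f b → f c ≠ f d →
    A.conf.key (f a) (f b) < A.conf.key (f c) (f d) → C.key a b < C.key c d
  -- Among the elements not yet treated the coincidences of `A` persist; together with `key_lt` this
  -- keeps their order type unchanged.
  key_eq : ∀ a b c d, (e.symm (f a) : ℕ) < i → (e.symm (f b) : ℕ) < i →
    (e.symm (f c) : ℕ) < i → (e.symm (f d) : ℕ) < i → f a ≠ f b → f c ≠ f d →
    A.conf.key (f a) (f b) = A.conf.key (f c) (f d) → C.key a b = C.key c d
  -- A connecting line of a treated element shares its slope with no other pair; at `i = 0` this is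
  -- full genericity.
  generic : ∀ a b c d, a ≠ b → c ≠ d → i ≤ (e.symm (f a) : ℕ) → C.key a b = C.key c d →
    (a = c ∧ b = d) ∨ (a = d ∧ b = c)
  fwd : ∀ p, A.conf.Realized p → ∀ ε : ℝ, 0 < ε → ∃ q, C.Realized q ∧ ∀ j,
    (A.Replaced e i j → (∀ r, dist (q (Q (e j) r)) (p (e j)) < ε) ∧
      p (e j) ∈ interior (convexHull ℝ (Set.range fun r => q (Q (e j) r))) ∧
      IsPerturbedParallelogram ε fun r => q (Q (e j) r)) ∧
    (¬ A.Replaced e i j → q (Q (e j) 0) = p (e j))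
  bwd : ∀ q, C.Realized q → ∃ p, A.conf.Realized p ∧ ∀ j,
    (A.Replaced e i j → ConvexIndependent ℝ (fun r => q (Q (e j) r)) ∧
      p (e j) ∈ interior (convexHull ℝ (Set.range fun r => q (Q (e j) r)))) ∧
    (¬ A.Replaced e i j → q (Q (e j) 0) = p (e j))

/-- The stage where no element is treated. -/
noncomputable def Stage.init (A : AllowableSeq n k) (e : Equiv.Perm (Fin n)) : A.Stage e n where
  ι := Fin n
  finite := inferInstance
  C := A.conf
  f := id
  Q j _ := j
  valid := A.conf_valid
  Q_f a := ⟨0, rfl⟩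
  f_Q j r := rfl
  Q_inj j h := absurd h.1 (by omega)
  Q_const j h r := rfl
  pos_iff a b h := Iff.rfl
  key_lt a b c d _ _ h := h
  key_eq a b c d _ _ _ _ _ _ h := h
  generic a b c d _ _ h := absurd h (by omega)
  fwd p hp ε hε := ⟨p, hp, fun j => ⟨fun h => absurd h.1 (by omega), fun _ => rfl⟩⟩
  bwd p hp := ⟨p, hp, fun j => ⟨fun h => absurd h.1 (by omega), fun _ => rfl⟩⟩

namespace Stage

variable {A : AllowableSeq n k} {e : Equiv.Perm (Fin n)}

theorem eq_of_f_eq {i : ℕ} (S : A.Stage e i) {a b : S.ι} (h : S.f a = S.f b)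
    (hi : (e.symm (S.f a) : ℕ) < i) : a = b := by
  have key : ∀ r, S.Q (S.f a) r = S.Q (S.f a) 0 := by
    intro r
    have := S.Q_const (e.symm (S.f a)) (fun h => absurd h.1 (by omega)) r
    simpa using this
  obtain ⟨r, hr⟩ := S.Q_f a
  obtain ⟨q, hq⟩ := S.Q_f b
  rw [← hr, ← hq, ← h, key r, key q]

/-- A line through the next element that is not in general position is one of the lines `linesAt`. -/
theorem exists_line {j₀ : Fin n} (S : A.Stage e (j₀ + 1)) {x y c d : S.ι}
    (hx : S.f x = e j₀) (hyx : y ≠ x) (hcd : c ≠ d) (hkey : S.C.key y x = S.C.key c d)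
    (h1 : ¬ (c = y ∧ d = x)) (h2 : ¬ (c = x ∧ d = y)) :
    (e.symm (S.f y) : ℕ) < j₀ ∧ ∃ l ∈ A.linesAt e j₀, (l.1 : ℕ) = A.time (S.f y) (e j₀) := by
  have hxi : e.symm (S.f x) = j₀ := by simp [hx]
  have lt_of : ∀ a, (e.symm (S.f a) : ℕ) < j₀ + 1 → a ≠ x → (e.symm (S.f a) : ℕ) < j₀ := by
    intro a ha hax
    refine lt_of_le_of_ne (by omega) fun h => hax (S.eq_of_f_eq ?_ ha)
    have : e.symm (S.f a) = e.symm (S.f x) := by rw [hxi]; exact Fin.ext h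
    exact e.symm.injective this
  -- Genericity excludes treated elements from a coincidence. Of `y`, `c`, `d`, those different from
  -- `x` thus precede `e j₀`.
  have hy' : (e.symm (S.f y) : ℕ) < j₀ + 1 := by
    by_contra hcon
    rcases S.generic y x c d hyx hcd (by omega) hkey with h | h
    · exact h1 ⟨h.1.symm, h.2.symm⟩
    · exact h2 ⟨h.2.symm, h.1.symm⟩
  have hc' : (e.symm (S.f c) : ℕ) < j₀ + 1 := by
    by_contra hcon
    rcases S.generic c d y x hcd hyx (by omega) hkey.symm with h | h
    · exact h1 h
    · exact h2 h
  have hd' : (e.symm (S.f d) : ℕ) < j₀ + 1 := by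
    by_contra hcon
    rcases S.generic d c y x hcd.symm hyx (by omega) (by rw [S.valid.symm d c, hkey]) with h | h
    · exact h2 ⟨h.2, h.1⟩
    · exact h1 ⟨h.2, h.1⟩
  have hy := lt_of y hy' hyx
  refine ⟨hy, ?_⟩
  have mem : ∀ a, (e.symm (S.f a) : ℕ) < j₀ → S.f a ∈ before e j₀ := fun a ha =>
    ⟨e.symm (S.f a), ha, by simp⟩
  have nf : ∀ {a b : S.ι}, a ≠ b → (e.symm (S.f a) : ℕ) < j₀ + 1 → S.f a ≠ S.f b :=
    fun hab ha h => hab (S.eq_of_f_eq h ha)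
  have nyx : S.f y ≠ e j₀ := by rw [← hx]; exact nf hyx hy'
  have ncd := nf hcd hc'
  have ht : A.time (S.f c) (S.f d) = A.time (S.f y) (e j₀) := by
    have e1 : ∀ a b, A.conf.key a b = A.time a b := fun _ _ => rfl
    rcases lt_trichotomy (A.time (S.f c) (S.f d)) (A.time (S.f y) (e j₀)) with h | h | h
    · have := S.key_lt c d y x ncd (by rwa [hx]) (by rw [hx, e1, e1]; exact_mod_cast h)
      exact absurd hkey this.ne'
    · exact h
    · have := S.key_lt y x c d (by rwa [hx]) ncd (by rw [hx, e1, e1]; exact_mod_cast h)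
      exact absurd hkey this.ne
  set t : Fin k := ⟨A.time (S.f y) (e j₀), A.time_lt nyx⟩ with htdef
  have syx : A.Switched t (S.f y) (e j₀) := (A.switched_iff nyx t).2 rfl
  have scd : A.Switched t (S.f c) (S.f d) := (A.switched_iff ncd t).2 ht.symm
  refine ⟨A.line t (S.f y), ⟨?_, Or.inr syx⟩, rfl⟩
  -- a second previous element on the line
  have third : ∀ z, z ≠ x → (e.symm (S.f z) : ℕ) < j₀ + 1 → A.Switched t (S.f y) (S.f z) →
      A.line t (S.f y) ∈ A.linesSpannedBy (before e j₀) (A.activePoints (before e j₀)) :=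
    fun z hz hz' hs => Or.inl ⟨t, _, mem y hy, _, mem z (lt_of z hz' hz), hs, rfl⟩
  have trans : ∀ z, z ≠ y → (e.symm (S.f z) : ℕ) < j₀ + 1 → A.Switched t (S.f z) (e j₀) →
      A.Switched t (S.f y) (S.f z) := fun z hz hz' hs =>
    Reversed.trans_of_isMove (A.isMove t) (Reversed.symm syx) (Reversed.symm hs)
      (nf hz hz').symm
  by_cases hcx : c = x
  · subst hcx
    have hdy : d ≠ y := fun h => h2 ⟨rfl, h⟩
    refine third d hcd.symm hd' (trans d hdy hd' ?_)
    rw [← hx]; exact Reversed.symm scd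
  by_cases hdx : d = x
  · subst hdx
    have hcy : c ≠ y := fun h => h1 ⟨h, rfl⟩
    refine third c hcd hc' (trans c hcy hc' ?_)
    rw [← hx]; exact scd
  by_cases hyc : y = c
  · subst hyc
    exact third d hdx hd' scd
  by_cases hs : A.Switched t (S.f y) (S.f c)
  · exact third c hcx hc' hs
  -- The lines `yx` and `cd` are now different with a common point at infinity. That point is
  -- active, and it is determined by the earlier elements `c` and `d`.
  · refine Or.inr ⟨S.f y, mem y hy, t, ⟨?_, A.line t (S.f c), ?_, rfl⟩, rfl⟩
    · refine ⟨A.line t (S.f c), ⟨t, _, trivial, _, trivial, scd, rfl⟩,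
        A.line t (S.f y), ⟨t, _, trivial, _, trivial, syx, rfl⟩, ?_, rfl, rfl⟩
      intro hEq
      have h3 : S.f c ∈ (A.line t (S.f y)).2 := by
        rw [← hEq]; exact Or.inl rfl
      rcases h3 with h3 | h3
      · exact nf (Ne.symm hyc) hc' h3
      · exact hs h3
    · exact ⟨t, _, mem c (lt_of c hc' hcx), _, mem d (lt_of d hd' hdx), scd, rfl⟩

/-- At most two lines through the next element are not in general position. -/
theorem exists_two_slopes {j₀ : Fin n} (S : A.Stage e (j₀ + 1)) {x : S.ι} (hx : S.f x = e j₀)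
    (hcard : (A.linesAt e j₀).ncard ≤ 2) (hne : (A.linesAt e j₀).Nonempty) :
    ∃ y, y ≠ x ∧ ∃ s : ℝ, ∀ j c d, j ≠ x → c ≠ x → d ≠ x → c ≠ d → S.C.key j x = S.C.key c d →
      S.C.key j x = S.C.key y x ∨ S.C.key j x = s := by
  let Bad : S.ι → Prop := fun j => j ≠ x ∧ ∃ c d, c ≠ x ∧ d ≠ x ∧ c ≠ d ∧ S.C.key j x = S.C.key c d
  have hline : ∀ j, Bad j → (e.symm (S.f j) : ℕ) < j₀ ∧
      ∃ l ∈ A.linesAt e j₀, (l.1 : ℕ) = A.time (S.f j) (e j₀) := by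
    rintro j ⟨hj, c, d, hc, hd, hcd, hk⟩
    exact S.exists_line hx hj hcd hk (fun h => hd h.2) (fun h => hc h.1)
  have hxi : (e.symm (S.f x) : ℕ) < j₀ + 1 := by simp [hx]
  -- Different special slopes at `x` belong to different points at infinity, hence to different
  -- members of `linesAt`; three of them would exceed the bound.
  have hdist : ∀ j j', Bad j → Bad j' → A.time (S.f j) (e j₀) = A.time (S.f j') (e j₀) →
      S.C.key j x = S.C.key j' x := by
    intro j j' hj hj' ht
    have b1 := (hline j hj).1
    have b2 := (hline j' hj').1
    refine S.key_eq _ _ _ _ (by omega) hxi (by omega) hxi ?_ ?_ ?_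
    · exact fun h => hj.1 (S.eq_of_f_eq h (by omega))
    · exact fun h => hj'.1 (S.eq_of_f_eq h (by omega))
    · rw [hx]
      have e1 : ∀ a b, A.conf.key a b = A.time a b := fun _ _ => rfl
      rw [e1, e1, ht]
  by_cases hex : ∃ y, Bad y
  · obtain ⟨y, hy⟩ := hex
    refine ⟨y, hy.1, ?_⟩
    by_cases hex' : ∃ z, Bad z ∧ S.C.key z x ≠ S.C.key y x
    · obtain ⟨z, hz, hzy⟩ := hex'
      refine ⟨S.C.key z x, fun j c d hj hc hd hcd hk => ?_⟩
      by_contra hcon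
      push Not at hcon
      have hjb : Bad j := ⟨hj, c, d, hc, hd, hcd, hk⟩
      obtain ⟨-, l1, m1, t1⟩ := hline y hy
      obtain ⟨-, l2, m2, t2⟩ := hline z hz
      obtain ⟨-, l3, m3, t3⟩ := hline j hjb
      have : 2 < (A.linesAt e j₀).ncard := by
        rw [Set.two_lt_ncard_iff (Set.toFinite _)]
        refine ⟨l1, l2, l3, m1, m2, m3, ?_, ?_, ?_⟩
        · rintro rfl; exact hzy (hdist _ _ hz hy (t2.symm.trans t1))
        · rintro rfl; exact hcon.1 (hdist _ _ hjb hy (t3.symm.trans t1))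
        · rintro rfl; exact hcon.2 (hdist _ _ hjb hz (t3.symm.trans t2))
      omega
    · push Not at hex'
      exact ⟨0, fun j c d hj hc hd hcd hk => Or.inl (hex' j ⟨hj, c, d, hc, hd, hcd, hk⟩)⟩
  -- Without a coincidence any earlier element can serve as `y`; a line in `linesAt` supplies one.
  · obtain ⟨l, hl, -⟩ := hne
    obtain ⟨a, j, hj, rfl⟩ : ∃ a, a ∈ before e j₀ := by
      rcases hl with ⟨t, a, ha, -⟩ | ⟨a, ha, -⟩
      · exact ⟨a, ha⟩
      · exact ⟨a, ha⟩
    refine ⟨S.Q (e j) 0, ?_, 0, fun i c d hi hc hd hcd hk => absurd ⟨i, hi, c, d, hc, hd, hcd, hk⟩ hex⟩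
    intro h
    have := S.f_Q (e j) 0
    rw [h, hx] at this
    exact hj.ne (e.injective this).symm

/-- An element that lies on no line needs no treatment. -/
theorem keep {j₀ : Fin n} (S : A.Stage e (j₀ + 1)) (h0 : A.linesAt e j₀ = ∅) :
    Nonempty (A.Stage e j₀) := by
  have hrep : ∀ j, A.Replaced e j₀ j ↔ A.Replaced e (j₀ + 1) j := by
    intro j
    unfold Replaced
    constructor
    · rintro ⟨h1, h2⟩
      refine ⟨lt_of_le_of_ne h1 fun h => ?_, h2⟩
      rw [← Fin.ext h, h0] at h2
      exact Set.not_nonempty_empty h2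
    · rintro ⟨h1, h2⟩
      exact ⟨by omega, h2⟩
  refine ⟨⟨S.ι, S.finite, S.C, S.f, S.Q, S.valid, S.Q_f, S.f_Q, ?_, ?_, S.pos_iff, S.key_lt, ?_,
    ?_, ?_, ?_⟩⟩
  · simpa only [hrep] using S.Q_inj
  · simpa only [hrep] using S.Q_const
  · intro a b c d ha hb hc hd
    exact S.key_eq a b c d (by omega) (by omega) (by omega) (by omega)
  · intro a b c d hab hcd ha hk
    by_cases ha' : (j₀ : ℕ) + 1 ≤ e.symm (S.f a)
    · exact S.generic a b c d hab hcd ha' hk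
    -- Only the newly admitted element `e j₀` is at issue; a coincidence there would produce a
    -- member of `linesAt`.
    · have hfa : S.f a = e j₀ := by
        rw [← Equiv.symm_apply_eq]; exact Fin.ext (by omega)
      by_contra hcon
      obtain ⟨-, l, hl, -⟩ := S.exists_line hfa hab.symm hcd (by rw [S.valid.symm b a, hk])
        (fun h => hcon (Or.inr ⟨h.2.symm, h.1.symm⟩)) (fun h => hcon (Or.inl ⟨h.1.symm, h.2.symm⟩))
      rw [h0] at hl
      exact hl
  · simpa only [hrep] using S.fwd
  · simpa only [hrep] using S.bwd

open Classical in
/-- An element that lies on one or two lines is replaced by four elements. -/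
theorem replace {j₀ : Fin n} (S : A.Stage e (j₀ + 1)) (hcard : (A.linesAt e j₀).ncard ≤ 2)
    (hne : (A.linesAt e j₀).Nonempty) : Nonempty (A.Stage e j₀) := by
  have := S.finite
  set x := S.Q (e j₀) 0 with hxdef
  have hx : S.f x = e j₀ := S.f_Q _ _
  have hxi : (e.symm (S.f x) : ℕ) < j₀ + 1 := by simp [hx]
  obtain ⟨y, hyx, s, hbad⟩ := S.exists_two_slopes hx hcard hne
  -- The parameters are fixed once for the abstract data; they only serve to define an order type.
  obtain ⟨ρ, hρ⟩ := (Conf.eventually_small S.valid x y).exists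
  obtain ⟨δ, hs⟩ := hρ.exists
  have hxne : ∀ {a}, S.f a = e j₀ → a = x := fun {a} ha =>
    S.eq_of_f_eq (ha.trans hx.symm) (by simp [ha])
  have hQne : ∀ {j : Fin n} (_ : j ≠ e j₀) r, S.Q j r ≠ x := by
    intro j hj r h
    apply hj
    rw [← S.f_Q j r, h, hx]
  have hrep : ∀ j, j ≠ j₀ → (A.Replaced e j₀ j ↔ A.Replaced e (j₀ + 1) j) := by
    intro j hj
    unfold Replaced
    have : (j₀ : ℕ) ≤ j ↔ (j₀ : ℕ) + 1 ≤ j :=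
      ⟨fun h => lt_of_le_of_ne h fun h' => hj (Fin.ext h'.symm), fun h => by omega⟩
    rw [this]
  have hrep0 : A.Replaced e j₀ j₀ := ⟨le_rfl, hne⟩
  have hrep1 : ¬ A.Replaced e (j₀ + 1) j₀ := fun h => absurd h.1 (by omega)
  let Q' : Fin n → Fin 4 → {a // a ≠ x} ⊕ Fin 4 := fun j r =>
    if hj : j = e j₀ then .inr r else .inl ⟨S.Q j r, hQne hj r⟩
  have Q'0 : ∀ r, Q' (e j₀) r = .inr r := fun r => by simp only [Q', dif_pos]
  have Q'1 : ∀ j, (hj : j ≠ e j₀) → ∀ r, Q' j r = .inl ⟨S.Q j r, hQne hj r⟩ :=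
    fun j hj r => by simp only [Q', dif_neg hj]
  let f' : {a // a ≠ x} ⊕ Fin 4 → Fin n := fun a => S.f (Conf.extBase x a)
  have fne : ∀ {a b}, f' a ≠ f' b → Conf.extBase x a ≠ Conf.extBase x b :=
    fun h h' => h (congrArg S.f h')
  have f'r : ∀ r, (e.symm (f' (.inr r)) : ℕ) = j₀ := fun r => by
    simp only [f', Conf.extBase, Sum.elim_inr, hx, Equiv.symm_apply_apply]
  refine ⟨⟨{a // a ≠ x} ⊕ Fin 4, inferInstance, S.C.ext x y ρ δ, f', Q', Conf.ext_valid S.valid hs,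
    ?_, ?_, ?_, ?_, ?_, ?_, ?_, ?_, ?_, ?_⟩⟩
  · rintro (a | r)
    · have ha : S.f a ≠ e j₀ := fun h => a.2 (hxne h)
      obtain ⟨r, hr⟩ := S.Q_f a
      refine ⟨r, ?_⟩
      simp only [f', Conf.extBase, Sum.elim_inl, Q'1 _ ha]
      simp only [hr]
    · refine ⟨r, ?_⟩
      simp only [f', Conf.extBase, Sum.elim_inr, hx, Q'0]
  · intro j r
    by_cases hj : j = e j₀
    · subst hj; rw [Q'0]; simp [f', Conf.extBase, hx]
    · rw [Q'1 j hj]; simp [f', Conf.extBase, S.f_Q]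
  · intro j hj r q h
    by_cases hj0 : j = j₀
    · subst hj0
      rw [Q'0, Q'0] at h
      exact Sum.inr_injective h
    · have hj1 : e j ≠ e j₀ := e.injective.ne hj0
      rw [Q'1 _ hj1, Q'1 _ hj1] at h
      exact S.Q_inj j ((hrep j hj0).1 hj) (congrArg Subtype.val (Sum.inl_injective h))
  · intro j hj r
    have hj0 : j ≠ j₀ := by rintro rfl; exact hj hrep0
    have hj1 : e j ≠ e j₀ := e.injective.ne hj0
    have := S.Q_const j (mt (hrep j hj0).2 hj) r
    simp only [Q'1 _ hj1, this]
  · intro a b hab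
    rw [Conf.ext_pos_lt_iff S.valid hs (fne hab)]
    exact S.pos_iff _ _ hab
  · intro a b c d hab hcd h
    exact Conf.ext_key_lt S.valid hs (fne hab) (fne hcd) (S.key_lt _ _ _ _ hab hcd h)
  · have hinr : ∀ r, ¬ (e.symm (f' (.inr r)) : ℕ) < j₀ := fun r => by rw [f'r]; omega
    rintro (a | r) (b | r') (c | q) (d | q') ha hb hc hd hab hcd h <;>
      first
        | exact absurd ha (hinr _)
        | exact absurd hb (hinr _)
        | exact absurd hc (hinr _)
        | exact absurd hd (hinr _)
        | skip
    rw [Conf.ext_key_old, Conf.ext_key_old]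
    have lt' : ∀ {z : ℕ}, z < j₀ → z < j₀ + 1 := fun h => by omega
    exact S.key_eq _ _ _ _ (lt' ha) (lt' hb) (lt' hc) (lt' hd) hab hcd h
  · intro a b c d hab hcd ha hk
    have hsame := Conf.ext_key_ne S.valid hs (extPair_proper hab) (extPair_proper hcd) hk
    rcases a with a | r <;> rcases b with b | r' <;> rcases c with c | q <;> rcases d with d | q' <;>
      simp only [extPair, ExtPair.Same] at hsame
    · have ha' : (j₀ : ℕ) + 1 ≤ e.symm (S.f a) := by
        refine lt_of_le_of_ne ha fun h => a.2 (hxne ?_)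
        rw [← Equiv.symm_apply_eq]; exact Fin.ext h.symm
      rcases S.generic a b c d (fun h => hab (congrArg Sum.inl (Subtype.ext h)))
        (fun h => hcd (congrArg Sum.inl (Subtype.ext h))) ha' hsame with h | h
      · exact Or.inl ⟨congrArg Sum.inl (Subtype.ext h.1), congrArg Sum.inl (Subtype.ext h.2)⟩
      · exact Or.inr ⟨congrArg Sum.inl (Subtype.ext h.1), congrArg Sum.inl (Subtype.ext h.2)⟩
    · exact Or.inl ⟨congrArg Sum.inl hsame.1, congrArg Sum.inr hsame.2⟩
    · exact Or.inr ⟨congrArg Sum.inl hsame.1, congrArg Sum.inr hsame.2⟩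
    · exact Or.inr ⟨congrArg Sum.inr hsame.2, congrArg Sum.inl hsame.1⟩
    · exact Or.inl ⟨congrArg Sum.inr hsame.2, congrArg Sum.inl hsame.1⟩
    · rcases hsame with h | h
      · exact Or.inl ⟨congrArg Sum.inr h.1, congrArg Sum.inr h.2⟩
      · exact Or.inr ⟨congrArg Sum.inr h.1, congrArg Sum.inr h.2⟩
  · intro p hp ε hε
    obtain ⟨q, hq, hqj⟩ := S.fwd p hp ε hε
    obtain ⟨v, hv, hv1, hv2, hv3⟩ := hq.exists_quad S.valid hs hyx hε
    -- In the previous stage `e j₀` is not yet replaced, so `q x` is the original point and the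
    -- bounds refer to it.
    rw [hxdef, (hqj j₀).2 hrep1] at hv1 hv2
    refine ⟨Sum.elim (fun j => q j) v, hv, fun j => ?_⟩
    by_cases hj0 : j = j₀
    · subst hj0
      simp only [Q'0, Sum.elim_inr]
      exact ⟨fun _ => ⟨hv1, hv2, hv3⟩, fun h => absurd hrep0 h⟩
    · simp only [Q'1 _ (e.injective.ne hj0), Sum.elim_inl, hrep j hj0]
      exact hqj j
  · intro q hq
    obtain ⟨c, hc, hc1, hc2⟩ := hq.exists_center S.valid hs hyx hbad
    obtain ⟨p, hp, hpj⟩ := S.bwd _ hc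
    refine ⟨p, hp, fun j => ?_⟩
    have hpj' := hpj j
    by_cases hj0 : j = j₀
    · subst hj0
      have := hpj'.2 hrep1
      rw [← hxdef, dif_pos rfl] at this
      simp only [Q'0]
      rw [← this]
      exact ⟨fun _ => ⟨hc1, hc2⟩, fun h => absurd hrep0 h⟩
    · have hj1 := e.injective.ne hj0
      simp only [dif_neg (hQne hj1 _)] at hpj'
      simp only [Q'1 _ hj1, hrep j hj0]
      exact hpj'

end Stage

/-- All elements can be treated. -/
theorem exists_stage (A : AllowableSeq n k) {e : Equiv.Perm (Fin n)}
    (he : A.IsConstructibilityOrder e) : Nonempty (A.Stage e 0) := by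
  -- The last elements come first: when `e j₀` is treated, all later ones are already in general
  -- position, so only the lines counted by the constructibility order matter.
  have key : ∀ d ≤ n, Nonempty (A.Stage e (n - d)) := by
    intro d
    induction d with
    | zero => exact fun _ => ⟨Stage.init A e⟩
    | succ d ih =>
      intro hd
      obtain ⟨S⟩ := ih (by omega)
      let j₀ : Fin n := ⟨n - (d + 1), by omega⟩
      have h : n - d = j₀ + 1 := by simp only [j₀]; omega
      rw [h] at S
      rcases Set.eq_empty_or_nonempty (A.linesAt e j₀) with h0 | h0
      · exact S.keep h0
      · exact S.replace (he j₀) h0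
  have := key n le_rfl
  rwa [Nat.sub_self] at this

end AllowableSeq

/-! ### Conclusion: the simple allowable sequence of the final stage -/

theorem Conf.realized_comap_iff {ι κ : Type} (C : Conf ι) (g : κ ≃ ι) (p : ι → Plane) :
    (C.comap g).Realized (p ∘ g) ↔ C.Realized p := by
  refine ⟨fun h => ?_, fun h => h.comap g.injective⟩
  have := h.comap g.symm.injective
  have e1 : (C.comap g).comap g.symm = C := by
    cases C; simp [Conf.comap]
  have e2 : (p ∘ g) ∘ g.symm = p := by ext1; simp
  rwa [e1, e2] at this

theorem mainTheorem5 {n k : ℕ} (A : AllowableSeq n k) (hA : A.Constructible) :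
    ∀ e : Equiv.Perm (Fin n), A.IsConstructibilityOrder e →
    ∃ (m k' : ℕ) (A' : AllowableSeq m k') (f : Fin m → Fin n),
      A'.IsSimple ∧
      (A'.Realizable ↔ A.Realizable) ∧
      -- one element for each element on no line, four for each element on one or two lines
      (∀ i : Fin n, A.linesAt e i = ∅ → {a | f a = e i}.ncard = 1) ∧
      (∀ i : Fin n, (A.linesAt e i).Nonempty → {a | f a = e i}.ncard = 4) ∧
      A'.IsPerturbation A f ∧
      -- from every realization of `A` by replacing points by small perturbed parallelograms
      (∀ p : Fin n → Plane, A.Realizes p → ∀ ε : ℝ, 0 < ε →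
        ∃ p' : Fin m → Plane, A'.Realizes p' ∧
          (∀ i : Fin n, A.linesAt e i = ∅ → ∀ a, f a = e i → p' a = p (e i)) ∧
          (∀ i : Fin n, (A.linesAt e i).Nonempty →
            (∀ a, f a = e i → dist (p' a) (p (e i)) < ε) ∧
            p (e i) ∈ interior (convexHull ℝ (p' '' {a | f a = e i})) ∧
            ∃ q : Fin 4 → Fin m, Function.Injective q ∧ Set.range q = {a | f a = e i} ∧
              IsPerturbedParallelogram ε (p' ∘ q))) ∧
      -- from every realization of `A'` by putting the replaced points back
      (∀ p' : Fin m → Plane, A'.Realizes p' →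
        ∃ p : Fin n → Plane, A.Realizes p ∧
          (∀ i : Fin n, A.linesAt e i = ∅ → ∀ a, f a = e i → p (e i) = p' a) ∧
          (∀ i : Fin n, (A.linesAt e i).Nonempty →
            ConvexIndependent ℝ (fun a : {a // f a = e i} => p' a) ∧
            p (e i) ∈ interior (convexHull ℝ (p' '' {a | f a = e i})))) := by
  intro e he
  obtain ⟨S⟩ := A.exists_stage he
  have := S.finite
  have := Fintype.ofFinite S.ι
  have hg : S.C.Generic := fun a b c d hab hcd h => S.generic a b c d hab hcd (Nat.zero_le _) h
  obtain ⟨k', A', g, hsimple, hequiv⟩ := Conf.exists_simple S.valid hg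
  have hreal : ∀ p' : Fin (Fintype.card S.ι) → Plane,
      A'.Realizes p' ↔ S.C.Realized (p' ∘ g) := by
    intro p'
    rw [A'.realizes_iff, ← Conf.realized_comap_iff _ g]
    exact ⟨fun h => h.congr hequiv, fun h => h.congr hequiv.symm⟩
  let f : Fin (Fintype.card S.ι) → Fin n := fun a => S.f (g.symm a)
  have hrep : ∀ i, A.Replaced e 0 i ↔ (A.linesAt e i).Nonempty := fun i =>
    ⟨fun h => h.2, fun h => ⟨Nat.zero_le _, h⟩⟩
  have hrep' : ∀ i, A.linesAt e i = ∅ → ¬ A.Replaced e 0 i := fun i h => by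
    rw [hrep, h]; exact Set.not_nonempty_empty
  -- The fibre consists of the four slots of `e i`, which are equal or pairwise different according
  -- to whether `e i` is replaced; this gives the counts one and four.
  have hfib : ∀ i, {a | f a = e i} = Set.range fun r => g (S.Q (e i) r) := by
    intro i
    ext a
    constructor
    · intro ha
      obtain ⟨r, hr⟩ := S.Q_f (g.symm a)
      have ha : S.f (g.symm a) = e i := ha
      rw [ha] at hr
      exact ⟨r, by simp [hr]⟩
    · rintro ⟨r, rfl⟩
      change S.f (g.symm (g (S.Q (e i) r))) = e i
      rw [Equiv.symm_apply_apply, S.f_Q]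
  have hone : ∀ i, A.linesAt e i = ∅ → {a | f a = e i} = {g (S.Q (e i) 0)} := by
    intro i hi
    rw [hfib]
    simp only [S.Q_const i (hrep' i hi)]
    exact Set.range_const
  have hqinj : ∀ i, (A.linesAt e i).Nonempty → Function.Injective fun r => g (S.Q (e i) r) :=
    fun i hi => g.injective.comp (S.Q_inj i ((hrep i).2 hi))
  have himage : ∀ (p' : Fin (Fintype.card S.ι) → Plane) i, p' '' {a | f a = e i} =
      Set.range fun r => (p' ∘ g) (S.Q (e i) r) := by
    intro p' i
    rw [hfib, ← Set.range_comp]; rfl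
  have hfwd : ∀ p : Fin n → Plane, A.Realizes p → ∀ ε : ℝ, 0 < ε →
        ∃ p' : Fin (Fintype.card S.ι) → Plane, A'.Realizes p' ∧
          (∀ i : Fin n, A.linesAt e i = ∅ → ∀ a, f a = e i → p' a = p (e i)) ∧
          (∀ i : Fin n, (A.linesAt e i).Nonempty →
            (∀ a, f a = e i → dist (p' a) (p (e i)) < ε) ∧
            p (e i) ∈ interior (convexHull ℝ (p' '' {a | f a = e i})) ∧
            ∃ q : Fin 4 → Fin (Fintype.card S.ι), Function.Injective q ∧
              Set.range q = {a | f a = e i} ∧ IsPerturbedParallelogram ε (p' ∘ q)) := by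
    intro p hp ε hε
    obtain ⟨q, hq, hqj⟩ := S.fwd p ((A.realizes_iff p).1 hp) ε hε
    have hqg : (q ∘ g.symm) ∘ g = q := by ext1; simp
    refine ⟨q ∘ g.symm, (hreal _).2 (by rwa [hqg]), fun i hi a ha => ?_, fun i hi => ?_⟩
    · have ha : a ∈ {a | f a = e i} := ha
      rw [hone i hi] at ha
      rw [Set.mem_singleton_iff.1 ha]
      simpa using (hqj i).2 (hrep' i hi)
    · obtain ⟨h1, h2, h3⟩ := (hqj i).1 ((hrep i).2 hi)
      refine ⟨fun a ha => ?_, ?_, fun r => g (S.Q (e i) r), hqinj i hi, (hfib i).symm, ?_⟩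
      · have ha : a ∈ {a | f a = e i} := ha
        rw [hfib] at ha
        obtain ⟨r, rfl⟩ := ha
        simpa using h1 r
      · rw [himage, hqg]; exact h2
      · have : (q ∘ g.symm) ∘ (fun r => g (S.Q (e i) r)) = fun r => q (S.Q (e i) r) := by
          ext1; simp
        rw [this]; exact h3
  have hbwd : ∀ p' : Fin (Fintype.card S.ι) → Plane, A'.Realizes p' →
        ∃ p : Fin n → Plane, A.Realizes p ∧
          (∀ i : Fin n, A.linesAt e i = ∅ → ∀ a, f a = e i → p (e i) = p' a) ∧
          (∀ i : Fin n, (A.linesAt e i).Nonempty →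
            ConvexIndependent ℝ (fun a : {a // f a = e i} => p' a) ∧
            p (e i) ∈ interior (convexHull ℝ (p' '' {a | f a = e i}))) := by
    intro p' hp'
    obtain ⟨p, hp, hpj⟩ := S.bwd _ ((hreal p').1 hp')
    refine ⟨p, (A.realizes_iff p).2 hp, fun i hi a ha => ?_, fun i hi => ?_⟩
    · have ha : a ∈ {a | f a = e i} := ha
      rw [hone i hi] at ha
      rw [Set.mem_singleton_iff.1 ha]
      exact ((hpj i).2 (hrep' i hi)).symm
    · obtain ⟨h1, h2⟩ := (hpj i).1 ((hrep i).2 hi)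
      refine ⟨?_, by rw [himage]; exact h2⟩
      have hr : ∀ a : {a // f a = e i}, ∃ r, g (S.Q (e i) r) = a := by
        intro a
        have ha : (a : Fin _) ∈ {a | f a = e i} := a.2
        rw [hfib] at ha
        exact ha
      choose r hr using hr
      have rinj : Function.Injective r := fun a b hab => Subtype.ext (by rw [← hr a, ← hr b, hab])
      have h3 := h1.comp_embedding ⟨r, rinj⟩
      convert h3 using 1
      ext1 a
      simp [hr]
  refine ⟨_, k', A', f, hsimple, ⟨?_, ?_⟩, fun i hi => ?_, fun i hi => ?_, ⟨?_, ?_⟩, hfwd, hbwd⟩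
  · rintro ⟨p', hp'⟩
    obtain ⟨p, hp, -⟩ := hbwd p' hp'
    exact ⟨p, hp⟩
  · rintro ⟨p, hp⟩
    obtain ⟨p', hp', -⟩ := hfwd p hp 1 one_pos
    exact ⟨p', hp'⟩
  · rw [hone i hi, Set.ncard_singleton]
  · rw [hfib, ← Set.image_univ, Set.ncard_image_of_injective _ (hqinj i hi), Set.ncard_univ]
    simp
  · intro a b hab
    have h1 := hequiv.pos_iff (g.symm a) (g.symm b)
    have h2 := S.pos_iff (g.symm a) (g.symm b) hab
    simp only [Conf.comap, AllowableSeq.conf, Equiv.apply_symm_apply, Nat.cast_lt,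
      Fin.val_fin_lt] at h1 h2
    exact h1.trans h2
  · intro a b c d s t s' t' h1 h2 h3 h4 hst
    have ne : ∀ {a b}, a ≠ b → g.symm a ≠ g.symm b := fun h => g.symm.injective.ne h
    have h5 := S.key_lt (g.symm a) (g.symm b) (g.symm c) (g.symm d) h1.ne h2.ne (by
      change (A.time (f a) (f b) : ℝ) < A.time (f c) (f d)
      rw [h1.time_eq, h2.time_eq]
      exact_mod_cast hst)
    have h6 := (hequiv.key_iff _ _ _ _ (ne h3.ne) (ne h4.ne)).2 h5
    simp only [Conf.comap, AllowableSeq.conf, Equiv.apply_symm_apply, Nat.cast_lt] at h6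
    rw [h3.time_eq, h4.time_eq] at h6
    exact h6
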